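/- **Data.** Let $\ell\ge 1$, $T>0$, let $\Omega\subset\mathbb R^\ell$ be bounded, open and connected, and let $\Gamma_l\subset\partial\Omega$ be a Borel set of positive $(\ell-1)$-dimensional measure. Put $Q_T=(0,T)\times\Omega$. For the two phases $\alpha\in\{l,g\}$ (saturations $s_l+s_g=1$) assume: 1. the porosity $\phi$ is measurable with $0<\phi_0\le\phi\le\phi_1$ a.e. in $\Omega$; 2. the mobilities $M_\alpha:[0,1]\to[0,\infty)$ are continuous and non-decreasing, $M_\alpha(0)=0$, and $M(s):=M_l(s)+M_g(1-s)\ge m_0>0$ on $[0,1]$; they are extended to $\mathbb R$ by constants; 3. $f_P,f_I\in L^2(Q_T)$ are nonnegative a.e., and the injected saturations $s^I_\alpha$ are measurable on $Q_T$ with values in $[0,1]$ a.e.; 4. the densities $\rho_\alpha\in C^1(\mathbb R)$ are non-decreasing with $0<\rho_m\le\rho_\alpha\le\rho_M$; 5. the capillary pressure $p_c$, as a function of $s_l$, is nonnegative, decreasing and $C^1$ on $[0,1]$, $|p_c'|\ge \underline{p_c}>0$, and $p_c(1)=0$ (outside $[0,1]$ its values are arbitrary); 6. $\gamma(s)=-\frac{M_l(s)M_g(1-s)}{M(s)}p_c'(s)$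 is $C^1$ on $[0,1]$, positive on $(0,1)$, zero at $0$ and $1$, and the inverse of $\mathcal B(s)=\int_0^s\gamma(z)\,dz$ is Hölder continuous of some order $\theta\in(0,1]$ on $[0,\mathcal B(1)]$; 7. the initial pressures satisfy $p^0_\alpha\in L^2(\Omega)$, and the initial saturations $s^0_\alpha$ are measurable with $0\le s^0_\alpha\le1$ and $s^0_l+s^0_g=1$ a.e.; ${\bf g}\in\mathbb R^\ell$ is the gravity vector. Put $\bar p(s)=\int_0^s\frac{M_g(1-z)}{M(z)}p_c'(z)\,dz$ and $\tilde p(s)=-\int_0^s\frac{M_l(z)}{M(z)}p_c'(z)\,dz$. **Mesh.** Fix $\xi>0$. An admissible mesh consists of finitely many pairwise disjoint bounded open convex polytopes $K\subset\Omega$ (set $\mathcal T$) with $\overline{\bigcup K}=\overline\Omega$, and centres $x_K\in K$. The set $N(K)$ consists of the $L\ne K$ for which $\sigma_{K|L}=\overline K\cap\overline L$ has positive $(\ell-1)$-measure $|\sigma_{K|L}|$. It is required that $\partial K=(\overline K\cap\partial\Omega)\cup\bigcup_{L\in N(K)}\sigma_{K|L}$, that $x_L-x_K\perp\sigma_{K|L}$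 for $L\in N(K)$, and that $\sum_{L\in N(K)}|\sigma_{K|L}|d_{K|L}\le\xi|K|$, where $d_{K|L}=|x_K-x_L|$. For every $K$, the set $\overline K\cap\Gamma_l$ is, up to $(\ell-1)$-null sets, the union of finitely many Borel sets $\sigma$ (exterior Dirichlet faces of $K$) of positive $(\ell-1)$-measure that overlap only in null sets; each lies in a hyperplane, at distance $d_{K,\sigma}>0$ from $x_K$, with unit normal $\eta_{K,\sigma}$ outward to $K$. Put $\tau_{K|L}=|\sigma_{K|L}|/d_{K|L}$, $\tau_{K,\sigma}=|\sigma|/d_{K,\sigma}$, and let $\eta_{K|L}$ be the unit normal to $\sigma_{K|L}$ outward to $K$. Let $\mathcal N(K)$ denote $N(K)$ together with the exterior Dirichlet faces of $K$; on an exterior face the exterior state "$L$" is $p_{l,L}=p_{g,L}=0$, $s_{l,L}=1$, $s_{g,L}=0$, and $d_{K|L},\tau_{K|L},\eta_{K|L},\sigma_{K|L}$ stand for $d_{K,\sigma},\tau_{K,\sigma},\eta_{K,\sigma},\sigma$. **Scheme.** Let $N\ge0$ be an integer, $\delta t=T/(N+1)$, $t^n=n\,\delta t$, and $\delta^{n+1}_{K|L}(u)=u_L^{n+1}-u_K^{n+1}$.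 A solution is a family $(p^n_{\alpha,K},s^n_{\alpha,K})_{K\in\mathcal T,\,0\le n\le N+1}$ such that $p^0_{\alpha,K},s^0_{\alpha,K}$ are the means of $p^0_\alpha,s^0_\alpha$ over $K$ and, for $0\le n\le N$, all $K$ and both $\alpha$, $s^{n+1}_{l,K}+s^{n+1}_{g,K}=1$, $p_c(s_{l,K}^{n+1})=p_{g,K}^{n+1}-p_{l,K}^{n+1}$ and $$|K|\phi_K\frac{\rho_\alpha(p^{n+1}_{\alpha,K})s^{n+1}_{\alpha,K}-\rho_\alpha(p^{n}_{\alpha,K})s^{n}_{\alpha,K}}{\delta t}+\sum_{L\in\mathcal N(K)}\Big(-\tau_{K|L}\,\rho^{n+1}_{\alpha,K|L}M^{n+1}_{\alpha,K|L}\,\delta^{n+1}_{K|L}(p_\alpha)+F^{n+1}_{\alpha,K|L}\Big)+|K|\rho_\alpha(p^{n+1}_{\alpha,K})s^{n+1}_{\alpha,K}f^{n+1}_{P,K}=|K|\rho_\alpha(p^{n+1}_{\alpha,K})(s^I_{\alpha,K})^{n+1}f^{n+1}_{I,K},$$ where $\phi_K$ is the mean of $\phi$ over $K$, the quantities $f^{n+1}_{P,K},f^{n+1}_{I,K},(s^I_{\alpha,K})^{n+1}$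 are the means over $(t^n,t^{n+1})\times K$, the upwind mobility $M^{n+1}_{\alpha,K|L}$ is $M_\alpha(s^{n+1}_{\alpha,K})$ if $\delta^{n+1}_{K|L}(p_\alpha)\le0$ and $M_\alpha(s^{n+1}_{\alpha,L})$ otherwise, $1/\rho^{n+1}_{\alpha,K|L}$ is the mean value of $1/\rho_\alpha$ between $p^{n+1}_{\alpha,K}$ and $p^{n+1}_{\alpha,L}$ (its value at that point if they coincide), and $F^{n+1}_{\alpha,K|L}=|\sigma_{K|L}|(\rho^{n+1}_{\alpha,K|L})^2\big(M_\alpha(s^{n+1}_{\alpha,K})({\bf g}\cdot\eta_{K|L})^+-M_\alpha(s^{n+1}_{\alpha,L})({\bf g}\cdot\eta_{K|L})^-\big)$. **Statement.** For all data as above and every $\xi>0$ there is a constant $C>0$, depending on the data and $\xi$ only, such that for every admissible mesh, every $N\ge0$ and every solution of the scheme, $$\sum_{n=0}^{N}\delta t\sum_{K\in\mathcal T}\sum_{L\in\mathcal N(K)}\tau_{K|L}\big(\delta^{n+1}_{K|L}(\mathcal B(s_l))\big)^2\le C,$$ $$\sum_{n=0}^{N}\delta t\sum_{K\in\mathcal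 T}\sum_{L\in\mathcal N(K)}\tau_{K|L}M^{n+1}_{l,K|L}\big(\delta^{n+1}_{K|L}(\bar p(s_l))\big)^2\le C,$$ $$\sum_{n=0}^{N}\delta t\sum_{K\in\mathcal T}\sum_{L\in\mathcal N(K)}\tau_{K|L}M^{n+1}_{g,K|L}\big(\delta^{n+1}_{K|L}(\tilde p(s_l))\big)^2\le C.$$ In particular the same bounds hold with $N(K)$ in place of $\mathcal N(K)$. -/

import Mathlib

open scoped MeasureTheory RealInnerProductSpace

noncomputable section

namespace TwoPhase

/-! ### Continuous data -/

/-- The ambient space `ℝ^ℓ` with its Euclidean structure. -/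
abbrev Space (ℓ : ℕ) : Type := EuclideanSpace ℝ (Fin ℓ)

/-- The two phases: `l` is the wetting (liquid) phase, `g` the non-wetting (gas) phase. -/
inductive Phase : Type
  | l
  | g

/-- The data of the compressible immiscible two-phase flow problem. A point of space-time is a pair
`(t, x)`. The functions `M α` and `pc` of the saturation are only relevant on `[0,1]`. -/
structure FlowData (ℓ : ℕ) where
  /-- the porous medium -/
  Ω : Set (Space ℓ)
  /-- the part of the boundary of `Ω` where both pressures are prescribed to be `0` -/
  Γ : Set (Space ℓ)
  /-- final time -/
  T : ℝ
  /-- porosity -/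
  φ : Space ℓ → ℝ
  /-- mobilities, each as a function of the saturation of its own phase -/
  M : Phase → ℝ → ℝ
  /-- densities -/
  ρ : Phase → ℝ → ℝ
  /-- capillary pressure, as a function of the saturation of the phase `l` -/
  pc : ℝ → ℝ
  /-- gravity vector -/
  grav : Space ℓ
  /-- production term -/
  fP : ℝ × Space ℓ → ℝ
  /-- injection term -/
  fI : ℝ × Space ℓ → ℝ
  /-- saturations of the injected fluid -/
  sI : Phase → ℝ × Space ℓ → ℝ
  /-- initial pressures -/
  p0 : Phase → Space ℓ → ℝ
  /-- initial saturations -/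
  s0 : Phase → Space ℓ → ℝ

namespace FlowData

variable {ℓ : ℕ} (D : FlowData ℓ)

/-- Total mobility as a function of the saturation `z` of the phase `l`; the other saturation is
`1 - z`. -/
def totalMobility (z : ℝ) : ℝ := D.M .l z + D.M .g (1 - z)

/-- The derivative of the capillary pressure on `[0,1]` (one-sided at the end points). -/
def dpc (z : ℝ) : ℝ := derivWithin D.pc (Set.Icc 0 1) z

/-- The artificial pressure `p̃`. -/
def pTilde (s : ℝ) : ℝ := -∫ z in (0 : ℝ)..s, D.M .l z / D.totalMobility z * D.dpc z

/-- The artificial pressure `p̄`. -/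
def pBar (s : ℝ) : ℝ := ∫ z in (0 : ℝ)..s, D.M .g (1 - z) / D.totalMobility z * D.dpc z

/-- The capillary term `γ`. -/
def gam (s : ℝ) : ℝ := -(D.M .l s * D.M .g (1 - s) / D.totalMobility s * D.dpc s)

/-- The primitive `𝓑` of the capillary term. -/
def calB (s : ℝ) : ℝ := ∫ z in (0 : ℝ)..s, D.gam z

/-- Lebesgue measure on the space-time cylinder `(0,T) × Ω`. -/
def cylinderMeasure : MeasureTheory.Measure (ℝ × Space ℓ) :=
  MeasureTheory.volume.restrict (Set.Ioo 0 D.T ×ˢ D.Ω)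

/-- Standing assumptions on the data. -/
structure Assumptions : Prop where
  -- geometry and final time
  isOpen_Ω : IsOpen D.Ω
  isBounded_Ω : Bornology.IsBounded D.Ω
  isConnected_Ω : IsConnected D.Ω
  Γ_subset : D.Γ ⊆ frontier D.Ω
  Γ_measurable : MeasurableSet D.Γ
  Γ_pos : 0 < μHE[ℓ - 1] D.Γ
  T_pos : 0 < D.T
  -- porosity
  φ_meas : MeasureTheory.AEStronglyMeasurable D.φ (MeasureTheory.volume.restrict D.Ω)
  φ_bounds : ∃ φ₀ φ₁ : ℝ, 0 < φ₀ ∧ 0 < φ₁ ∧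
    ∀ᵐ x ∂(MeasureTheory.volume.restrict D.Ω), φ₀ ≤ D.φ x ∧ D.φ x ≤ φ₁
  -- mobilities
  M_cont : ∀ α, ContinuousOn (D.M α) (Set.Icc 0 1)
  M_nonneg : ∀ α, ∀ s ∈ Set.Icc (0 : ℝ) 1, 0 ≤ D.M α s
  M_zero : ∀ α, D.M α 0 = 0
  M_mono : ∀ α, MonotoneOn (D.M α) (Set.Icc 0 1)
  M_lower : ∃ m₀ : ℝ, 0 < m₀ ∧ ∀ s ∈ Set.Icc (0 : ℝ) 1, m₀ ≤ D.totalMobility s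
  -- source terms
  fP_memLp : MeasureTheory.MemLp D.fP 2 D.cylinderMeasure
  fI_memLp : MeasureTheory.MemLp D.fI 2 D.cylinderMeasure
  fP_nonneg : ∀ᵐ z ∂D.cylinderMeasure, 0 ≤ D.fP z
  fI_nonneg : ∀ᵐ z ∂D.cylinderMeasure, 0 ≤ D.fI z
  sI_meas : ∀ α, MeasureTheory.AEStronglyMeasurable (D.sI α) D.cylinderMeasure
  sI_mem : ∀ α, ∀ᵐ z ∂D.cylinderMeasure, D.sI α z ∈ Set.Icc (0 : ℝ) 1
  -- densities
  ρ_contDiff : ∀ α, ContDiff ℝ 1 (D.ρ α)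
  ρ_mono : ∀ α, Monotone (D.ρ α)
  ρ_bounds : ∃ ρm ρM : ℝ, 0 < ρm ∧ 0 < ρM ∧ ∀ α p, ρm ≤ D.ρ α p ∧ D.ρ α p ≤ ρM
  -- capillary pressure; `pc 1 = 0` is the compatibility of the capillary law with the boundary
  -- condition (both pressures vanish on `Γ`)
  pc_contDiff : ContDiffOn ℝ 1 D.pc (Set.Icc 0 1)
  pc_nonneg : ∀ s ∈ Set.Icc (0 : ℝ) 1, 0 ≤ D.pc s
  pc_anti : StrictAntiOn D.pc (Set.Icc 0 1)
  pc_deriv : ∃ c : ℝ, 0 < c ∧ ∀ s ∈ Set.Icc (0 : ℝ) 1, c ≤ |D.dpc s|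
  pc_one : D.pc 1 = 0
  -- capillary term
  gam_contDiff : ContDiffOn ℝ 1 D.gam (Set.Icc 0 1)
  gam_pos : ∀ s ∈ Set.Ioo (0 : ℝ) 1, 0 < D.gam s
  gam_zero : D.gam 0 = 0
  gam_one : D.gam 1 = 0
  calB_inv : ∃ Binv : ℝ → ℝ, (∀ s ∈ Set.Icc (0 : ℝ) 1, Binv (D.calB s) = s) ∧
    ∃ c θ : ℝ, 0 < c ∧ 0 < θ ∧ θ ≤ 1 ∧
      ∀ a ∈ Set.Icc 0 (D.calB 1), ∀ b ∈ Set.Icc 0 (D.calB 1),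
        |Binv a - Binv b| ≤ c * |a - b| ^ θ
  -- initial data
  p0_memLp : ∀ α, MeasureTheory.MemLp (D.p0 α) 2 (MeasureTheory.volume.restrict D.Ω)
  s0_meas : ∀ α, MeasureTheory.AEStronglyMeasurable (D.s0 α) (MeasureTheory.volume.restrict D.Ω)
  s0_mem : ∀ α, ∀ᵐ x ∂(MeasureTheory.volume.restrict D.Ω), D.s0 α x ∈ Set.Icc (0 : ℝ) 1
  s0_sum : ∀ᵐ x ∂(MeasureTheory.volume.restrict D.Ω), D.s0 .l x + D.s0 .g x = 1

end FlowData

/-! ### Meshes -/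

/-- A bounded open convex polytope: a bounded finite intersection of open half-spaces. -/
def IsOpenPolytope {ℓ : ℕ} (K : Set (Space ℓ)) : Prop :=
  Bornology.IsBounded K ∧
    ∃ H : Finset (Space ℓ × ℝ), K = {x | ∀ h ∈ H, ⟪h.1, x⟫ < h.2}

/-- The underlying data of a mesh: control volumes with their centres, indexed by `ι`, and the
exterior faces on which the Dirichlet condition is imposed, indexed by `κ`. -/
structure MeshData (ℓ : ℕ) (ι κ : Type) where
  /-- control volumes -/
  cell : ι → Set (Space ℓ)
  /-- centres of the control volumes -/
  center : ι → Space ℓ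
  /-- the control volume to which an exterior Dirichlet face belongs -/
  owner : κ → ι
  /-- exterior Dirichlet faces -/
  face : κ → Set (Space ℓ)
  /-- unit normals to the exterior faces, outward to their owners -/
  extNormal : κ → Space ℓ
  /-- distance from the centre of the owner to the hyperplane that contains the exterior face -/
  extDist : κ → ℝ

namespace MeshData

variable {ℓ : ℕ} {ι κ : Type} (m : MeshData ℓ ι κ)

/-- Volume of a control volume. -/
def vol (K : ι) : ℝ := MeasureTheory.volume.real (m.cell K)

/-- The interface `σ_{K|L}`. -/
def interface (K L : ι) : Set (Space ℓ) := closure (m.cell K) ∩ closure (m.cell L)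

/-- The `(ℓ-1)`-dimensional Lebesgue measure of `σ_{K|L}`. -/
def area (K L : ι) : ℝ := (μHE[ℓ - 1]).real (m.interface K L)

/-- `L` is a neighbour of `K`: the interface has positive `(ℓ-1)`-dimensional measure. -/
def IsNeighbor (K L : ι) : Prop := K ≠ L ∧ 0 < μHE[ℓ - 1] (m.interface K L)

open Classical in
/-- The set `N(K)` of the neighbours of `K`. -/
def nbrs [Fintype ι] (K : ι) : Finset ι := Finset.univ.filter fun L => m.IsNeighbor K L

/-- The distance `d_{K|L}` between the centres. -/
def cdist (K L : ι) : ℝ := dist (m.center K) (m.center L)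

/-- The unit vector from `x_K` to `x_L`. For neighbours in an admissible mesh it is the unit normal
to `σ_{K|L}` outward to `K`. -/
def normal (K L : ι) : Space ℓ := (m.cdist K L)⁻¹ • (m.center L - m.center K)

/-- The transmissivity `τ_{K|L}`. -/
def trans (K L : ι) : ℝ := m.area K L / m.cdist K L

open Classical in
/-- The exterior Dirichlet faces of the control volume `K`. -/
def extFaces [Fintype κ] (K : ι) : Finset κ := Finset.univ.filter fun k => m.owner k = K

/-- The `(ℓ-1)`-dimensional Lebesgue measure of an exterior face. -/
def extArea (k : κ) : ℝ := (μHE[ℓ - 1]).real (m.face k)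

/-- The transmissivity of an exterior face. -/
def extTrans (k : κ) : ℝ := m.extArea k / m.extDist k

/-- Admissible mesh of `Ω` with regularity parameter `ξ`, adapted to the Dirichlet part `Γ` of the
boundary. -/
structure IsAdmissible [Fintype ι] (Ω Γ : Set (Space ℓ)) (ξ : ℝ) : Prop where
  polytope : ∀ K, IsOpenPolytope (m.cell K)
  subset : ∀ K, m.cell K ⊆ Ω
  closure_eq : closure (⋃ K, m.cell K) = closure Ω
  disjoint : ∀ K L, K ≠ L → m.cell K ∩ m.cell L = ∅
  frontier_eq : ∀ K, frontier (m.cell K) =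
    (closure (m.cell K) ∩ frontier Ω) ∪ ⋃ L ∈ m.nbrs K, m.interface K L
  center_mem : ∀ K, m.center K ∈ m.cell K
  orthogonal : ∀ K L, m.IsNeighbor K L → ∀ x ∈ m.interface K L, ∀ y ∈ m.interface K L,
    ⟪x - y, m.center L - m.center K⟫ = 0
  regular : ∀ K, ∑ L ∈ m.nbrs K, m.area K L * m.cdist K L ≤ ξ * m.vol K
  -- exterior Dirichlet faces: flat pieces which, for each control volume `K`, decompose the part of
  -- `Γ` on the boundary of `K` up to a set of `(ℓ-1)`-dimensional measure zero
  face_measurable : ∀ k, MeasurableSet (m.face k)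
  face_subset : ∀ k, m.face k ⊆ closure (m.cell (m.owner k)) ∩ Γ
  face_pos : ∀ k, 0 < μHE[ℓ - 1] (m.face k)
  face_disjoint : ∀ k k', k ≠ k' → m.owner k = m.owner k' →
    μHE[ℓ - 1] (m.face k ∩ m.face k') = 0
  face_cover : ∀ K,
    μHE[ℓ - 1] ((closure (m.cell K) ∩ Γ) \ ⋃ (k : κ) (_ : m.owner k = K), m.face k) = 0
  extNormal_unit : ∀ k, ‖m.extNormal k‖ = 1
  extDist_pos : ∀ k, 0 < m.extDist k
  face_flat : ∀ k, ∀ x ∈ m.face k,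
    ⟪m.extNormal k, x - m.center (m.owner k)⟫ = m.extDist k

end MeshData

/-! ### The scheme -/

namespace FlowData

variable {ℓ : ℕ} (D : FlowData ℓ)

/-- The mobility extended outside `[0,1]` by constants. -/
def Mext (α : Phase) (s : ℝ) : ℝ := D.M α (max 0 (min 1 s))

/-- The upwind numerical flux `G_α(a,b,c) = -M_α(b) c⁺ + M_α(a) c⁻`. -/
def G (α : Phase) (a b c : ℝ) : ℝ := -(D.Mext α b * max c 0) + D.Mext α a * max (-c) 0

/-- The upwind mobility on a face seen from `K`, where `sK, pK` are the saturation and the pressure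
of the phase `α` in `K` and `sL, pL` those on the other side. -/
def upwindM (α : Phase) (sK sL pK pL : ℝ) : ℝ :=
  if pL - pK ≤ 0 then D.Mext α sK else D.Mext α sL

/-- The mean density on a face: its inverse is the mean value of `1 / ρ_α` between the two
pressures. -/
def meanρ (α : Phase) (pK pL : ℝ) : ℝ :=
  if pK = pL then D.ρ α pK
  else (1 / (pL - pK) * ∫ ζ in pK..pL, 1 / D.ρ α ζ)⁻¹

/-- The numerical mass flux (Darcy flux and gravity flux) of the phase `α` through a face of measure
`a`, with distance `d` and unit normal `η` (outward to `K`). -/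
def massFlux (α : Phase) (a d : ℝ) (η : Space ℓ) (sK sL pK pL : ℝ) : ℝ :=
  a / d * D.meanρ α pK pL * D.G α sK sL (pL - pK) +
    a * D.meanρ α pK pL ^ 2 *
      (D.Mext α sK * max ⟪D.grav, η⟫ 0 - D.Mext α sL * max (-⟪D.grav, η⟫) 0)

/-- The saturations on the Dirichlet boundary: `p_l = p_g = 0` there, so `pc (s_l) = 0`, that is
`s_l = 1` and `s_g = 0`. -/
def bdrySat : Phase → ℝ
  | .l => 1
  | .g => 0

/-- The uniform time step for `N + 1` steps, `t^n = n δt`, `t^{N+1} = T`. -/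
def timeStep (N : ℕ) : ℝ := D.T / (N + 1)

variable {ι κ : Type}

/-- Mean value over `(t^n, t^{n+1}) × K`. -/
def spaceTimeMean (m : MeshData ℓ ι κ) (N n : ℕ) (K : ι) (f : ℝ × Space ℓ → ℝ) : ℝ :=
  (D.timeStep N * m.vol K)⁻¹ *
    ∫ z in Set.Ioo (n * D.timeStep N) ((n + 1) * D.timeStep N) ×ˢ m.cell K, f z

/-- Mean value over `K`. -/
def spaceMean (m : MeshData ℓ ι κ) (K : ι) (f : Space ℓ → ℝ) : ℝ :=
  (m.vol K)⁻¹ * ∫ x in m.cell K, f x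

/-- `p` and `s` solve the finite volume scheme on the mesh `m` with `N + 1` time steps; `p α n K` and
`s α n K` are the pressure and the saturation of the phase `α` in the control volume `K` at the time
`t^n` (only `n ≤ N + 1` matters). On the exterior Dirichlet faces the exterior state is
`p_l = p_g = 0`, `s_l = 1`, `s_g = 0`; the flux through the rest of the boundary is zero. -/
structure IsSchemeSolution [Fintype ι] [Fintype κ] (m : MeshData ℓ ι κ) (N : ℕ)
    (p s : Phase → ℕ → ι → ℝ) : Prop where
  init_p : ∀ α K, p α 0 K = spaceMean m K (D.p0 α)
  init_s : ∀ α K, s α 0 K = spaceMean m K (D.s0 α)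
  saturated : ∀ n ≤ N, ∀ K, s .l (n + 1) K + s .g (n + 1) K = 1
  capillary : ∀ n ≤ N, ∀ K, D.pc (s .l (n + 1) K) = p .g (n + 1) K - p .l (n + 1) K
  balance : ∀ n ≤ N, ∀ α K,
    m.vol K * spaceMean m K D.φ *
        ((D.ρ α (p α (n + 1) K) * s α (n + 1) K - D.ρ α (p α n K) * s α n K) / D.timeStep N) +
      ∑ L ∈ m.nbrs K, D.massFlux α (m.area K L) (m.cdist K L) (m.normal K L)
        (s α (n + 1) K) (s α (n + 1) L) (p α (n + 1) K) (p α (n + 1) L) +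
      ∑ k ∈ m.extFaces K, D.massFlux α (m.extArea k) (m.extDist k) (m.extNormal k)
        (s α (n + 1) K) (bdrySat α) (p α (n + 1) K) 0 +
      m.vol K * D.ρ α (p α (n + 1) K) * s α (n + 1) K * D.spaceTimeMean m N n K D.fP =
    m.vol K * D.ρ α (p α (n + 1) K) * D.spaceTimeMean m N n K (D.sI α) *
      D.spaceTimeMean m N n K D.fI

/-- The squared discrete `L²(0,T;H¹)` seminorm of `b(s_l)`,
`∑ₙ δt ∑_K ∑_{L ∈ N(K)} τ_{K|L} (b(s_{l,L}^{n+1}) - b(s_{l,K}^{n+1}))²`,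
including the terms of the exterior Dirichlet faces, where the exterior saturation is `s_l = 1`. -/
def discreteSeminorm [Fintype ι] [Fintype κ] (m : MeshData ℓ ι κ) (N : ℕ)
    (s : Phase → ℕ → ι → ℝ) (b : ℝ → ℝ) : ℝ :=
  ∑ n ∈ Finset.range (N + 1), D.timeStep N * ∑ K,
    (∑ L ∈ m.nbrs K, m.trans K L * (b (s .l (n + 1) L) - b (s .l (n + 1) K)) ^ 2 +
      ∑ k ∈ m.extFaces K, m.extTrans k * (b (bdrySat .l) - b (s .l (n + 1) K)) ^ 2)

/-- The same quantity with each face term weighted by the upwind mobility of the phase `α`. -/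
def weightedSeminorm [Fintype ι] [Fintype κ] (m : MeshData ℓ ι κ) (N : ℕ)
    (p s : Phase → ℕ → ι → ℝ) (α : Phase) (b : ℝ → ℝ) : ℝ :=
  ∑ n ∈ Finset.range (N + 1), D.timeStep N * ∑ K,
    (∑ L ∈ m.nbrs K, m.trans K L *
        D.upwindM α (s α (n + 1) K) (s α (n + 1) L) (p α (n + 1) K) (p α (n + 1) L) *
        (b (s .l (n + 1) L) - b (s .l (n + 1) K)) ^ 2 +
      ∑ k ∈ m.extFaces K, m.extTrans k *
        D.upwindM α (s α (n + 1) K) (bdrySat α) (p α (n + 1) K) 0 *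
        (b (bdrySat .l) - b (s .l (n + 1) K)) ^ 2)

end FlowData

end TwoPhase

end

/-! ### Volumes of swept sets and of cones over flat sets. -/

open scoped MeasureTheory RealInnerProductSpace ENNReal

noncomputable section

namespace TwoPhase

open MeasureTheory Set

variable {ℓ : ℕ}

/-! The three bounds follow from an energy estimate. The balance of phase `α` is tested with
`g_α(p_α)`, where `g_α` is the primitive of `1/ρ_α` (`kirchhoff`). The mean density on a face is
chosen so that `ρ_{K|L} δ(g_α) = δ(p_α)` (`meanρ_mul_sub`), hence the Darcy fluxes produce exactly
`τ M_α (δp_α)²`, the dissipation `diss`. The accumulation terms dominate the increment of a free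
energy that is bounded below, by the concavity of `g_α`, the monotonicity of the capillary pressure
and the capillary law (`freeEnergy_sub_le`). A maximum principle keeps the saturations in `[0,1]`
(`saturation_mem`).

The difficulty is that `M_α` may vanish, so the dissipation does not control `δp_α`. With `x = δp_l`
and `y = δp_g`, the increments of `p̄` and `p̃` are `θ(y - x)` and `-(1 - θ)(y - x)` with one common
`θ ∈ [0,1]` (`exists_fraction`). For each phase, either its upwind mobility dominates its mobility
at all intermediate saturations, or both phases are upwinded from the same side and the lower bound
on the total mobility takes over (`upwind_l_or`, `upwind_g_or`). In all cases `θ y²` and `(1 - θ)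
x²` are bounded by the dissipation. This controls the increments of `𝓑`, `p̄`, `p̃` as stated, and
also that of the global pressure `p_l + p̄` (`exists_face_estimate`). It remains to bound the total
dissipation.

Gravity is absorbed by Young's inequality at the cost of `∑ |σ| d`, which is at most a constant
times `|Ω|`: by mesh regularity on interior faces, and by disjoint cones inside the cells on
Dirichlet faces (`sum_extArea_mul_extDist_le`). For the sources an `L²` bound on the pressures is
needed. They differ from the global pressure by a bounded amount, and the latter obeys a discrete
Poincaré inequality (`exists_poincare_l2`).

Its constant must not depend on the mesh, while `∂Ω` has no assumed regularity. The `L¹` version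
(`exists_poincare_l1`) counts the interfaces crossed by segments inside convex sets, propagates this
along overlapping balls by connectedness, and uses the cells and one Dirichlet face of a single
fixed admissible mesh to reach all of `Ω` and `Γ`. Applying it to `u²` gives the `L²` version. -/

/-- The volume of a set is the integral of the measures of its slices orthogonal to a unit
vector. -/
theorem volume_eq_lintegral_slice (η : Space ℓ) (hη : ‖η‖ = 1) {t : Set (Space ℓ)}
    (ht : MeasurableSet t) :
    volume t = ∫⁻ c : ℝ, μHE[ℓ - 1] (t ∩ {x | ⟪η, x⟫ = c}) := by
  have h0 : η ≠ 0 := by rintro rfl; simp at hη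
  have h := EuclideanGeometry.euclideanHausdorffMeasure_eq_lintegral (0 : Space ℓ) h0 ht
  rw [finrank_euclideanSpace_fin, EuclideanSpace.euclideanHausdorffMeasure_eq_volume,
    ← ofReal_norm, hη, ENNReal.ofReal_one, one_mul] at h
  rw [h]
  congr 1
  ext c
  congr 2
  ext x
  simp only [vadd_eq_add, add_zero, SetLike.mem_coe, AffineSubspace.mem_mk', vsub_eq_sub,
    mem_ofPred_eq, Submodule.mem_orthogonal_singleton_iff_inner_right, inner_sub_right,
    inner_smul_right, real_inner_self_eq_norm_sq, hη]
  constructor <;> intro h <;> linarith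

/-- The set swept by `F` when it is translated along `t • v`, `t ∈ I`. -/
def sweep (F : Set (Space ℓ)) (v : Space ℓ) (I : Set ℝ) : Set (Space ℓ) :=
  {x | ∃ z ∈ F, ∃ t ∈ I, x = z + t • v}

theorem sweep_eq {F : Set (Space ℓ)} {η v : Space ℓ} {c : ℝ} {I : Set ℝ}
    (hF : ∀ z ∈ F, ⟪η, z⟫ = c) (hv : ⟪η, v⟫ ≠ 0) :
    sweep F v I = {x | (⟪η, x⟫ - c) / ⟪η, v⟫ ∈ I ∧ x - ((⟪η, x⟫ - c) / ⟪η, v⟫) • v ∈ F} := by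
  ext x
  constructor
  · rintro ⟨z, hz, t, ht, rfl⟩
    have : (⟪η, z + t • v⟫ - c) / ⟪η, v⟫ = t := by
      rw [inner_add_right, inner_smul_right, hF z hz]; field_simp; ring
    simp only [mem_ofPred_eq, this]
    exact ⟨ht, by simpa using hz⟩
  · rintro ⟨h1, h2⟩
    exact ⟨_, h2, _, h1, by simp⟩

theorem measurableSet_sweep {F : Set (Space ℓ)} {η v : Space ℓ} {c : ℝ} {I : Set ℝ}
    (hFm : MeasurableSet F) (hI : MeasurableSet I)
    (hF : ∀ z ∈ F, ⟪η, z⟫ = c) (hv : ⟪η, v⟫ ≠ 0) : MeasurableSet (sweep F v I) := by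
  rw [sweep_eq hF hv]
  have h1 : Measurable fun x : Space ℓ => (⟪η, x⟫ - c) / ⟪η, v⟫ := by fun_prop
  have h2 : Measurable fun x : Space ℓ => x - ((⟪η, x⟫ - c) / ⟪η, v⟫) • v := by fun_prop
  exact (h1 hI).inter (h2 hFm)

theorem volume_preimage_affine (c a : ℝ) (ha : a ≠ 0) (I : Set ℝ) :
    volume {x : ℝ | (x - c) / a ∈ I} = ENNReal.ofReal |a| * volume I := by
  have h1 : {x : ℝ | (x - c) / a ∈ I} = (fun x => x - c) ⁻¹' ((fun x => a⁻¹ * x) ⁻¹' I) := by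
    ext x; simp [div_eq_inv_mul]
  rw [h1]
  simp_rw [sub_eq_add_neg]
  rw [measure_preimage_add_right, Real.volume_preimage_mul_left (inv_ne_zero ha), inv_inv]

/-- Cavalieri's principle: the slice at height `x` is a translate of `F` when `(x - c) / ⟪η, v⟫`
lies in `I`, and is empty otherwise. -/
theorem volume_sweep {F : Set (Space ℓ)} {η v : Space ℓ} {c : ℝ} {I : Set ℝ} (hη : ‖η‖ = 1)
    (hFm : MeasurableSet F) (hI : MeasurableSet I)
    (hF : ∀ z ∈ F, ⟪η, z⟫ = c) (hv : ⟪η, v⟫ ≠ 0) :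
    volume (sweep F v I) = ENNReal.ofReal |⟪η, v⟫| * volume I * μHE[ℓ - 1] F := by
  rw [volume_eq_lintegral_slice η hη (measurableSet_sweep hFm hI hF hv)]
  have h1 : ∀ x : ℝ, μHE[ℓ - 1] (sweep F v I ∩ {y | ⟪η, y⟫ = x}) =
      {x : ℝ | (x - c) / ⟪η, v⟫ ∈ I}.indicator (fun _ => μHE[ℓ - 1] F) x := by
    intro x
    by_cases hx : (x - c) / ⟪η, v⟫ ∈ I
    · rw [indicator_of_mem (by exact hx)]
      have : sweep F v I ∩ {y | ⟪η, y⟫ = x} =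
          (fun y => y + -(((x - c) / ⟪η, v⟫) • v)) ⁻¹' F := by
        rw [sweep_eq hF hv]
        ext y
        simp only [mem_inter_iff, mem_ofPred_eq, mem_preimage, ← sub_eq_add_neg]
        constructor
        · rintro ⟨⟨_, h⟩, rfl⟩; exact h
        · intro h
          have h3 := hF _ h
          rw [inner_sub_right, inner_smul_right, div_mul_cancel₀ _ hv] at h3
          have h4 : ⟪η, y⟫ = x := by linarith
          rw [h4]
          exact ⟨⟨hx, h⟩, rfl⟩
      rw [this, measure_preimage_add_right]
    · rw [indicator_of_notMem (by exact hx)]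
      have : sweep F v I ∩ {y | ⟪η, y⟫ = x} = ∅ := by
        rw [sweep_eq hF hv]
        ext y
        simp only [mem_inter_iff, mem_ofPred_eq, mem_empty_iff_false, iff_false]
        rintro ⟨⟨h, _⟩, rfl⟩
        exact hx h
      rw [this, measure_empty]
  simp_rw [h1]
  have hm : MeasurableSet {x : ℝ | (x - c) / ⟪η, v⟫ ∈ I} := by
    have : Measurable fun x : ℝ => (x - c) / ⟪η, v⟫ := by fun_prop
    exact this hI
  rw [lintegral_indicator_const hm, volume_preimage_affine _ _ hv]
  ring

theorem volume_hyperplane (η : Space ℓ) (hη : ‖η‖ = 1) (c : ℝ) :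
    volume {x : Space ℓ | ⟪η, x⟫ = c} = 0 := by
  have hm : MeasurableSet {x : Space ℓ | ⟪η, x⟫ = c} :=
    (isClosed_eq (by fun_prop) continuous_const).measurableSet
  rw [volume_eq_lintegral_slice η hη hm]
  have h1 : ∀ x : ℝ, x ≠ c → μHE[ℓ - 1] ({y : Space ℓ | ⟪η, y⟫ = c} ∩ {y | ⟪η, y⟫ = x}) = 0 := by
    intro x hx
    have : {y : Space ℓ | ⟪η, y⟫ = c} ∩ {y | ⟪η, y⟫ = x} = ∅ := by
      ext y
      simp only [mem_inter_iff, mem_ofPred_eq, mem_empty_iff_false, iff_false]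
      rintro ⟨rfl, rfl⟩
      exact hx rfl
    rw [this, measure_empty]
  rw [lintegral_eq_zero_of_ae_eq_zero]
  have : ∀ᵐ x : ℝ, x ≠ c := by simp [ae_iff]
  filter_upwards [this] with x hx using h1 x hx

/-- A flat set swept along a segment has volume at most the length times the measure. -/
theorem volume_sweep_le {F : Set (Space ℓ)} {η : Space ℓ} (v : Space ℓ) {c : ℝ} (hη : ‖η‖ = 1)
    (hFm : MeasurableSet F) (hF : ∀ z ∈ F, ⟪η, z⟫ = c) :
    volume (sweep F v (Icc 0 1)) ≤ ENNReal.ofReal ‖v‖ * μHE[ℓ - 1] F := by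
  by_cases hv : ⟪η, v⟫ = 0
  · have : sweep F v (Icc 0 1) ⊆ {x | ⟪η, x⟫ = c} := by
      rintro x ⟨z, hz, t, _, rfl⟩
      simp [inner_add_right, inner_smul_right, hv, hF z hz]
    rw [measure_mono_null this (volume_hyperplane η hη c)]
    exact zero_le
  · rw [volume_sweep hη hFm measurableSet_Icc hF hv]
    simp only [Real.volume_Icc, sub_zero, ENNReal.ofReal_one, mul_one]
    gcongr
    have := abs_real_inner_le_norm η v
    rwa [hη, one_mul] at this

/-- Bounded flat sets have finite measure. -/
theorem measure_flat_lt_top {F : Set (Space ℓ)} {η : Space ℓ} {c : ℝ} (hη : ‖η‖ = 1)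
    (hFm : MeasurableSet F) (hF : ∀ z ∈ F, ⟪η, z⟫ = c) (hb : Bornology.IsBounded F) :
    μHE[ℓ - 1] F < ∞ := by
  have hηη : ⟪η, η⟫ = 1 := by rw [real_inner_self_eq_norm_sq, hη]; norm_num
  -- A thickening of thickness one along the normal has volume equal to the measure of `F`, and it
  -- is bounded.
  have h := volume_sweep (I := Icc 0 1) (v := η) hη hFm measurableSet_Icc hF (by rw [hηη]; simp)
  simp only [hηη, abs_one, ENNReal.ofReal_one, Real.volume_Icc, sub_zero, one_mul] at h
  rw [← h]
  refine Bornology.IsBounded.measure_lt_top ?_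
  obtain ⟨R, hR⟩ := hb.exists_norm_le
  refine isBounded_iff_forall_norm_le.2 ⟨R + 1, ?_⟩
  rintro x ⟨z, hz, t, ht, rfl⟩
  refine (norm_add_le _ _).trans (add_le_add (hR z hz) ?_)
  rw [norm_smul, hη, mul_one, Real.norm_eq_abs, abs_of_nonneg ht.1]
  exact ht.2

/-- The part of the cone with apex `a` over `F` that is closer to `F`. -/
def coneOver (F : Set (Space ℓ)) (a : Space ℓ) : Set (Space ℓ) :=
  {x | ∃ z ∈ F, ∃ t ∈ Ioo (1 / 2 : ℝ) 1, x = AffineMap.homothety a t z}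

theorem inner_homothety (η a z : Space ℓ) (t : ℝ) :
    ⟪η, AffineMap.homothety a t z - a⟫ = t * ⟪η, z - a⟫ := by
  simp [AffineMap.homothety_apply, inner_smul_right]

theorem coneOver_eq {F : Set (Space ℓ)} {η a : Space ℓ} {d : ℝ} (hd : 0 < d)
    (hF : ∀ z ∈ F, ⟪η, z - a⟫ = d) :
    coneOver F a = {x | ⟪η, x - a⟫ / d ∈ Ioo (1 / 2 : ℝ) 1 ∧
      AffineMap.homothety a (⟪η, x - a⟫ / d)⁻¹ x ∈ F} := by
  ext x
  constructor
  · rintro ⟨z, hz, t, ht, rfl⟩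
    have h1 : ⟪η, AffineMap.homothety a t z - a⟫ / d = t := by
      rw [inner_homothety, hF z hz]; field_simp
    have ht0 : t ≠ 0 := by have := ht.1; intro h; rw [h] at this; norm_num at this
    simp only [mem_ofPred_eq, h1]
    refine ⟨ht, ?_⟩
    rw [← AffineMap.homothety_mul_apply, inv_mul_cancel₀ ht0]
    simpa using hz
  · rintro ⟨h1, h2⟩
    refine ⟨_, h2, _, h1, ?_⟩
    have ht0 : ⟪η, x - a⟫ / d ≠ 0 := by have := h1.1; intro h; rw [h] at this; norm_num at this
    rw [← AffineMap.homothety_mul_apply, mul_inv_cancel₀ ht0]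
    simp

theorem measurableSet_coneOver {F : Set (Space ℓ)} {η a : Space ℓ} {d : ℝ} (hd : 0 < d)
    (hFm : MeasurableSet F) (hF : ∀ z ∈ F, ⟪η, z - a⟫ = d) : MeasurableSet (coneOver F a) := by
  rw [coneOver_eq hd hF]
  have h1 : Measurable fun x : Space ℓ => ⟪η, x - a⟫ / d := by fun_prop
  have h2 : Measurable fun x : Space ℓ => AffineMap.homothety a (⟪η, x - a⟫ / d)⁻¹ x := by
    simp only [AffineMap.homothety_apply, vsub_eq_sub, vadd_eq_add]
    fun_prop
  exact (h1 measurableSet_Ioo).inter (h2 hFm)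

/-- The slice at relative height `t` contains the image of `F` under a homothety of ratio `t > 1/2`,
so it has at least `(1/2)^(ℓ-1)` times the measure of `F`. The heights fill an interval of length
`d/2`. -/
theorem le_volume_coneOver (hℓ : 1 ≤ ℓ) {F : Set (Space ℓ)} {η a : Space ℓ} {d : ℝ} (hη : ‖η‖ = 1)
    (hd : 0 < d) (hFm : MeasurableSet F) (hF : ∀ z ∈ F, ⟪η, z - a⟫ = d) :
    ENNReal.ofReal (d * (1 / 2) ^ ℓ) * μHE[ℓ - 1] F ≤ volume (coneOver F a) := by
  rw [volume_eq_lintegral_slice η hη (measurableSet_coneOver hd hFm hF)]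
  set c : ℝ := ⟪η, a⟫ with hc
  have h1 : ∀ x : ℝ, {x : ℝ | (x - c) / d ∈ Ioo (1 / 2 : ℝ) 1}.indicator
        (fun _ => ENNReal.ofReal ((1 / 2) ^ (ℓ - 1)) * μHE[ℓ - 1] F) x ≤
      μHE[ℓ - 1] (coneOver F a ∩ {y | ⟪η, y⟫ = x}) := by
    intro x
    by_cases hx : (x - c) / d ∈ Ioo (1 / 2 : ℝ) 1
    · rw [indicator_of_mem (by exact hx)]
      set t := (x - c) / d with ht
      have ht0 : 0 < t := lt_trans (by norm_num) hx.1
      have hsub : AffineMap.homothety a t '' F ⊆ coneOver F a ∩ {y | ⟪η, y⟫ = x} := by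
        rintro y ⟨z, hz, rfl⟩
        refine ⟨⟨z, hz, t, hx, rfl⟩, ?_⟩
        have h3 := inner_homothety η a z t
        rw [hF z hz, inner_sub_right] at h3
        have : t * d = x - c := by rw [ht]; field_simp
        simp only [mem_ofPred_eq]
        linarith
      refine le_trans ?_ (measure_mono hsub)
      rw [euclideanHausdorffMeasure_homothety_image _ _ ht0.ne', ENNReal.smul_def, smul_eq_mul]
      gcongr
      rw [ENNReal.ofReal, ENNReal.coe_le_coe, ← NNReal.coe_le_coe, Real.coe_toNNReal _ (by positivity)]
      push_cast
      rw [Real.norm_eq_abs, abs_of_pos ht0]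
      exact pow_le_pow_left₀ (by norm_num) hx.1.le _
    · rw [indicator_of_notMem (by exact hx)]
      exact zero_le
  refine le_trans ?_ (lintegral_mono h1)
  have hm : MeasurableSet {x : ℝ | (x - c) / d ∈ Ioo (1 / 2 : ℝ) 1} := by
    have : Measurable fun x : ℝ => (x - c) / d := by fun_prop
    exact this measurableSet_Ioo
  rw [lintegral_indicator_const hm, volume_preimage_affine _ _ hd.ne', abs_of_pos hd,
    Real.volume_Ioo, mul_right_comm, ← ENNReal.ofReal_mul (by positivity), ← ENNReal.ofReal_mul (by positivity)]
  refine mul_le_mul_left (ENNReal.ofReal_le_ofReal (le_of_eq ?_)) _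
  obtain ⟨n, rfl⟩ : ∃ n, ℓ = n + 1 := ⟨ℓ - 1, by omega⟩
  simp only [Nat.add_sub_cancel, pow_succ]
  ring

end TwoPhase

end

/-! ### Convex cells, interfaces, and jumps along segments. -/

open scoped MeasureTheory RealInnerProductSpace ENNReal

noncomputable section

set_option linter.unusedSectionVars false

namespace TwoPhase

open MeasureTheory Set

variable {ℓ : ℕ}

theorem IsOpenPolytope.convex {K : Set (Space ℓ)} (h : IsOpenPolytope K) : Convex ℝ K := by
  obtain ⟨_, H, rfl⟩ := h
  have : {x : Space ℓ | ∀ h ∈ H, ⟪h.1, x⟫ < h.2} = ⋂ h ∈ H, {x | ⟪h.1, x⟫ < h.2} := by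
    ext; simp
  rw [this]
  refine convex_iInter₂ fun h _ => ?_
  exact convex_halfSpace_lt (innerₗ _ h.1).isLinear h.2

theorem IsOpenPolytope.isOpen {K : Set (Space ℓ)} (h : IsOpenPolytope K) : IsOpen K := by
  obtain ⟨_, H, rfl⟩ := h
  have : {x : Space ℓ | ∀ h ∈ H, ⟪h.1, x⟫ < h.2} = ⋂ h ∈ H, {x | ⟪h.1, x⟫ < h.2} := by
    ext; simp
  rw [this]
  refine isOpen_biInter_finset fun h _ => ?_
  exact isOpen_lt (by fun_prop) continuous_const

/-- A hyperplane separating the two convex sets contains the intersection of their closures, because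
each closure lies in its own closed half-space. -/
theorem exists_unit_normal {A B : Set (Space ℓ)} (hA : Convex ℝ A) (hAo : IsOpen A)
    (hAn : A.Nonempty) (hB : Convex ℝ B) (hBo : IsOpen B) (hBn : B.Nonempty) (h : A ∩ B = ∅) :
    ∃ (η : Space ℓ) (c : ℝ), ‖η‖ = 1 ∧ ∀ z ∈ closure A ∩ closure B, ⟪η, z⟫ = c := by
  obtain ⟨f, u, h1, h2⟩ := geometric_hahn_banach_open_open hA hAo hB hBo
    (disjoint_iff_inter_eq_empty.2 h)
  obtain ⟨a, ha⟩ := hAn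
  obtain ⟨b, hb⟩ := hBn
  set e := (InnerProductSpace.toDual ℝ (Space ℓ)).symm f with he
  have hfe : ∀ x, f x = ⟪e, x⟫ := fun x => by rw [he, InnerProductSpace.toDual_symm_apply]
  have he0 : e ≠ 0 := by
    intro h0
    have := (h1 a ha).trans (h2 b hb)
    simp [hfe, h0] at this
  have hn : 0 < ‖e‖ := norm_pos_iff.2 he0
  refine ⟨‖e‖⁻¹ • e, ‖e‖⁻¹ * u, ?_, ?_⟩
  · rw [norm_smul, norm_inv, norm_norm, inv_mul_cancel₀ hn.ne']
  · rintro z ⟨hz1, hz2⟩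
    have h3 : f z ≤ u := closure_minimal (t := {x | f x ≤ u}) (fun x hx => (h1 x hx).le)
      (isClosed_le f.continuous continuous_const) hz1
    have h4 : u ≤ f z := closure_minimal (t := {x | u ≤ f x}) (fun x hx => (h2 x hx).le)
      (isClosed_le continuous_const f.continuous) hz2
    rw [real_inner_smul_left, ← hfe, le_antisymm h3 h4]

namespace MeshData

variable {ι κ : Type} [Fintype ι] [Fintype κ] {m : MeshData ℓ ι κ} {Ω Γ : Set (Space ℓ)} {ξ : ℝ}

theorem interface_comm (m : MeshData ℓ ι κ) (K L : ι) : m.interface K L = m.interface L K :=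
  inter_comm _ _

theorem area_comm (m : MeshData ℓ ι κ) (K L : ι) : m.area K L = m.area L K := by
  rw [area, area, interface_comm]

theorem cdist_comm (m : MeshData ℓ ι κ) (K L : ι) : m.cdist K L = m.cdist L K := dist_comm _ _

theorem normal_comm (m : MeshData ℓ ι κ) (K L : ι) : m.normal L K = -m.normal K L := by
  rw [normal, normal, cdist_comm, ← smul_neg, neg_sub]

theorem area_nonneg (m : MeshData ℓ ι κ) (K L : ι) : 0 ≤ m.area K L := measureReal_nonneg

theorem extArea_nonneg (m : MeshData ℓ ι κ) (k : κ) : 0 ≤ m.extArea k := measureReal_nonneg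

theorem vol_nonneg (m : MeshData ℓ ι κ) (K : ι) : 0 ≤ m.vol K := measureReal_nonneg

theorem mem_nbrs {K L : ι} : L ∈ m.nbrs K ↔ m.IsNeighbor K L := by
  classical
  simp [nbrs]

theorem mem_nbrs_comm {K L : ι} : L ∈ m.nbrs K ↔ K ∈ m.nbrs L := by
  rw [mem_nbrs, mem_nbrs, IsNeighbor, IsNeighbor, interface_comm, ne_comm]

theorem sum_nbrs_comm (m : MeshData ℓ ι κ) (f : ι → ι → ℝ) :
    ∑ K, ∑ L ∈ m.nbrs K, f K L = ∑ K, ∑ L ∈ m.nbrs K, f L K := by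
  rw [Finset.sum_comm' (t' := Finset.univ) (s' := fun L => m.nbrs L)]
  intro x y
  simp [mem_nbrs_comm]

theorem sum_extFaces (m : MeshData ℓ ι κ) (f : ι → κ → ℝ) :
    ∑ K, ∑ k ∈ m.extFaces K, f K k = ∑ k, f (m.owner k) k := by
  classical
  simp only [extFaces, Finset.sum_filter]
  rw [Finset.sum_comm]
  simp

/-- The total variation of a function that is constant on the control volumes. -/
def totalVar (m : MeshData ℓ ι κ) (w : ι → ℝ) : ℝ :=
  ∑ K, ∑ L ∈ m.nbrs K, m.area K L * |w K - w L|

/-- The `L¹` norm of the trace on the Dirichlet faces. -/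
def bdryVar (m : MeshData ℓ ι κ) (w : ι → ℝ) : ℝ :=
  ∑ k, m.extArea k * |w (m.owner k)|

theorem totalVar_nonneg (m : MeshData ℓ ι κ) (w : ι → ℝ) : 0 ≤ m.totalVar w :=
  Finset.sum_nonneg fun _ _ => Finset.sum_nonneg fun _ _ =>
    mul_nonneg (m.area_nonneg _ _) (abs_nonneg _)

theorem bdryVar_nonneg (m : MeshData ℓ ι κ) (w : ι → ℝ) : 0 ≤ m.bdryVar w :=
  Finset.sum_nonneg fun _ _ => mul_nonneg (m.extArea_nonneg _) (abs_nonneg _)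

namespace IsAdmissible

theorem isOpen (hm : m.IsAdmissible Ω Γ ξ) (K : ι) : IsOpen (m.cell K) := (hm.polytope K).isOpen

theorem convex (hm : m.IsAdmissible Ω Γ ξ) (K : ι) : Convex ℝ (m.cell K) := (hm.polytope K).convex

theorem bounded (hm : m.IsAdmissible Ω Γ ξ) (K : ι) : Bornology.IsBounded (m.cell K) :=
  (hm.polytope K).1

theorem nonempty (hm : m.IsAdmissible Ω Γ ξ) (K : ι) : (m.cell K).Nonempty := ⟨_, hm.center_mem K⟩

theorem volume_lt_top (hm : m.IsAdmissible Ω Γ ξ) (K : ι) : volume (m.cell K) < ∞ :=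
  (hm.bounded K).measure_lt_top

theorem vol_pos (hm : m.IsAdmissible Ω Γ ξ) (K : ι) : 0 < m.vol K :=
  ENNReal.toReal_pos ((hm.isOpen K).measure_pos _ (hm.nonempty K)).ne' (hm.volume_lt_top K).ne

theorem ofReal_vol (hm : m.IsAdmissible Ω Γ ξ) (K : ι) :
    ENNReal.ofReal (m.vol K) = volume (m.cell K) :=
  ENNReal.ofReal_toReal (hm.volume_lt_top K).ne

theorem closure_Ω (hm : m.IsAdmissible Ω Γ ξ) : closure Ω = ⋃ K, closure (m.cell K) := by
  rw [← hm.closure_eq, closure_iUnion_of_finite]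

theorem exists_unit_normal (hm : m.IsAdmissible Ω Γ ξ) {K L : ι} (h : K ≠ L) :
    ∃ (η : Space ℓ) (c : ℝ), ‖η‖ = 1 ∧ ∀ z ∈ m.interface K L, ⟪η, z⟫ = c :=
  TwoPhase.exists_unit_normal (hm.convex K) (hm.isOpen K) (hm.nonempty K) (hm.convex L)
    (hm.isOpen L) (hm.nonempty L) (hm.disjoint K L h)

theorem measurableSet_interface (K L : ι) : MeasurableSet (m.interface K L) :=
  (isClosed_closure.inter isClosed_closure).measurableSet

theorem interface_lt_top (hm : m.IsAdmissible Ω Γ ξ) {K L : ι} (h : K ≠ L) :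
    μHE[ℓ - 1] (m.interface K L) < ∞ := by
  obtain ⟨η, c, hη, hz⟩ := hm.exists_unit_normal h
  exact measure_flat_lt_top hη (measurableSet_interface K L) hz
    ((hm.bounded K).closure.subset inter_subset_left)

theorem face_flat' (hm : m.IsAdmissible Ω Γ ξ) (k : κ) : ∀ z ∈ m.face k,
    ⟪m.extNormal k, z⟫ = m.extDist k + ⟪m.extNormal k, m.center (m.owner k)⟫ := by
  intro z hz
  have := hm.face_flat k z hz
  rw [inner_sub_right] at this
  linarith

theorem face_lt_top (hm : m.IsAdmissible Ω Γ ξ) (k : κ) : μHE[ℓ - 1] (m.face k) < ∞ :=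
  measure_flat_lt_top (hm.extNormal_unit k) (hm.face_measurable k) (hm.face_flat' k)
    ((hm.bounded (m.owner k)).closure.subset ((hm.face_subset k).trans inter_subset_left))

theorem ofReal_area (hm : m.IsAdmissible Ω Γ ξ) {K L : ι} (h : K ≠ L) :
    ENNReal.ofReal (m.area K L) = μHE[ℓ - 1] (m.interface K L) :=
  ENNReal.ofReal_toReal (hm.interface_lt_top h).ne

theorem ofReal_extArea (hm : m.IsAdmissible Ω Γ ξ) (k : κ) :
    ENNReal.ofReal (m.extArea k) = μHE[ℓ - 1] (m.face k) :=
  ENNReal.ofReal_toReal (hm.face_lt_top k).ne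

-- Crossing arguments produce sums over all pairs of distinct cells. Pairs that are not neighbours
-- have a null interface and do not contribute.
open Classical in
theorem ofReal_totalVar (hm : m.IsAdmissible Ω Γ ξ) (w : ι → ℝ) :
    ∑ K, ∑ L, (if K ≠ L then ENNReal.ofReal |w K - w L| * μHE[ℓ - 1] (m.interface K L) else 0) =
      ENNReal.ofReal (m.totalVar w) := by
  rw [totalVar, ENNReal.ofReal_sum_of_nonneg fun _ _ => Finset.sum_nonneg fun _ _ =>
    mul_nonneg (m.area_nonneg _ _) (abs_nonneg _)]
  refine Finset.sum_congr rfl fun K _ => ?_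
  rw [ENNReal.ofReal_sum_of_nonneg fun _ _ => mul_nonneg (m.area_nonneg _ _) (abs_nonneg _),
    nbrs, Finset.sum_filter]
  refine Finset.sum_congr rfl fun L _ => ?_
  by_cases h : K = L
  · simp [h, IsNeighbor]
  · rw [if_pos h]
    by_cases h' : μHE[ℓ - 1] (m.interface K L) = 0
    · simp [IsNeighbor, h']
    · rw [if_pos ⟨h, pos_iff_ne_zero.2 h'⟩, ENNReal.ofReal_mul (m.area_nonneg _ _),
        hm.ofReal_area h, mul_comm]

theorem ofReal_bdryVar (hm : m.IsAdmissible Ω Γ ξ) (w : ι → ℝ) :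
    ∑ k, ENNReal.ofReal |w (m.owner k)| * μHE[ℓ - 1] (m.face k) =
      ENNReal.ofReal (m.bdryVar w) := by
  rw [bdryVar, ENNReal.ofReal_sum_of_nonneg fun _ _ =>
    mul_nonneg (m.extArea_nonneg _) (abs_nonneg _)]
  refine Finset.sum_congr rfl fun k _ => ?_
  rw [ENNReal.ofReal_mul (m.extArea_nonneg _), hm.ofReal_extArea, mul_comm]

/-- The control volumes partition `Ω` up to a null set. -/
theorem sum_volume_inter (hm : m.IsAdmissible Ω Γ ξ) {A : Set (Space ℓ)} (hA : A ⊆ Ω) :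
    ∑ K, volume (A ∩ m.cell K) = volume A := by
  have h1 : volume.restrict A (⋃ K, m.cell K) = ∑ K, volume (A ∩ m.cell K) := by
    rw [measure_iUnion, tsum_fintype]
    · refine Finset.sum_congr rfl fun K _ => ?_
      rw [Measure.restrict_apply (hm.isOpen K).measurableSet, inter_comm]
    · intro K L h
      exact disjoint_iff_inter_eq_empty.2 (hm.disjoint K L h)
    · exact fun K => (hm.isOpen K).measurableSet
  rw [← h1, Measure.restrict_apply (MeasurableSet.iUnion fun K => (hm.isOpen K).measurableSet)]
  refine le_antisymm (measure_mono inter_subset_right) ?_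
  have h2 : A ⊆ ((⋃ K, m.cell K) ∩ A) ∪ ⋃ K, frontier (m.cell K) := by
    intro x hx
    have : x ∈ closure Ω := subset_closure (hA hx)
    rw [hm.closure_Ω] at this
    obtain ⟨K, hK⟩ := mem_iUnion.1 this
    by_cases hxK : x ∈ m.cell K
    · exact Or.inl ⟨mem_iUnion.2 ⟨K, hxK⟩, hx⟩
    · refine Or.inr (mem_iUnion.2 ⟨K, hK, ?_⟩)
      rwa [(hm.isOpen K).interior_eq]
  calc volume A ≤ _ := measure_mono h2
    _ ≤ _ := measure_union_le _ _
    _ = _ := by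
      rw [measure_iUnion_null fun K => (hm.convex K).addHaar_frontier _, add_zero]

theorem sum_vol (hm : m.IsAdmissible Ω Γ ξ) : ∑ K, m.vol K = volume.real Ω := by
  have h := hm.sum_volume_inter (A := Ω) subset_rfl
  rw [measureReal_def, ← h, ENNReal.toReal_sum]
  · refine Finset.sum_congr rfl fun K _ => ?_
    rw [inter_eq_right.2 (hm.subset K)]; rfl
  · intro K _
    rw [inter_eq_right.2 (hm.subset K)]
    exact (hm.volume_lt_top K).ne

-- For each level `t` between the end values, the connected segment is covered by two closed sets,
-- the closures of the cells with `w ≤ t` and of those with `w > t`. They meet on the segment, at a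
-- point of an interface whose jump straddles `t`. Thus the jump intervals cover `[w K₀, w K₁)`. No
-- general position of the segment is required.
open Classical in
theorem sub_le_sum_crossing (hm : m.IsAdmissible Ω Γ ξ) (w : ι → ℝ) {x y : Space ℓ}
    (hxy : segment ℝ x y ⊆ closure Ω) {K₀ K₁ : ι} (hx : x ∈ closure (m.cell K₀))
    (hy : y ∈ closure (m.cell K₁)) :
    ENNReal.ofReal (w K₁ - w K₀) ≤ ∑ K, ∑ L,
      if K ≠ L ∧ (segment ℝ x y ∩ m.interface K L).Nonempty
        then ENNReal.ofReal |w K - w L| else 0 := by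
  have h1 : Ico (w K₀) (w K₁) ⊆ ⋃ K, ⋃ L,
      if K ≠ L ∧ (segment ℝ x y ∩ m.interface K L).Nonempty then Ico (w K) (w L) else ∅ := by
    intro t ht
    have hc : ∀ p : ι → Prop, IsClosed (⋃ K, ⋃ _ : p K, closure (m.cell K)) := fun p =>
      isClosed_iUnion_of_finite fun K => isClosed_iUnion_of_finite fun _ => isClosed_closure
    have hpre : IsPreconnected (segment ℝ x y) := (convex_segment x y).isPreconnected
    rw [isPreconnected_closed_iff] at hpre
    obtain ⟨z, hz, hz1, hz2⟩ := hpre _ _ (hc fun K => w K ≤ t) (hc fun K => t < w K)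
      (by
        intro z hz
        have := hxy hz
        rw [hm.closure_Ω] at this
        obtain ⟨K, hK⟩ := mem_iUnion.1 this
        rcases le_or_gt (w K) t with h | h
        · exact Or.inl (mem_iUnion₂.2 ⟨K, h, hK⟩)
        · exact Or.inr (mem_iUnion₂.2 ⟨K, h, hK⟩))
      ⟨x, left_mem_segment ℝ x y, mem_iUnion₂.2 ⟨K₀, ht.1, hx⟩⟩
      ⟨y, right_mem_segment ℝ x y, mem_iUnion₂.2 ⟨K₁, ht.2, hy⟩⟩
    obtain ⟨K, hK, hzK⟩ := mem_iUnion₂.1 hz1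
    obtain ⟨L, hL, hzL⟩ := mem_iUnion₂.1 hz2
    have hne : K ≠ L := by
      rintro rfl
      exact (lt_of_le_of_lt hK hL).false
    refine mem_iUnion₂.2 ⟨K, L, ?_⟩
    rw [if_pos ⟨hne, z, hz, hzK, hzL⟩]
    exact ⟨hK, hL⟩
  calc ENNReal.ofReal (w K₁ - w K₀) = volume (Ico (w K₀) (w K₁)) := by rw [Real.volume_Ico]
    _ ≤ _ := measure_mono h1
    _ ≤ ∑ K, volume (⋃ L, if K ≠ L ∧ (segment ℝ x y ∩ m.interface K L).Nonempty
          then Ico (w K) (w L) else ∅) := measure_iUnion_fintype_le _ _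
    _ ≤ _ := by
      refine Finset.sum_le_sum fun K _ => (measure_iUnion_fintype_le _ _).trans ?_
      refine Finset.sum_le_sum fun L _ => ?_
      split_ifs
      · rw [Real.volume_Ico, abs_sub_comm]
        exact ENNReal.ofReal_le_ofReal (le_abs_self _)
      · simp

open Classical in
/-- The difference of the values at the end points of a segment is bounded by the sum of the jumps
over all interfaces that the segment meets. -/
theorem abs_sub_le_sum_crossing (hm : m.IsAdmissible Ω Γ ξ) (w : ι → ℝ) {x y : Space ℓ}
    (hxy : segment ℝ x y ⊆ closure Ω) {K₀ K₁ : ι} (hx : x ∈ closure (m.cell K₀))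
    (hy : y ∈ closure (m.cell K₁)) :
    ENNReal.ofReal |w K₀ - w K₁| ≤ ∑ K, ∑ L,
      if K ≠ L ∧ (segment ℝ x y ∩ m.interface K L).Nonempty
        then ENNReal.ofReal |w K - w L| else 0 := by
  rcases abs_cases (w K₀ - w K₁) with ⟨h, _⟩ | ⟨h, _⟩
  · rw [h]
    have := hm.sub_le_sum_crossing w (segment_symm ℝ x y ▸ hxy) hy hx
    rwa [segment_symm] at this
  · rw [h, neg_sub]
    exact hm.sub_le_sum_crossing w hxy hx hy

theorem volume_sweep_interface_le (hm : m.IsAdmissible Ω Γ ξ) {K L : ι} (h : K ≠ L) (v : Space ℓ) :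
    volume (sweep (m.interface K L) v (Icc 0 1)) ≤
      ENNReal.ofReal ‖v‖ * μHE[ℓ - 1] (m.interface K L) := by
  obtain ⟨η, c, hη, hz⟩ := hm.exists_unit_normal h
  exact volume_sweep_le v hη (measurableSet_interface K L) hz

theorem mem_cell_unique (hm : m.IsAdmissible Ω Γ ξ) {x : Space ℓ} {K L : ι} (hK : x ∈ m.cell K)
    (hL : x ∈ m.cell L) : K = L := by
  by_contra h
  have := hm.disjoint K L h
  exact (this ▸ (⟨hK, hL⟩ : x ∈ m.cell K ∩ m.cell L) : x ∈ (∅ : Set (Space ℓ)))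

end IsAdmissible

end MeshData

end TwoPhase

end

/-! ### Oscillation and an `L¹` Poincaré–Wirtinger inequality uniform in the mesh. -/

open scoped MeasureTheory RealInnerProductSpace ENNReal

noncomputable section

set_option linter.unusedSectionVars false

namespace TwoPhase

open MeasureTheory Set

variable {ℓ : ℕ}

/-- The oscillation between `A` and `B` of functions that are constant on control volumes. -/
def osc {ι κ : Type} [Fintype ι] (m : MeshData ℓ ι κ) (w : ι → ℝ) (A B : Set (Space ℓ)) : ℝ≥0∞ :=
  ∑ K, ∑ L, ENNReal.ofReal |w K - w L| * volume (A ∩ m.cell K) * volume (B ∩ m.cell L)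

/-- The oscillation between `A` and `B` is controlled by the total variation, uniformly for all
admissible meshes. -/
def Linked (Ω Γ : Set (Space ℓ)) (ξ : ℝ) (A B : Set (Space ℓ)) : Prop :=
  ∃ C : ℝ≥0∞, C ≠ ∞ ∧ ∀ (ι κ : Type) [Fintype ι] [Fintype κ] (m : MeshData ℓ ι κ) (w : ι → ℝ),
    m.IsAdmissible Ω Γ ξ → osc m w A B ≤ C * ENNReal.ofReal (m.totalVar w)

section Osc

variable {ι κ : Type} [Fintype ι] [Fintype κ] {m : MeshData ℓ ι κ} {Ω Γ : Set (Space ℓ)} {ξ : ℝ}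

theorem osc_mono (w : ι → ℝ) {A A' B B' : Set (Space ℓ)} (hA : A' ⊆ A) (hB : B' ⊆ B) :
    osc m w A' B' ≤ osc m w A B := by
  unfold osc
  gcongr

theorem osc_comm (w : ι → ℝ) (A B : Set (Space ℓ)) : osc m w A B = osc m w B A := by
  unfold osc
  rw [Finset.sum_comm]
  refine Finset.sum_congr rfl fun K _ => Finset.sum_congr rfl fun L _ => ?_
  rw [abs_sub_comm, mul_right_comm]

/-- The triangle inequality through an intermediate point of `B`, integrated over `A`, `B` and `C`.
-/
theorem osc_mul_volume_le (hm : m.IsAdmissible Ω Γ ξ) (w : ι → ℝ) {A B C : Set (Space ℓ)}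
    (hA : A ⊆ Ω) (hB : B ⊆ Ω) (hC : C ⊆ Ω) :
    osc m w A C * volume B ≤ osc m w A B * volume C + osc m w B C * volume A := by
  have h1 : osc m w A C * volume B = ∑ K, ∑ L, ∑ M, ENNReal.ofReal |w K - w L| *
      (volume (A ∩ m.cell K) * volume (C ∩ m.cell L) * volume (B ∩ m.cell M)) := by
    rw [osc, ← hm.sum_volume_inter hB, Finset.sum_mul]
    refine Finset.sum_congr rfl fun K _ => ?_
    rw [Finset.sum_mul]
    refine Finset.sum_congr rfl fun L _ => ?_
    rw [Finset.mul_sum]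
    exact Finset.sum_congr rfl fun M _ => by ring
  have h2 : osc m w A B * volume C = ∑ K, ∑ L, ∑ M, ENNReal.ofReal |w K - w M| *
      (volume (A ∩ m.cell K) * volume (C ∩ m.cell L) * volume (B ∩ m.cell M)) := by
    rw [osc, ← hm.sum_volume_inter hC, Finset.sum_mul]
    refine Finset.sum_congr rfl fun K _ => ?_
    rw [Finset.sum_mul, Finset.sum_comm]
    refine Finset.sum_congr rfl fun M _ => ?_
    rw [Finset.mul_sum]
    exact Finset.sum_congr rfl fun L _ => by ring
  have h3 : osc m w B C * volume A = ∑ K, ∑ L, ∑ M, ENNReal.ofReal |w M - w L| *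
      (volume (A ∩ m.cell K) * volume (C ∩ m.cell L) * volume (B ∩ m.cell M)) := by
    rw [osc, ← hm.sum_volume_inter hA, Finset.mul_sum]
    refine Finset.sum_congr rfl fun K _ => ?_
    rw [Finset.sum_mul, Finset.sum_comm]
    refine Finset.sum_congr rfl fun L _ => ?_
    rw [Finset.sum_mul]
    exact Finset.sum_congr rfl fun M _ => by ring
  rw [h1, h2, h3]
  simp_rw [← Finset.sum_add_distrib, ← add_mul]
  gcongr with K _ L _ M _
  rw [← ENNReal.ofReal_add (abs_nonneg _) (abs_nonneg _)]
  exact ENNReal.ofReal_le_ofReal (abs_sub_le _ _ _)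

theorem lintegral_indicator_pair (hm : m.IsAdmissible Ω Γ ξ) (w : ι → ℝ) {A : Set (Space ℓ)}
    (hA : IsOpen A) :
    ∫⁻ x, ∫⁻ y, (∑ K, ∑ L, ENNReal.ofReal |w K - w L| *
      ((A ∩ m.cell K).indicator 1 x * (A ∩ m.cell L).indicator 1 y)) = osc m w A A := by
  have hmeas : ∀ K, MeasurableSet (A ∩ m.cell K) := fun K => (hA.inter (hm.isOpen K)).measurableSet
  have hind : ∀ K, Measurable ((A ∩ m.cell K).indicator (1 : Space ℓ → ℝ≥0∞)) := fun K =>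
    measurable_one.indicator (hmeas K)
  have h1 : ∀ x, ∫⁻ y, (∑ K, ∑ L, ENNReal.ofReal |w K - w L| *
      ((A ∩ m.cell K).indicator 1 x * (A ∩ m.cell L).indicator 1 y)) =
      ∑ K, ∑ L, ENNReal.ofReal |w K - w L| * volume (A ∩ m.cell L) *
        (A ∩ m.cell K).indicator 1 x := by
    intro x
    rw [lintegral_finsetSum _ fun K _ => by fun_prop]
    refine Finset.sum_congr rfl fun K _ => ?_
    rw [lintegral_finsetSum _ fun L _ => by fun_prop]
    refine Finset.sum_congr rfl fun L _ => ?_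
    rw [lintegral_const_mul _ (by fun_prop), lintegral_const_mul _ (by fun_prop),
      lintegral_indicator_one (hmeas L)]
    ring
  simp_rw [h1]
  rw [lintegral_finsetSum _ fun K _ => by fun_prop, osc]
  refine Finset.sum_congr rfl fun K _ => ?_
  rw [lintegral_finsetSum _ fun L _ => by fun_prop]
  refine Finset.sum_congr rfl fun L _ => ?_
  rw [lintegral_const_mul _ (by fun_prop), lintegral_indicator_one (hmeas K)]
  ring

/-- Since the cells are disjoint, at most one term of the double sum is nonzero, which turns it into
a pointwise quantity. -/
theorem sum_indicator_pair_le (hm : m.IsAdmissible Ω Γ ξ) (w : ι → ℝ) {A : Set (Space ℓ)}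
    (x y : Space ℓ) {c : ℝ≥0∞}
    (h : ∀ K L, x ∈ A ∩ m.cell K → y ∈ A ∩ m.cell L → ENNReal.ofReal |w K - w L| ≤ c) :
    ∑ K, ∑ L, ENNReal.ofReal |w K - w L| *
      ((A ∩ m.cell K).indicator 1 x * (A ∩ m.cell L).indicator 1 y) ≤ c := by
  classical
  by_cases hx : ∃ K, x ∈ A ∩ m.cell K
  · by_cases hy : ∃ L, y ∈ A ∩ m.cell L
    · obtain ⟨K, hK⟩ := hx
      obtain ⟨L, hL⟩ := hy
      rw [Finset.sum_eq_single K, Finset.sum_eq_single L]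
      · simpa [hK, hL] using h K L hK hL
      · intro L' _ hne
        rw [indicator_of_notMem (s := A ∩ m.cell L'), mul_zero, mul_zero]
        exact fun h' => hne (hm.mem_cell_unique h'.2 hL.2)
      · simp
      · intro K' _ hne
        refine Finset.sum_eq_zero fun L' _ => ?_
        rw [indicator_of_notMem (s := A ∩ m.cell K'), zero_mul, mul_zero]
        exact fun h' => hne (hm.mem_cell_unique h'.2 hK.2)
      · simp
    · push Not at hy
      refine le_trans (le_of_eq ?_) zero_le
      refine Finset.sum_eq_zero fun K' _ => Finset.sum_eq_zero fun L' _ => ?_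
      rw [indicator_of_notMem (hy L'), mul_zero, mul_zero]
  · push Not at hx
    refine le_trans (le_of_eq ?_) zero_le
    refine Finset.sum_eq_zero fun K' _ => Finset.sum_eq_zero fun L' _ => ?_
    rw [indicator_of_notMem (hx K'), zero_mul, mul_zero]

theorem mem_sweep_of_segment {S : Set (Space ℓ)} {x h : Space ℓ}
    (hne : (segment ℝ x (x + h) ∩ S).Nonempty) : x ∈ sweep S (-h) (Icc 0 1) := by
  obtain ⟨z, hz, hzS⟩ := hne
  rw [segment_eq_image'] at hz
  obtain ⟨t, ht, rfl⟩ := hz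
  exact ⟨_, hzS, t, ht, by simp⟩

theorem isCompact_sweep {F : Set (Space ℓ)} (hF : IsCompact F) (v : Space ℓ) :
    IsCompact (sweep F v (Icc 0 1)) := by
  have : sweep F v (Icc 0 1) = (fun p : Space ℓ × ℝ => p.1 + p.2 • v) '' (F ×ˢ Icc 0 1) := by
    ext x
    simp only [sweep, mem_ofPred_eq, mem_image, mem_prod, Prod.exists]
    constructor
    · rintro ⟨z, hz, t, ht, rfl⟩; exact ⟨z, t, ⟨hz, ht⟩, rfl⟩
    · rintro ⟨z, t, ⟨hz, ht⟩, rfl⟩; exact ⟨z, hz, t, ht, rfl⟩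
  rw [this]
  exact (hF.prod isCompact_Icc).image (by fun_prop)

theorem MeshData.IsAdmissible.isCompact_interface (hm : m.IsAdmissible Ω Γ ξ) (K L : ι) :
    IsCompact (m.interface K L) :=
  (hm.bounded K).isCompact_closure.inter_right isClosed_closure

/-- Convexity keeps the segment from `x` to `x + h` inside `Ω`, so the difference of values is at
most the sum of the jumps it crosses. For fixed `h`, the points `x` whose segment meets an interface
lie in its sweep along `-h`, of volume at most `‖h‖` times its area. It remains to integrate over
`‖h‖ ≤ R`. -/
theorem osc_convex_le (hm : m.IsAdmissible Ω Γ ξ) (w : ι → ℝ) {A : Set (Space ℓ)}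
    (hA : IsOpen A) (hc : Convex ℝ A) (hAΩ : A ⊆ Ω) {R : ℝ}
    (hR : ∀ x ∈ A, ∀ y ∈ A, ‖y - x‖ ≤ R) :
    osc m w A A ≤ volume (Metric.closedBall (0 : Space ℓ) R) * ENNReal.ofReal R *
      ENNReal.ofReal (m.totalVar w) := by
  classical
  have hmeas : ∀ K, MeasurableSet (A ∩ m.cell K) := fun K => (hA.inter (hm.isOpen K)).measurableSet
  have hind : ∀ K, Measurable ((A ∩ m.cell K).indicator (1 : Space ℓ → ℝ≥0∞)) := fun K =>
    measurable_one.indicator (hmeas K)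
  set F : Space ℓ → Space ℓ → ℝ≥0∞ := fun x y => ∑ K, ∑ L, ENNReal.ofReal |w K - w L| *
      ((A ∩ m.cell K).indicator 1 x * (A ∩ m.cell L).indicator 1 y) with hF
  have hFm : Measurable (Function.uncurry fun x h => F x (x + h)) := by
    simp only [Function.uncurry_def, hF]
    fun_prop
  -- The substitution `y = x + h` and Fubini's theorem put the integral over the displacement
  -- outside.
  have h1 : osc m w A A = ∫⁻ h, ∫⁻ x, F x (x + h) := by
    rw [← lintegral_indicator_pair hm w hA, ← lintegral_lintegral_swap hFm.aemeasurable]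
    refine lintegral_congr fun x => ?_
    exact (lintegral_add_left_eq_self (F x) x).symm
  have h2 : ∀ h, ∫⁻ x, F x (x + h) ≤ (Metric.closedBall (0 : Space ℓ) R).indicator
      (fun _ => ENNReal.ofReal R * ENNReal.ofReal (m.totalVar w)) h := by
    intro h
    by_cases hh : h ∈ Metric.closedBall (0 : Space ℓ) R
    · rw [indicator_of_mem hh]
      have h3 : ∀ x, F x (x + h) ≤ ∑ K, ∑ L, if K ≠ L then
          (sweep (m.interface K L) (-h) (Icc 0 1)).indicator
            (fun _ => ENNReal.ofReal |w K - w L|) x else 0 := by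
        intro x
        refine sum_indicator_pair_le hm w x (x + h) fun K₀ L₀ hK hL => ?_
        refine (hm.abs_sub_le_sum_crossing w ?_ (subset_closure hK.2)
          (subset_closure hL.2)).trans ?_
        · exact ((hc.segment_subset hK.1 hL.1).trans hAΩ).trans subset_closure
        · gcongr with K _ L _
          by_cases hKL : K ≠ L
          · by_cases hne : (segment ℝ x (x + h) ∩ m.interface K L).Nonempty
            · rw [if_pos ⟨hKL, hne⟩, if_pos hKL, indicator_of_mem (mem_sweep_of_segment hne)]
            · rw [if_neg (fun h => hne h.2)]; exact zero_le
          · rw [if_neg (fun h => hKL h.1)]; exact zero_le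
      have hs : ∀ K L, MeasurableSet (sweep (m.interface K L) (-h) (Icc 0 1)) := fun K L =>
        (isCompact_sweep (hm.isCompact_interface K L) _).isClosed.measurableSet
      refine (lintegral_mono h3).trans ?_
      have h4 : ∀ K L, Measurable fun x => if K ≠ L then
          (sweep (m.interface K L) (-h) (Icc 0 1)).indicator
            (fun _ => ENNReal.ofReal |w K - w L|) x else 0 := fun K L => by
        split_ifs
        · exact measurable_const.indicator (hs K L)
        · exact measurable_const
      rw [lintegral_finsetSum _ fun K _ => Finset.measurable_fun_sum _ fun L _ => h4 K L,
        ← hm.ofReal_totalVar, Finset.mul_sum]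
      refine Finset.sum_le_sum fun K _ => ?_
      rw [lintegral_finsetSum _ fun L _ => h4 K L, Finset.mul_sum]
      refine Finset.sum_le_sum fun L _ => ?_
      by_cases hKL : K ≠ L
      · simp only [if_pos hKL]
        rw [lintegral_indicator_const (hs K L), mul_left_comm]
        gcongr
        refine (hm.volume_sweep_interface_le hKL _).trans ?_
        gcongr
        simpa using hh
      · simp [if_neg hKL]
    · rw [indicator_of_notMem hh]
      refine le_of_eq (lintegral_eq_zero_of_ae_eq_zero (Filter.Eventually.of_forall fun x => ?_))
      refine le_antisymm ?_ zero_le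
      refine sum_indicator_pair_le hm w x (x + h) fun K₀ L₀ hK hL => ?_
      exfalso
      apply hh
      have := hR _ hK.1 _ hL.1
      simpa using this
  rw [h1]
  refine (lintegral_mono h2).trans ?_
  rw [lintegral_indicator_const Metric.isClosed_closedBall.measurableSet]
  apply le_of_eq
  ring

end Osc

section Linked

variable {Ω Γ : Set (Space ℓ)} {ξ : ℝ}

theorem Linked.mono {A A' B B' : Set (Space ℓ)} (h : Linked Ω Γ ξ A B) (hA : A' ⊆ A)
    (hB : B' ⊆ B) : Linked Ω Γ ξ A' B' := by
  obtain ⟨C, hC, h⟩ := h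
  exact ⟨C, hC, fun ι κ _ _ m w hm => (osc_mono w hA hB).trans (h ι κ m w hm)⟩

theorem Linked.symm {A B : Set (Space ℓ)} (h : Linked Ω Γ ξ A B) : Linked Ω Γ ξ B A := by
  obtain ⟨C, hC, h⟩ := h
  exact ⟨C, hC, fun ι κ _ _ m w hm => (osc_comm w B A).trans_le (h ι κ m w hm)⟩

theorem Linked.trans {A B C : Set (Space ℓ)} (hΩ : volume Ω ≠ ∞) (hAB : Linked Ω Γ ξ A B)
    (hBC : Linked Ω Γ ξ B C) (hA : A ⊆ Ω) (hB : B ⊆ Ω) (hC : C ⊆ Ω) (h0 : volume B ≠ 0) :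
    Linked Ω Γ ξ A C := by
  obtain ⟨c₁, hc₁, h₁⟩ := hAB
  obtain ⟨c₂, hc₂, h₂⟩ := hBC
  have hB' : volume B ≠ ∞ := ne_top_of_le_ne_top hΩ (measure_mono hB)
  have hA' : volume A ≠ ∞ := ne_top_of_le_ne_top hΩ (measure_mono hA)
  have hC' : volume C ≠ ∞ := ne_top_of_le_ne_top hΩ (measure_mono hC)
  refine ⟨(c₁ * volume C + c₂ * volume A) / volume B, ?_, fun ι κ _ _ m w hm => ?_⟩
  · refine ENNReal.div_ne_top (ENNReal.add_ne_top.2 ⟨?_, ?_⟩) h0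
    · exact ENNReal.mul_ne_top hc₁ hC'
    · exact ENNReal.mul_ne_top hc₂ hA'
  · rw [ENNReal.mul_comm_div, ← mul_div_assoc, ENNReal.le_div_iff_mul_le (Or.inl h0) (Or.inl hB')]
    refine (osc_mul_volume_le hm w hA hB hC).trans ?_
    calc _ ≤ c₁ * ENNReal.ofReal (m.totalVar w) * volume C +
          c₂ * ENNReal.ofReal (m.totalVar w) * volume A := by
          gcongr
          · exact h₁ ι κ m w hm
          · exact h₂ ι κ m w hm
      _ = _ := by ring

theorem Linked.of_convex {A : Set (Space ℓ)} (hA : IsOpen A) (hc : Convex ℝ A) (hAΩ : A ⊆ Ω)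
    (hb : Bornology.IsBounded A) : Linked Ω Γ ξ A A := by
  obtain ⟨R, hR⟩ := Metric.isBounded_iff.1 hb
  refine ⟨volume (Metric.closedBall (0 : Space ℓ) R) * ENNReal.ofReal R,
    ENNReal.mul_ne_top Metric.isBounded_closedBall.measure_lt_top.ne ENNReal.ofReal_ne_top,
    fun ι κ _ _ m w hm => osc_convex_le hm w hA hc hAΩ fun x hx y hy => ?_⟩
  rw [← dist_eq_norm]
  exact hR hy hx

/-- If two bounded convex open sets overlap then what is linked to one is linked to the other. -/
theorem Linked.of_inter {A B D : Set (Space ℓ)} (hΩ : volume Ω ≠ ∞) (hA : IsOpen A)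
    (hB : IsOpen B) (hBc : Convex ℝ B) (hAΩ : A ⊆ Ω) (hBΩ : B ⊆ Ω)
    (hBb : Bornology.IsBounded B) (hDΩ : D ⊆ Ω) (hne : (A ∩ B).Nonempty)
    (h : Linked Ω Γ ξ A D) : Linked Ω Γ ξ B D := by
  have h1 : Linked Ω Γ ξ B (A ∩ B) :=
    (Linked.of_convex hB hBc hBΩ hBb).mono subset_rfl inter_subset_right
  have h2 : Linked Ω Γ ξ (A ∩ B) D := h.mono inter_subset_left subset_rfl
  exact h1.trans hΩ h2 hBΩ (inter_subset_left.trans hAΩ) hDΩ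
    ((hA.inter hB).measure_pos _ hne).ne'

/-- The balls in `Ω` that are linked to `B` and those that are not form two open sets covering `Ω`.
They are disjoint, since overlapping balls share the property. The first meets `Ω`, so connectedness
excludes the second. -/
theorem Linked.of_isPreconnected (hΩo : IsOpen Ω) (hΩ : volume Ω ≠ ∞) (hpre : IsPreconnected Ω)
    {A B : Set (Space ℓ)} (hA : IsOpen A) (hAc : Convex ℝ A) (hAΩ : A ⊆ Ω)
    (hAb : Bornology.IsBounded A) (hAn : A.Nonempty)
    (hB : IsOpen B) (hBc : Convex ℝ B) (hBΩ : B ⊆ Ω)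
    (hBb : Bornology.IsBounded B) (hBn : B.Nonempty) : Linked Ω Γ ξ A B := by
  set P : Set (Space ℓ) → Prop := fun U => ∃ x r, 0 < r ∧ U = Metric.ball x r ∧ U ⊆ Ω with hP
  have hPconv : ∀ U, P U → IsOpen U ∧ Convex ℝ U ∧ U ⊆ Ω ∧ Bornology.IsBounded U := by
    rintro U ⟨x, r, hr, rfl, hU⟩
    exact ⟨Metric.isOpen_ball, convex_ball _ _, hU, Metric.isBounded_ball⟩
  have hball : ∀ x ∈ Ω, ∃ U, P U ∧ x ∈ U := by
    intro x hx
    obtain ⟨r, hr, hU⟩ := Metric.isOpen_iff.1 hΩo x hx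
    exact ⟨_, ⟨x, r, hr, rfl, hU⟩, Metric.mem_ball_self hr⟩
  set S : Set (Space ℓ) := ⋃₀ {U | P U ∧ Linked Ω Γ ξ U B} with hS
  set S' : Set (Space ℓ) := ⋃₀ {U | P U ∧ ¬ Linked Ω Γ ξ U B} with hS'
  have hSo : IsOpen S := isOpen_sUnion fun U hU => (hPconv U hU.1).1
  have hSo' : IsOpen S' := isOpen_sUnion fun U hU => (hPconv U hU.1).1
  have hcov : Ω ⊆ S ∪ S' := by
    intro x hx
    obtain ⟨U, hU, hxU⟩ := hball x hx
    by_cases h : Linked Ω Γ ξ U B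
    · exact Or.inl ⟨U, ⟨hU, h⟩, hxU⟩
    · exact Or.inr ⟨U, ⟨hU, h⟩, hxU⟩
  have hdis : ¬ (Ω ∩ (S ∩ S')).Nonempty := by
    rintro ⟨x, _, ⟨U, ⟨hU, hUB⟩, hxU⟩, ⟨U', ⟨hU', hUB'⟩, hxU'⟩⟩
    obtain ⟨o, _, i, _⟩ := hPconv U hU
    obtain ⟨o', c', i', b'⟩ := hPconv U' hU'
    exact hUB' (Linked.of_inter hΩ o o' c' i i' b' hBΩ ⟨x, hxU, hxU'⟩ hUB)
  have hBS : (Ω ∩ S).Nonempty := by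
    obtain ⟨x, hx⟩ := hBn
    obtain ⟨U, hU, hxU⟩ := hball x (hBΩ hx)
    obtain ⟨o, c, i, b⟩ := hPconv U hU
    exact ⟨x, hBΩ hx, U, ⟨hU, Linked.of_inter hΩ hB o c hBΩ i b hBΩ ⟨x, hx, hxU⟩
      (Linked.of_convex hB hBc hBΩ hBb)⟩, hxU⟩
  have hS'e : ¬ (Ω ∩ S').Nonempty := fun h => hdis (hpre _ _ hSo hSo' hcov hBS h)
  obtain ⟨x, hx⟩ := hAn
  obtain ⟨U, hU, hxU⟩ := hball x (hAΩ hx)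
  obtain ⟨o, c, i, b⟩ := hPconv U hU
  by_cases h : Linked Ω Γ ξ U B
  · exact Linked.of_inter hΩ o hA hAc i hAΩ hAb hBΩ ⟨x, hxU, hx⟩ h
  · exact absurd ⟨x, hAΩ hx, U, ⟨hU, h⟩, hxU⟩ hS'e

/-- Poincaré–Wirtinger inequality on the whole domain. -/
theorem Linked.whole {ι₀ κ₀ : Type} [Fintype ι₀] [Fintype κ₀] {m₀ : MeshData ℓ ι₀ κ₀}
    (hm₀ : m₀.IsAdmissible Ω Γ ξ) (hΩo : IsOpen Ω) (hΩ : volume Ω ≠ ∞)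
    (hpre : IsPreconnected Ω) : Linked Ω Γ ξ Ω Ω := by
  have h : ∀ i j, Linked Ω Γ ξ (m₀.cell i) (m₀.cell j) := fun i j =>
    Linked.of_isPreconnected hΩo hΩ hpre (hm₀.polytope i).isOpen (hm₀.polytope i).convex
      (hm₀.subset i) (hm₀.polytope i).1 ⟨_, hm₀.center_mem i⟩ (hm₀.polytope j).isOpen
      (hm₀.polytope j).convex (hm₀.subset j) (hm₀.polytope j).1 ⟨_, hm₀.center_mem j⟩
  choose C hC h using h
  refine ⟨∑ i, ∑ j, C i j, ?_, fun ι κ _ _ m w hm => ?_⟩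
  · exact ENNReal.sum_ne_top.2 fun i _ => ENNReal.sum_ne_top.2 fun j _ => hC i j
  -- The cells of the fixed mesh `m₀` are convex and exhaust `Ω` up to a null set, so finitely many
  -- constants suffice for every mesh `m`.
  · have h1 : osc m w Ω Ω = ∑ i, ∑ j, osc m w (m₀.cell i) (m₀.cell j) := by
      unfold osc
      have h2 : ∀ K, volume (Ω ∩ m.cell K) = ∑ i, volume (m₀.cell i ∩ m.cell K) := by
        intro K
        rw [inter_eq_right.2 (hm.subset K), ← hm₀.sum_volume_inter (hm.subset K)]
        simp_rw [inter_comm]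
      have h3 : ∀ K L, ENNReal.ofReal |w K - w L| * volume (Ω ∩ m.cell K) *
          volume (Ω ∩ m.cell L) = ∑ i, ∑ j, ENNReal.ofReal |w K - w L| *
            volume (m₀.cell i ∩ m.cell K) * volume (m₀.cell j ∩ m.cell L) := by
        intro K L
        rw [h2, h2, mul_assoc, Finset.sum_mul_sum]
        simp_rw [Finset.mul_sum, mul_assoc]
      simp_rw [h3]
      refine (Finset.sum_congr rfl fun K _ => Finset.sum_comm).trans ?_
      refine Finset.sum_comm.trans (Finset.sum_congr rfl fun i _ => ?_)
      exact (Finset.sum_congr rfl fun K _ => Finset.sum_comm).trans Finset.sum_comm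
    rw [h1]
    simp_rw [Finset.sum_mul]
    exact Finset.sum_le_sum fun i _ => Finset.sum_le_sum fun j _ => h i j ι κ m w hm

end Linked

end TwoPhase

end

/-! ### The trace inequality and the `L¹` Poincaré inequality. -/

open scoped MeasureTheory RealInnerProductSpace ENNReal

noncomputable section

set_option linter.unusedSectionVars false

namespace TwoPhase

open MeasureTheory Set

variable {ℓ : ℕ}

section Trace

variable {ι κ : Type} [Fintype ι] [Fintype κ] {m : MeshData ℓ ι κ} {Ω Γ : Set (Space ℓ)} {ξ : ℝ}

theorem mem_sweep_of_segment_translate {S : Set (Space ℓ)} {z v : Space ℓ} {t : ℝ}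
    (ht : t ∈ Ioc (0 : ℝ) 1) (hne : (segment ℝ z (z + t • v) ∩ S).Nonempty) :
    z + t • v ∈ sweep S v (Icc 0 1) := by
  obtain ⟨y, hy, hyS⟩ := hne
  rw [segment_eq_image'] at hy
  obtain ⟨s, hs, rfl⟩ := hy
  refine ⟨_, hyS, t - s * t, ⟨?_, ?_⟩, ?_⟩
  · nlinarith [hs.2, ht.1]
  · nlinarith [hs.1, ht.1, ht.2]
  · simp only [add_sub_cancel_left, smul_smul, sub_smul]
    abel

/-- The trace inequality: on the set swept by a flat part `F` of the Dirichlet boundary, a function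
that is constant on control volumes is controlled by its jumps and its values on Dirichlet faces. -/
theorem sum_sweep_le (hm : m.IsAdmissible Ω Γ ξ) (hΓ : MeasurableSet Γ) (hΓΩ : Γ ⊆ closure Ω)
    (w : ι → ℝ) {F : Set (Space ℓ)} {η v : Space ℓ} {c : ℝ} (hη : ‖η‖ = 1)
    (hFm : MeasurableSet F) (hF : ∀ z ∈ F, ⟪η, z⟫ = c) (hv : ⟪η, v⟫ ≠ 0) (hFΓ : F ⊆ Γ)
    (hin : ∀ z ∈ F, ∀ t ∈ Ioc (0 : ℝ) 1, z + t • v ∈ Ω) :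
    ∑ K, ENNReal.ofReal |w K| * volume (sweep F v (Ioc 0 1) ∩ m.cell K) ≤
      ENNReal.ofReal ‖v‖ * (ENNReal.ofReal (m.totalVar w) + ENNReal.ofReal (m.bdryVar w)) := by
  classical
  set P := sweep F v (Ioc 0 1) with hP
  have hPm : MeasurableSet P := measurableSet_sweep hFm measurableSet_Ioc hF hv
  set N : ι → Set (Space ℓ) := fun K =>
    (closure (m.cell K) ∩ Γ) \ ⋃ (k : κ) (_ : m.owner k = K), m.face k with hN
  have hNm : ∀ K, MeasurableSet (N K) := fun K =>
    (isClosed_closure.measurableSet.inter hΓ).diff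
      (MeasurableSet.iUnion fun k => MeasurableSet.iUnion fun _ => hm.face_measurable k)
  have hsw : ∀ S : Set (Space ℓ), MeasurableSet S → MeasurableSet (sweep (S ∩ F) v (Icc 0 1)) :=
    fun S hS => measurableSet_sweep (hS.inter hFm) measurableSet_Icc (fun z hz => hF z hz.2) hv
  have hswl : ∀ S : Set (Space ℓ), MeasurableSet S →
      volume (sweep (S ∩ F) v (Icc 0 1)) ≤ ENNReal.ofReal ‖v‖ * μHE[ℓ - 1] S := fun S hS =>
    (volume_sweep_le v hη (hS.inter hFm) (fun z hz => hF z hz.2)).trans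
      (mul_le_mul_right (measure_mono inter_subset_left) _)
  have hs : ∀ K L, MeasurableSet (sweep (m.interface K L) v (Icc 0 1)) := fun K L =>
    (isCompact_sweep (hm.isCompact_interface K L) _).isClosed.measurableSet
  -- Three majorants: `f₁` collects the jumps crossed on the way to the foot in `F`, `f₂` the
  -- boundary value when the foot lies on a Dirichlet face, and `f₃` the feet missed by the faces, a
  -- null set.
  set f₁ : Space ℓ → ℝ≥0∞ := fun x => ∑ K, ∑ L, if K ≠ L then
    (sweep (m.interface K L) v (Icc 0 1)).indicator (fun _ => ENNReal.ofReal |w K - w L|) x else 0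
    with hf₁
  set f₂ : Space ℓ → ℝ≥0∞ := fun x => ∑ k, (sweep (m.face k ∩ F) v (Icc 0 1)).indicator
    (fun _ => ENNReal.ofReal |w (m.owner k)|) x with hf₂
  set f₃ : Space ℓ → ℝ≥0∞ := fun x => ∑ K, (sweep (N K ∩ F) v (Icc 0 1)).indicator
    (fun _ => ENNReal.ofReal |w K|) x with hf₃
  have hm₁' : ∀ K L, Measurable fun x => if K ≠ L then
      (sweep (m.interface K L) v (Icc 0 1)).indicator
        (fun _ => ENNReal.ofReal |w K - w L|) x else 0 := fun K L => by
    split_ifs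
    · exact measurable_const.indicator (hs K L)
    · exact measurable_const
  have hm₁ : Measurable f₁ :=
    Finset.measurable_fun_sum _ fun K _ => Finset.measurable_fun_sum _ fun L _ => hm₁' K L
  have hm₂' : ∀ k, Measurable fun x => (sweep (m.face k ∩ F) v (Icc 0 1)).indicator
    (fun _ => ENNReal.ofReal |w (m.owner k)|) x := fun k =>
      measurable_const.indicator (hsw _ (hm.face_measurable k))
  have hm₂ : Measurable f₂ := Finset.measurable_fun_sum _ fun k _ => hm₂' k
  have hm₃' : ∀ K, Measurable fun x => (sweep (N K ∩ F) v (Icc 0 1)).indicator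
    (fun _ => ENNReal.ofReal |w K|) x := fun K => measurable_const.indicator (hsw _ (hNm K))
  have i₁ : ∫⁻ x, f₁ x ≤ ENNReal.ofReal ‖v‖ * ENNReal.ofReal (m.totalVar w) := by
    rw [lintegral_finsetSum _ fun K _ => Finset.measurable_fun_sum _ fun L _ => hm₁' K L,
      ← hm.ofReal_totalVar, Finset.mul_sum]
    refine Finset.sum_le_sum fun K _ => ?_
    rw [lintegral_finsetSum _ fun L _ => hm₁' K L, Finset.mul_sum]
    refine Finset.sum_le_sum fun L _ => ?_
    by_cases hKL : K ≠ L
    · simp only [if_pos hKL]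
      rw [lintegral_indicator_const (hs K L), mul_left_comm]
      gcongr
      exact hm.volume_sweep_interface_le hKL _
    · simp [if_neg hKL]
  have i₂ : ∫⁻ x, f₂ x ≤ ENNReal.ofReal ‖v‖ * ENNReal.ofReal (m.bdryVar w) := by
    rw [lintegral_finsetSum _ fun k _ => hm₂' k, ← hm.ofReal_bdryVar, Finset.mul_sum]
    refine Finset.sum_le_sum fun k _ => ?_
    rw [lintegral_indicator_const (hsw _ (hm.face_measurable k)), mul_left_comm]
    gcongr
    exact hswl _ (hm.face_measurable k)
  have i₃ : ∫⁻ x, f₃ x = 0 := by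
    rw [lintegral_finsetSum _ fun K _ => hm₃' K]
    refine Finset.sum_eq_zero fun K _ => ?_
    rw [lintegral_indicator_const (hsw _ (hNm K))]
    have : volume (sweep (N K ∩ F) v (Icc 0 1)) = 0 := by
      refine le_antisymm ((hswl _ (hNm K)).trans (le_of_eq ?_)) zero_le
      rw [hN, hm.face_cover K, mul_zero]
    rw [this, mul_zero]
  have hpt : ∀ x, ∑ K, (P ∩ m.cell K).indicator (fun _ => ENNReal.ofReal |w K|) x ≤
      f₁ x + f₂ x + f₃ x := by
    intro x
    by_cases hx : ∃ K, x ∈ P ∩ m.cell K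
    · obtain ⟨K, hK⟩ := hx
      rw [Finset.sum_eq_single K, indicator_of_mem hK]
      · obtain ⟨⟨z, hz, t, ht, rfl⟩, hxK⟩ := hK
        have hzΩ : z ∈ closure Ω := hΓΩ (hFΓ hz)
        have hseg : segment ℝ z (z + t • v) ⊆ closure Ω := by
          intro y hy
          rw [segment_eq_image'] at hy
          obtain ⟨s, hs, rfl⟩ := hy
          rcases hs.1.eq_or_lt with h0 | h0
          · simpa [← h0] using hzΩ
          · refine subset_closure ?_
            have := hin z hz (s * t) ⟨mul_pos h0 ht.1, mul_le_one₀ hs.2 ht.1.le ht.2⟩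
            simpa [smul_smul] using this
        -- The foot `z` lies in the closure of some cell `K'`. It is either on a Dirichlet face
        -- owned by `K'` or in the leftover set `N K'`.
        have hzΩ' := hzΩ
        rw [hm.closure_Ω] at hzΩ'
        obtain ⟨K', hK'⟩ := mem_iUnion.1 hzΩ'
        have h1 := hm.abs_sub_le_sum_crossing w hseg hK' (subset_closure hxK)
        have h2 : ENNReal.ofReal |w K' - w K| ≤ f₁ (z + t • v) := by
          refine h1.trans ?_
          simp only [hf₁]
          gcongr with K _ L _
          by_cases hKL : K ≠ L
          · by_cases hne : (segment ℝ z (z + t • v) ∩ m.interface K L).Nonempty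
            · rw [if_pos ⟨hKL, hne⟩, if_pos hKL,
                indicator_of_mem (mem_sweep_of_segment_translate ht hne)]
            · rw [if_neg (fun h => hne h.2)]; exact zero_le
          · rw [if_neg (fun h => hKL h.1)]; exact zero_le
        have ht' : t ∈ Icc (0 : ℝ) 1 := Ioc_subset_Icc_self ht
        have h3 : ENNReal.ofReal |w K'| ≤ f₂ (z + t • v) + f₃ (z + t • v) := by
          by_cases hk : ∃ k, m.owner k = K' ∧ z ∈ m.face k
          · obtain ⟨k, rfl, hzk⟩ := hk
            refine le_add_right ?_
            refine le_trans ?_ (Finset.single_le_sum (fun _ _ => zero_le) (Finset.mem_univ k))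
            rw [indicator_of_mem]
            exact ⟨z, ⟨hzk, hz⟩, t, ht', rfl⟩
          · refine le_add_left ?_
            refine le_trans ?_ (Finset.single_le_sum (fun _ _ => zero_le) (Finset.mem_univ K'))
            rw [indicator_of_mem]
            refine ⟨z, ⟨⟨⟨hK', hFΓ hz⟩, ?_⟩, hz⟩, t, ht', rfl⟩
            simp only [mem_iUnion, not_exists]
            exact fun k h1 h2 => hk ⟨k, h1, h2⟩
        calc ENNReal.ofReal |w K| ≤ ENNReal.ofReal (|w K' - w K| + |w K'|) := by
              refine ENNReal.ofReal_le_ofReal ?_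
              rw [abs_sub_comm]
              have := abs_add_le (w K - w K') (w K')
              simpa using this
          _ = ENNReal.ofReal |w K' - w K| + ENNReal.ofReal |w K'| :=
              ENNReal.ofReal_add (abs_nonneg _) (abs_nonneg _)
          _ ≤ _ := by rw [add_assoc]; exact add_le_add h2 h3
      · intro K' _ hne
        rw [indicator_of_notMem]
        exact fun h' => hne (hm.mem_cell_unique h'.2 hK.2)
      · simp
    · push Not at hx
      refine le_trans (le_of_eq ?_) zero_le
      exact Finset.sum_eq_zero fun K' _ => indicator_of_notMem (hx K') _
  calc ∑ K, ENNReal.ofReal |w K| * volume (P ∩ m.cell K)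
      = ∫⁻ x, ∑ K, (P ∩ m.cell K).indicator (fun _ => ENNReal.ofReal |w K|) x := by
        rw [lintegral_finsetSum _ fun K _ =>
          measurable_const.indicator (hPm.inter (hm.isOpen K).measurableSet)]
        refine Finset.sum_congr rfl fun K _ => ?_
        rw [lintegral_indicator_const (hPm.inter (hm.isOpen K).measurableSet)]
    _ ≤ ∫⁻ x, f₁ x + f₂ x + f₃ x := lintegral_mono hpt
    _ = (∫⁻ x, f₁ x) + (∫⁻ x, f₂ x) + ∫⁻ x, f₃ x := by
        rw [lintegral_add_left (f := fun x => f₁ x + f₂ x) (hm₁.add hm₂), lintegral_add_left hm₁]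
    _ ≤ _ := by
        rw [i₃, add_zero, mul_add]
        exact add_le_add i₁ i₂

end Trace

/-- A piece of a Dirichlet face from which a fixed direction leads into the adjacent control
volume. -/
theorem exists_inward_sweep {ι κ : Type} [Fintype ι] [Fintype κ] {m : MeshData ℓ ι κ}
    {Ω Γ : Set (Space ℓ)} {ξ : ℝ} (hm : m.IsAdmissible Ω Γ ξ) (hΓΩ : Γ ⊆ closure Ω)
    (hpos : 0 < μHE[ℓ - 1] Γ) :
    ∃ (F : Set (Space ℓ)) (η v : Space ℓ) (c : ℝ), ‖η‖ = 1 ∧ MeasurableSet F ∧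
      (∀ z ∈ F, ⟪η, z⟫ = c) ∧ ⟪η, v⟫ ≠ 0 ∧ F ⊆ Γ ∧
      (∀ z ∈ F, ∀ t ∈ Ioc (0 : ℝ) 1, z + t • v ∈ Ω) ∧
      0 < volume (sweep F v (Ioc 0 1)) := by
  -- Without Dirichlet faces the covering condition would make `Γ` null.
  have hk : Nonempty κ := by
    by_contra hk
    rw [not_nonempty_iff] at hk
    refine hpos.ne' (measure_mono_null (t := ⋃ K, closure (m.cell K) ∩ Γ) ?_ ?_)
    · intro x hx
      have := hΓΩ hx
      rw [hm.closure_Ω] at this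
      obtain ⟨K, hK⟩ := mem_iUnion.1 this
      exact mem_iUnion.2 ⟨K, hK, hx⟩
    · refine measure_iUnion_null fun K => ?_
      have := hm.face_cover K
      simpa using this
  obtain ⟨k⟩ := hk
  -- Choosing `y` in the support of the measure on the face ensures that the piece of the face near
  -- `y` keeps positive measure.
  obtain ⟨y, hy, hypos⟩ := exists_mem_forall_mem_nhdsWithin_pos_measure (hm.face_pos k).ne'
  set Q := m.cell (m.owner k) with hQ
  set a := m.center (m.owner k) with ha
  obtain ⟨r, hr, hball⟩ := Metric.isOpen_iff.1 (hm.isOpen (m.owner k)) a (hm.center_mem _)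
  have hF : ∀ z ∈ m.face k ∩ Metric.ball y r, ⟪m.extNormal k, z⟫ =
      m.extDist k + ⟪m.extNormal k, a⟫ := fun z hz => hm.face_flat' k z hz.1
  have hFm : MeasurableSet (m.face k ∩ Metric.ball y r) :=
    (hm.face_measurable k).inter measurableSet_ball
  have hv : ⟪m.extNormal k, a - y⟫ = - m.extDist k := by
    have := hm.face_flat' k y hy
    rw [inner_sub_right, this]
    ring
  have hv0 : ⟪m.extNormal k, a - y⟫ ≠ 0 := by
    rw [hv]
    exact neg_ne_zero.2 (hm.extDist_pos k).ne'
  refine ⟨m.face k ∩ Metric.ball y r, m.extNormal k, a - y, _, hm.extNormal_unit k,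
    hFm, hF, hv0, fun z hz => (hm.face_subset k hz.1).2, ?_, ?_⟩
  · rintro z ⟨hz, hzy⟩ t ht
    refine hm.subset (m.owner k) ?_
    have h1 : z ∈ closure Q := (hm.face_subset k hz).1
    -- The vector `a - y` leads from `z` to the interior point `a + (z - y)`, within distance `r` of
    -- the centre; convexity then keeps `z + t • (a - y)` in the cell.
    have h2 : a + (z - y) ∈ interior Q := by
      rw [(hm.isOpen _).interior_eq]
      refine hball ?_
      rw [mem_ball_iff_norm, add_sub_cancel_left]
      exact mem_ball_iff_norm.1 hzy
    have h3 := (hm.convex (m.owner k)).add_smul_sub_mem_interior' h1 h2 ht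
    have h4 : z + t • (a + (z - y) - z) = z + t • (a - y) := by
      congr 2; abel
    rw [h4] at h3
    exact interior_subset h3
  · rw [volume_sweep (hm.extNormal_unit k) hFm measurableSet_Ioc hF hv0]
    have h1 : 0 < μHE[ℓ - 1] (m.face k ∩ Metric.ball y r) :=
      hypos _ (Filter.inter_mem self_mem_nhdsWithin (mem_nhdsWithin_of_mem_nhds
        (Metric.ball_mem_nhds y hr)))
    refine pos_iff_ne_zero.2 (mul_ne_zero (mul_ne_zero ?_ ?_) h1.ne')
    · rw [hv, abs_neg, abs_of_pos (hm.extDist_pos k)]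
      exact (ENNReal.ofReal_pos.2 (hm.extDist_pos k)).ne'
    · simp

/-- The `L¹` Poincaré inequality, with a constant that does not depend on the mesh. -/
theorem exists_poincare_l1 {Ω Γ : Set (Space ℓ)} (ξ : ℝ) (hΩo : IsOpen Ω)
    (hΩb : Bornology.IsBounded Ω) (hΩc : IsPreconnected Ω) (hΓΩ : Γ ⊆ closure Ω)
    (hΓ : MeasurableSet Γ) (hpos : 0 < μHE[ℓ - 1] Γ) :
    ∃ C : ℝ, 0 < C ∧ ∀ (ι κ : Type) [Fintype ι] [Fintype κ] (m : MeshData ℓ ι κ) (w : ι → ℝ),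
      m.IsAdmissible Ω Γ ξ → ∑ K, |w K| * m.vol K ≤ C * (m.totalVar w + m.bdryVar w) := by
  -- If no admissible mesh exists the claim is vacuous. Otherwise one such mesh is fixed, and the
  -- constant is built from it alone.
  by_cases hex : ∃ (ι κ : Type) (_ : Fintype ι) (_ : Fintype κ) (m : MeshData ℓ ι κ),
      m.IsAdmissible Ω Γ ξ
  swap
  · exact ⟨1, one_pos, fun ι κ _ _ m w hm => absurd ⟨ι, κ, _, inferInstance, m, hm⟩ hex⟩
  obtain ⟨ι₀, κ₀, _, _, m₀, hm₀⟩ := hex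
  have hΩ : volume Ω ≠ ∞ := hΩb.measure_lt_top.ne
  obtain ⟨F, η, v, c, hη, hFm, hF, hv, hFΓ, hin, hP⟩ := exists_inward_sweep hm₀ hΓΩ hpos
  set P := sweep F v (Ioc 0 1) with hPdef
  have hPΩ : P ⊆ Ω := by
    rintro x ⟨z, hz, t, ht, rfl⟩
    exact hin z hz t ht
  have hPt : volume P ≠ ∞ := ne_top_of_le_ne_top hΩ (measure_mono hPΩ)
  obtain ⟨C₁, hC₁, h₁⟩ := (Linked.whole hm₀ hΩo hΩ hΩc).mono subset_rfl hPΩ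
  set C := (C₁ + volume Ω * ENNReal.ofReal ‖v‖) / volume P with hC
  have hCt : C ≠ ∞ := by
    refine ENNReal.div_ne_top (ENNReal.add_ne_top.2 ⟨hC₁, ?_⟩) hP.ne'
    exact ENNReal.mul_ne_top hΩ ENNReal.ofReal_ne_top
  refine ⟨C.toReal + 1, by positivity, fun ι κ _ _ m w hm => ?_⟩
  have hTV := m.totalVar_nonneg w
  have hBV := m.bdryVar_nonneg w
  have key : (∑ K, ENNReal.ofReal |w K| * volume (m.cell K)) ≤
      C * (ENNReal.ofReal (m.totalVar w) + ENNReal.ofReal (m.bdryVar w)) := by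
    rw [hC, ENNReal.mul_comm_div, ← mul_div_assoc,
      ENNReal.le_div_iff_mul_le (Or.inl hP.ne') (Or.inl hPt)]
    have e1 : (∑ K, ENNReal.ofReal |w K| * volume (m.cell K)) * volume P =
        ∑ K, ∑ L, ENNReal.ofReal |w K| * volume (Ω ∩ m.cell K) * volume (P ∩ m.cell L) := by
      rw [← hm.sum_volume_inter hPΩ, Finset.sum_mul_sum]
      refine Finset.sum_congr rfl fun K _ => Finset.sum_congr rfl fun L _ => ?_
      rw [inter_eq_right.2 (hm.subset K)]
    have e2 : ∑ K, ∑ L, ENNReal.ofReal |w L| * volume (Ω ∩ m.cell K) * volume (P ∩ m.cell L) =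
        volume Ω * ∑ L, ENNReal.ofReal |w L| * volume (P ∩ m.cell L) := by
      rw [← hm.sum_volume_inter (A := Ω) subset_rfl, Finset.sum_mul_sum]
      exact Finset.sum_congr rfl fun K _ => Finset.sum_congr rfl fun L _ => by ring
    -- The inequality `|w K| ≤ |w K - w L| + |w L|` is averaged over a first point in `Ω` and a
    -- second in `P`. The first part is an oscillation, the second is controlled by the trace
    -- inequality.
    calc _ = _ := e1
      _ ≤ osc m w Ω P + ∑ K, ∑ L, ENNReal.ofReal |w L| * volume (Ω ∩ m.cell K) *
            volume (P ∩ m.cell L) := by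
          rw [osc]
          simp_rw [← Finset.sum_add_distrib, ← add_mul]
          gcongr with K _ L _
          rw [← ENNReal.ofReal_add (abs_nonneg _) (abs_nonneg _)]
          refine ENNReal.ofReal_le_ofReal ?_
          have := abs_add_le (w K - w L) (w L)
          simpa using this
      _ ≤ C₁ * ENNReal.ofReal (m.totalVar w) + volume Ω * (ENNReal.ofReal ‖v‖ *
            (ENNReal.ofReal (m.totalVar w) + ENNReal.ofReal (m.bdryVar w))) := by
          rw [e2]
          gcongr
          · exact h₁ ι κ m w hm
          · exact sum_sweep_le hm hΓ hΓΩ w hη hFm hF hv hFΓ hin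
      _ ≤ C₁ * (ENNReal.ofReal (m.totalVar w) + ENNReal.ofReal (m.bdryVar w)) +
            volume Ω * (ENNReal.ofReal ‖v‖ *
            (ENNReal.ofReal (m.totalVar w) + ENNReal.ofReal (m.bdryVar w))) := by
          gcongr
          exact le_self_add
      _ = _ := by ring
  have e3 : ENNReal.ofReal (∑ K, |w K| * m.vol K) =
      ∑ K, ENNReal.ofReal |w K| * volume (m.cell K) := by
    rw [ENNReal.ofReal_sum_of_nonneg fun K _ => mul_nonneg (abs_nonneg _) (m.vol_nonneg K)]
    refine Finset.sum_congr rfl fun K _ => ?_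
    rw [ENNReal.ofReal_mul (abs_nonneg _), hm.ofReal_vol]
  rw [← e3, ← ENNReal.ofReal_add hTV hBV, ← ENNReal.ofReal_toReal hCt,
    ← ENNReal.ofReal_mul ENNReal.toReal_nonneg, ENNReal.ofReal_le_ofReal_iff (by positivity)] at key
  refine key.trans ?_
  nlinarith

end TwoPhase

end

/-! ### Cones over Dirichlet faces and the discrete `L²` Poincaré inequality. -/

open scoped MeasureTheory RealInnerProductSpace ENNReal

noncomputable section

set_option linter.unusedSectionVars false

namespace TwoPhase

open MeasureTheory Set

variable {ℓ : ℕ}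

namespace MeshData

variable {ι κ : Type} [Fintype ι] [Fintype κ] {m : MeshData ℓ ι κ} {Ω Γ : Set (Space ℓ)} {ξ : ℝ}

namespace IsAdmissible

theorem cdist_pos (hm : m.IsAdmissible Ω Γ ξ) {K L : ι} (h : L ∈ m.nbrs K) : 0 < m.cdist K L := by
  refine dist_pos.2 fun h' => (mem_nbrs.1 h).1 ?_
  exact hm.mem_cell_unique (hm.center_mem K) (h' ▸ hm.center_mem L)

theorem norm_normal (hm : m.IsAdmissible Ω Γ ξ) {K L : ι} (h : L ∈ m.nbrs K) :
    ‖m.normal K L‖ = 1 := by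
  have hd := hm.cdist_pos h
  rw [normal, norm_smul, norm_inv, Real.norm_of_nonneg hd.le, ← dist_eq_norm, dist_comm]
  exact inv_mul_cancel₀ hd.ne'

theorem face_nonempty (hm : m.IsAdmissible Ω Γ ξ) (k : κ) : (m.face k).Nonempty :=
  nonempty_of_measure_ne_zero (hm.face_pos k).ne'

theorem extDist_le (hm : m.IsAdmissible Ω Γ ξ) {R : ℝ}
    (hR : ∀ x ∈ closure Ω, ∀ y ∈ closure Ω, ‖x - y‖ ≤ R) (k : κ) : m.extDist k ≤ R := by
  obtain ⟨z, hz⟩ := hm.face_nonempty k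
  rw [← hm.face_flat k z hz]
  refine (real_inner_le_norm _ _).trans ?_
  rw [hm.extNormal_unit, one_mul]
  refine hR _ ?_ _ (subset_closure (hm.subset _ (hm.center_mem _)))
  exact closure_mono (hm.subset _) (hm.face_subset k hz).1

theorem trans_nonneg (hm : m.IsAdmissible Ω Γ ξ) {K L : ι} (h : L ∈ m.nbrs K) :
    0 ≤ m.trans K L := div_nonneg (m.area_nonneg _ _) (hm.cdist_pos h).le

theorem extTrans_nonneg (hm : m.IsAdmissible Ω Γ ξ) (k : κ) : 0 ≤ m.extTrans k :=
  div_nonneg (m.extArea_nonneg _) (hm.extDist_pos k).le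

theorem homothety_mem (hm : m.IsAdmissible Ω Γ ξ) {K : ι} {z : Space ℓ}
    (hz : z ∈ closure (m.cell K)) {t : ℝ} (ht0 : 0 ≤ t) (ht1 : t < 1) :
    AffineMap.homothety (m.center K) t z ∈ m.cell K := by
  have h2 : m.center K ∈ interior (m.cell K) := by
    rw [(hm.isOpen _).interior_eq]; exact hm.center_mem K
  have h3 := (hm.convex K).add_smul_sub_mem_interior' hz h2
    (t := 1 - t) ⟨by linarith, by linarith⟩
  have h4 : z + (1 - t) • (m.center K - z) = AffineMap.homothety (m.center K) t z := by
    simp only [AffineMap.homothety_apply, vsub_eq_sub, vadd_eq_add, sub_smul, smul_sub, one_smul]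
    abel
  rw [h4] at h3
  exact interior_subset h3

/-- The Dirichlet faces of a control volume span cones inside the control volume that do not
overlap. -/
theorem sum_extArea_mul_extDist_le (hm : m.IsAdmissible Ω Γ ξ) (hℓ : 1 ≤ ℓ) (hΩ : IsOpen Ω)
    (hΓ : Γ ⊆ frontier Ω) (K : ι) :
    ∑ k ∈ m.extFaces K, m.extArea k * m.extDist k ≤ 2 ^ ℓ * m.vol K := by
  classical
  -- Removing the null overlaps with the other faces of the same cell makes the cones genuinely
  -- disjoint without changing the measures.
  set S : κ → Set (Space ℓ) := fun k =>
    m.face k \ ⋃ (k' : κ) (_ : k ≠ k' ∧ m.owner k = m.owner k'), m.face k' with hS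
  have hSm : ∀ k, MeasurableSet (S k) := fun k => (hm.face_measurable k).diff
    (MeasurableSet.iUnion fun k => MeasurableSet.iUnion fun _ => hm.face_measurable k)
  have hSμ : ∀ k, μHE[ℓ - 1] (S k) = μHE[ℓ - 1] (m.face k) := by
    intro k
    have h0 : μHE[ℓ - 1] (m.face k ∩ ⋃ (k' : κ) (_ : k ≠ k' ∧ m.owner k = m.owner k'), m.face k') =
        0 := by
      simp only [inter_iUnion]
      exact measure_iUnion_null fun k' => measure_iUnion_null fun h =>
        hm.face_disjoint k k' h.1 h.2
    exact measure_sdiff_null' h0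
  have hflat : ∀ k, ∀ z ∈ S k, ⟪m.extNormal k, z - m.center (m.owner k)⟫ = m.extDist k :=
    fun k z hz => hm.face_flat k z hz.1
  have hsub : ∀ k ∈ m.extFaces K, coneOver (S k) (m.center K) ⊆ m.cell K := by
    intro k hk x
    simp only [extFaces, Finset.mem_filter, Finset.mem_univ, true_and] at hk
    rintro ⟨z, hz, t, ht, rfl⟩
    refine hm.homothety_mem (hk ▸ (hm.face_subset k hz.1).1) (by linarith [ht.1]) ht.2
  have hnot : ∀ k, ∀ z ∈ m.face k, z ∉ m.cell (m.owner k) := by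
    intro k z hz hzK
    have h1 := hΓ (hm.face_subset k hz).2
    rw [hΩ.frontier_eq] at h1
    exact h1.2 (hm.subset _ hzK)
  -- A ray from the centre meets the faces in at most one point: any closer point of the ray would
  -- be interior to the cell, whereas faces lie on `∂Ω`.
  have hlt : ∀ k ∈ m.extFaces K, ∀ k' ∈ m.extFaces K, ∀ z ∈ m.face k, ∀ z' ∈ m.face k',
      ∀ t t' : ℝ, 0 < t → AffineMap.homothety (m.center K) t z =
        AffineMap.homothety (m.center K) t' z' → ¬ t < t' := by
    intro k hk k' hk' z hz z' hz' t t' ht0 heq htt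
    simp only [extFaces, Finset.mem_filter, Finset.mem_univ, true_and] at hk hk'
    have ht' : t' ≠ 0 := (ht0.trans htt).ne'
    have h1 : z' = AffineMap.homothety (m.center K) (t'⁻¹ * t) z := by
      rw [AffineMap.homothety_mul_apply, heq, ← AffineMap.homothety_mul_apply, inv_mul_cancel₀ ht']
      simp
    have h2 := hm.homothety_mem (K := K) (z := z) (hk ▸ (hm.face_subset k hz).1) (t := t'⁻¹ * t)
      (mul_nonneg (inv_nonneg.2 (ht0.trans htt).le) ht0.le)
      (by rw [inv_mul_lt_iff₀ (ht0.trans htt)]; linarith)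
    rw [← h1, ← hk'] at h2
    exact hnot k' z' hz' h2
  have hdisj : (m.extFaces K : Set κ).PairwiseDisjoint fun k => coneOver (S k) (m.center K) := by
    intro k hk k' hk' hne
    rw [Function.onFun, Set.disjoint_left]
    rintro x ⟨z, hz, t, ht, rfl⟩ ⟨z', hz', t', ht', heq⟩
    have ht0 : 0 < t := by linarith [ht.1]
    have ht0' : 0 < t' := by linarith [ht'.1]
    have htt : t = t' := le_antisymm (not_lt.1 (hlt k' hk' k hk z' hz'.1 z hz.1 t' t ht0' heq.symm))
      (not_lt.1 (hlt k hk k' hk' z hz.1 z' hz'.1 t t' ht0 heq))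
    subst htt
    have hzz : z = z' := by
      have := congrArg (AffineMap.homothety (m.center K) t⁻¹) heq
      rw [← AffineMap.homothety_mul_apply, ← AffineMap.homothety_mul_apply,
        inv_mul_cancel₀ ht0.ne'] at this
      simpa using this
    subst hzz
    have hk2 := hk; have hk2' := hk'
    simp only [extFaces, Finset.coe_filter, Finset.mem_univ, true_and, mem_ofPred_eq] at hk2 hk2'
    exact hz.2 (mem_iUnion₂.2 ⟨k', ⟨hne, hk2.trans hk2'.symm⟩, hz'.1⟩)
  have hle : ∀ k ∈ m.extFaces K, ENNReal.ofReal (m.extDist k * (1 / 2) ^ ℓ) * μHE[ℓ - 1] (m.face k) ≤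
      volume (coneOver (S k) (m.center K)) := by
    intro k hk
    simp only [extFaces, Finset.mem_filter, Finset.mem_univ, true_and] at hk
    rw [← hSμ, ← hk]
    exact le_volume_coneOver hℓ (hm.extNormal_unit k) (hm.extDist_pos k) (hSm k) (hflat k)
  have hcm : ∀ k ∈ m.extFaces K, MeasurableSet (coneOver (S k) (m.center K)) := by
    intro k hk
    simp only [extFaces, Finset.mem_filter, Finset.mem_univ, true_and] at hk
    rw [← hk]
    exact measurableSet_coneOver (hm.extDist_pos k) (hSm k) (hflat k)
  have hsum : ∑ k ∈ m.extFaces K, ENNReal.ofReal (m.extDist k * (1 / 2) ^ ℓ) *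
      μHE[ℓ - 1] (m.face k) ≤ volume (m.cell K) := by
    refine (Finset.sum_le_sum hle).trans ?_
    rw [← measure_biUnion_finset hdisj hcm]
    exact measure_mono (iUnion₂_subset hsub)
  have hreal : ENNReal.ofReal (∑ k ∈ m.extFaces K, m.extDist k * (1 / 2) ^ ℓ * m.extArea k) ≤
      ENNReal.ofReal (m.vol K) := by
    rw [hm.ofReal_vol, ENNReal.ofReal_sum_of_nonneg]
    · refine le_trans (le_of_eq ?_) hsum
      refine Finset.sum_congr rfl fun k _ => ?_
      rw [ENNReal.ofReal_mul (mul_nonneg (hm.extDist_pos k).le (by positivity)), hm.ofReal_extArea]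
    · intro k _
      exact mul_nonneg (mul_nonneg (hm.extDist_pos k).le (by positivity)) (m.extArea_nonneg k)
  rw [ENNReal.ofReal_le_ofReal_iff (m.vol_nonneg K)] at hreal
  have h2 : (2 : ℝ) ^ ℓ * (1 / 2) ^ ℓ = 1 := by rw [← mul_pow]; norm_num
  calc ∑ k ∈ m.extFaces K, m.extArea k * m.extDist k
      = 2 ^ ℓ * ∑ k ∈ m.extFaces K, m.extDist k * (1 / 2) ^ ℓ * m.extArea k := by
        rw [Finset.mul_sum]
        refine Finset.sum_congr rfl fun k _ => ?_
        linear_combination (-(m.extArea k * m.extDist k)) * h2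
    _ ≤ _ := by gcongr

end IsAdmissible

/-- The discrete Dirichlet energy of a function that vanishes on the Dirichlet faces. -/
def energy (m : MeshData ℓ ι κ) (u : ι → ℝ) : ℝ :=
  ∑ K, (∑ L ∈ m.nbrs K, m.trans K L * (u L - u K) ^ 2 +
    ∑ k ∈ m.extFaces K, m.extTrans k * u K ^ 2)

end MeshData

open MeshData

/-- The discrete `L²` Poincaré inequality. -/
theorem exists_poincare_l2 {Ω Γ : Set (Space ℓ)} {ξ : ℝ} (hξ : 0 < ξ) (hΩo : IsOpen Ω)
    (hΩb : Bornology.IsBounded Ω) (hΩc : IsPreconnected Ω) (hΓΩ : Γ ⊆ closure Ω)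
    (hΓ : MeasurableSet Γ) (hpos : 0 < μHE[ℓ - 1] Γ) :
    ∃ C : ℝ, 0 < C ∧ ∀ (ι κ : Type) [Fintype ι] [Fintype κ] (m : MeshData ℓ ι κ) (u : ι → ℝ),
      m.IsAdmissible Ω Γ ξ → ∑ K, m.vol K * u K ^ 2 ≤ C * m.energy u := by
  obtain ⟨C, hC, h⟩ := exists_poincare_l1 ξ hΩo hΩb hΩc hΓΩ hΓ hpos
  obtain ⟨R, hR⟩ := Metric.isBounded_iff.1 hΩb.closure
  have hR' : ∀ x ∈ closure Ω, ∀ y ∈ closure Ω, ‖x - y‖ ≤ max R 0 := fun x hx y hy => by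
    rw [← dist_eq_norm]; exact (hR hx hy).trans (le_max_left _ _)
  have hR0 : 0 ≤ max R 0 := le_max_right _ _
  -- The Young weight is chosen so that `C * (ξ / A) = 1 / 2`, which lets the `L²` norm be absorbed
  -- on the left.
  set A := 2 * C * ξ with hA
  have hA0 : 0 < A := by positivity
  refine ⟨2 * C * (A + max R 0), by positivity, fun ι κ _ _ m u hm => ?_⟩
  -- The `L¹` inequality is applied to `u²`, whose jumps factor as `(u K - u L) * (u K + u L)`.
  have h1 := h ι κ m (fun K => u K ^ 2) hm
  set a := ∑ K, m.vol K * u K ^ 2 with ha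
  have e1 : ∑ K, |u K ^ 2| * m.vol K = a :=
    Finset.sum_congr rfl fun K _ => by rw [abs_of_nonneg (sq_nonneg _), mul_comm]
  rw [e1] at h1
  set E₁ := ∑ K, ∑ L ∈ m.nbrs K, m.trans K L * (u L - u K) ^ 2 with hE₁
  set E₂ := ∑ K, ∑ k ∈ m.extFaces K, m.extTrans k * u K ^ 2 with hE₂
  have hE : m.energy u = E₁ + E₂ := Finset.sum_add_distrib
  have hE₁0 : 0 ≤ E₁ := Finset.sum_nonneg fun K _ => Finset.sum_nonneg fun L hL =>
    mul_nonneg (hm.trans_nonneg hL) (sq_nonneg _)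
  have hE₂0 : 0 ≤ E₂ := Finset.sum_nonneg fun K _ => Finset.sum_nonneg fun k _ =>
    mul_nonneg (hm.extTrans_nonneg k) (sq_nonneg _)
  have hBV : m.bdryVar (fun K => u K ^ 2) ≤ max R 0 * E₂ := by
    rw [hE₂, m.sum_extFaces fun K k => m.extTrans k * u K ^ 2, bdryVar, Finset.mul_sum]
    refine Finset.sum_le_sum fun k _ => ?_
    rw [abs_of_nonneg (sq_nonneg _), ← mul_assoc]
    refine mul_le_mul_of_nonneg_right ?_ (sq_nonneg _)
    have hd := hm.extDist_pos k
    rw [extTrans, mul_div_assoc', le_div_iff₀ hd, mul_comm]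
    exact mul_le_mul_of_nonneg_right (hm.extDist_le hR' k) (m.extArea_nonneg k)
  have hTV : m.totalVar (fun K => u K ^ 2) ≤ A * E₁ + ξ / A * a := by
    have s1 : m.totalVar (fun K => u K ^ 2) ≤
        ∑ K, ∑ L ∈ m.nbrs K, (m.area K L * |u K - u L| * |u K| + m.area K L * |u K - u L| * |u L|) := by
      refine Finset.sum_le_sum fun K _ => Finset.sum_le_sum fun L _ => ?_
      rw [← mul_add, mul_assoc]
      refine mul_le_mul_of_nonneg_left ?_ (m.area_nonneg _ _)
      rw [sq_sub_sq, abs_mul, mul_comm]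
      exact mul_le_mul_of_nonneg_left (abs_add_le _ _) (abs_nonneg _)
    have s2 : ∑ K, ∑ L ∈ m.nbrs K, m.area K L * |u K - u L| * |u L| =
        ∑ K, ∑ L ∈ m.nbrs K, m.area K L * |u K - u L| * |u K| := by
      rw [m.sum_nbrs_comm]
      refine Finset.sum_congr rfl fun K _ => Finset.sum_congr rfl fun L _ => ?_
      rw [m.area_comm, abs_sub_comm]
    simp_rw [Finset.sum_add_distrib] at s1
    rw [s2, ← two_mul] at s1
    -- Young's inequality splits the area into `τ` and `|σ| d`. The latter sums over each cell to at
    -- most `ξ |K|`, by mesh regularity.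
    have s3 : 2 * ∑ K, ∑ L ∈ m.nbrs K, m.area K L * |u K - u L| * |u K| ≤
        ∑ K, ∑ L ∈ m.nbrs K, (A * (m.trans K L * (u L - u K) ^ 2) +
          A⁻¹ * (u K ^ 2 * (m.area K L * m.cdist K L))) := by
      rw [Finset.mul_sum]
      refine Finset.sum_le_sum fun K _ => ?_
      rw [Finset.mul_sum]
      refine Finset.sum_le_sum fun L hL => ?_
      have hd := hm.cdist_pos hL
      have har := m.area_nonneg K L
      have key : 0 ≤ m.area K L * ((A * |u K - u L| - m.cdist K L * |u K|) ^ 2 / (A * m.cdist K L)) := by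
        positivity
      have e : m.area K L * ((A * |u K - u L| - m.cdist K L * |u K|) ^ 2 / (A * m.cdist K L)) =
          A * (m.trans K L * |u K - u L| ^ 2) + A⁻¹ * (|u K| ^ 2 * (m.area K L * m.cdist K L)) -
            2 * (m.area K L * |u K - u L| * |u K|) := by
        rw [MeshData.trans]; field_simp; ring
      rw [e, sq_abs, sq_abs] at key
      rw [show (u L - u K) ^ 2 = (u K - u L) ^ 2 by ring]
      linarith
    refine s1.trans (s3.trans ?_)
    simp_rw [Finset.sum_add_distrib, ← Finset.mul_sum]
    rw [div_eq_inv_mul, mul_assoc A⁻¹ ξ a]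
    refine add_le_add le_rfl (mul_le_mul_of_nonneg_left ?_ (inv_nonneg.2 hA0.le))
    rw [ha, Finset.mul_sum]
    refine Finset.sum_le_sum fun K _ => ?_
    have := mul_le_mul_of_nonneg_left (hm.regular K) (sq_nonneg (u K))
    linarith
  have hξA : C * (ξ / A) = 1 / 2 := by rw [hA]; field_simp
  rw [hE]
  have h2 : a ≤ C * (A * E₁ + ξ / A * a + max R 0 * E₂) :=
    h1.trans (mul_le_mul_of_nonneg_left (add_le_add hTV hBV) hC.le)
  have h3 : C * (A * E₁ + ξ / A * a + max R 0 * E₂) = C * A * E₁ + 1 / 2 * a + C * max R 0 * E₂ := by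
    rw [← hξA]; ring
  have h4 : 0 ≤ C * A * E₂ := by positivity
  have h5 : 0 ≤ C * max R 0 * E₁ := by positivity
  nlinarith

end TwoPhase

end

/-! ### Increments of the saturation functions and dissipation on a face. -/

open scoped MeasureTheory RealInnerProductSpace ENNReal

noncomputable section

namespace TwoPhase

open MeasureTheory Set

namespace FlowData

variable {ℓ : ℕ} {D : FlowData ℓ}

namespace Assumptions

theorem one_sub_mem {z : ℝ} (hz : z ∈ Icc (0 : ℝ) 1) : 1 - z ∈ Icc (0 : ℝ) 1 :=
  ⟨by linarith [hz.2], by linarith [hz.1]⟩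

theorem M_le (hD : D.Assumptions) (α : Phase) {z : ℝ} (hz : z ∈ Icc (0 : ℝ) 1) :
    D.M α z ≤ D.M .l 1 + D.M .g 1 := by
  have h1 : ∀ α, 0 ≤ D.M α 1 := fun α => hD.M_nonneg α 1 ⟨zero_le_one, le_rfl⟩
  have h2 := hD.M_mono α hz ⟨zero_le_one, le_rfl⟩ hz.2
  have := h1 .l
  have := h1 .g
  cases α <;> linarith

theorem Mext_eq {α : Phase} {z : ℝ} (hz : z ∈ Icc (0 : ℝ) 1) : D.Mext α z = D.M α z := by
  rw [Mext, min_eq_right hz.2, max_eq_right hz.1]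

theorem clamp_mem (z : ℝ) : max 0 (min 1 z) ∈ Icc (0 : ℝ) 1 :=
  ⟨le_max_left _ _, max_le zero_le_one (min_le_left _ _)⟩

theorem Mext_nonneg (hD : D.Assumptions) (α : Phase) (z : ℝ) : 0 ≤ D.Mext α z :=
  hD.M_nonneg α _ (clamp_mem z)

theorem continuousOn_Mg (hD : D.Assumptions) :
    ContinuousOn (fun z => D.M .g (1 - z)) (Icc 0 1) :=
  (hD.M_cont .g).comp (by fun_prop) fun _ hz => one_sub_mem hz

theorem continuousOn_dpc (hD : D.Assumptions) : ContinuousOn D.dpc (Icc 0 1) :=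
  hD.pc_contDiff.continuousOn_derivWithin (uniqueDiffOn_Icc zero_lt_one) le_rfl

theorem dpc_nonpos (hD : D.Assumptions) (z : ℝ) : D.dpc z ≤ 0 :=
  hD.pc_anti.antitoneOn.derivWithin_nonpos

theorem totalMobility_pos (hD : D.Assumptions) {z : ℝ} (hz : z ∈ Icc (0 : ℝ) 1) :
    0 < D.totalMobility z := by
  obtain ⟨m₀, hm₀, h⟩ := hD.M_lower
  exact hm₀.trans_le (h z hz)

theorem continuousOn_totalMobility (hD : D.Assumptions) : ContinuousOn D.totalMobility (Icc 0 1) :=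
  (hD.M_cont .l).add hD.continuousOn_Mg

theorem intervalIntegrable {f : ℝ → ℝ} (hf : ContinuousOn f (Icc 0 1)) {a b : ℝ}
    (ha : a ∈ Icc (0 : ℝ) 1) (hb : b ∈ Icc (0 : ℝ) 1) : IntervalIntegrable f volume a b :=
  (hf.mono (ordConnected_Icc.uIcc_subset ha hb)).intervalIntegrable

theorem integral_dpc (hD : D.Assumptions) {a b : ℝ} (ha : a ∈ Icc (0 : ℝ) 1)
    (hb : b ∈ Icc (0 : ℝ) 1) (hab : a ≤ b) : ∫ z in a..b, D.dpc z = D.pc b - D.pc a := by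
  refine intervalIntegral.integral_eq_sub_of_hasDerivAt_of_le hab
    (hD.pc_contDiff.continuousOn.mono (Icc_subset_Icc ha.1 hb.2)) (fun z hz => ?_)
    (intervalIntegrable hD.continuousOn_dpc ha hb)
  have hz' : z ∈ Ioo (0 : ℝ) 1 := ⟨ha.1.trans_lt hz.1, hz.2.trans_le hb.2⟩
  exact ((hD.pc_contDiff.differentiableOn one_ne_zero z
    (Ioo_subset_Icc_self hz')).hasDerivWithinAt).hasDerivAt (Icc_mem_nhds hz'.1 hz'.2)

theorem continuousOn_pBar' (hD : D.Assumptions) :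
    ContinuousOn (fun z => D.M .g (1 - z) / D.totalMobility z * D.dpc z) (Icc 0 1) :=
  (hD.continuousOn_Mg.div hD.continuousOn_totalMobility
    fun _ hz => (hD.totalMobility_pos hz).ne').mul hD.continuousOn_dpc

theorem continuousOn_pTilde' (hD : D.Assumptions) :
    ContinuousOn (fun z => D.M .l z / D.totalMobility z * D.dpc z) (Icc 0 1) :=
  ((hD.M_cont .l).div hD.continuousOn_totalMobility
    fun _ hz => (hD.totalMobility_pos hz).ne').mul hD.continuousOn_dpc

theorem zero_mem : (0 : ℝ) ∈ Icc (0 : ℝ) 1 := ⟨le_rfl, zero_le_one⟩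

theorem one_mem : (1 : ℝ) ∈ Icc (0 : ℝ) 1 := ⟨zero_le_one, le_rfl⟩

theorem pBar_sub (hD : D.Assumptions) {a b : ℝ} (ha : a ∈ Icc (0 : ℝ) 1) (hb : b ∈ Icc (0 : ℝ) 1) :
    D.pBar b - D.pBar a = ∫ z in a..b, D.M .g (1 - z) / D.totalMobility z * D.dpc z :=
  intervalIntegral.integral_interval_sub_left (intervalIntegrable hD.continuousOn_pBar' zero_mem hb)
    (intervalIntegrable hD.continuousOn_pBar' zero_mem ha)

theorem pTilde_sub (hD : D.Assumptions) {a b : ℝ} (ha : a ∈ Icc (0 : ℝ) 1)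
    (hb : b ∈ Icc (0 : ℝ) 1) :
    D.pTilde b - D.pTilde a = -∫ z in a..b, D.M .l z / D.totalMobility z * D.dpc z := by
  rw [← intervalIntegral.integral_interval_sub_left
    (intervalIntegrable hD.continuousOn_pTilde' zero_mem hb)
    (intervalIntegrable hD.continuousOn_pTilde' zero_mem ha), pTilde, pTilde]
  ring

theorem calB_sub (hD : D.Assumptions) {a b : ℝ} (ha : a ∈ Icc (0 : ℝ) 1) (hb : b ∈ Icc (0 : ℝ) 1) :
    D.calB b - D.calB a = ∫ z in a..b, D.gam z :=
  intervalIntegral.integral_interval_sub_left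
    (intervalIntegrable hD.gam_contDiff.continuousOn zero_mem hb)
    (intervalIntegrable hD.gam_contDiff.continuousOn zero_mem ha)

/-- The increments of `p̄`, `p̃` and `𝓑` in terms of the increment of the capillary pressure and of a
mean value `θ` of the fractional flow of the gas phase. -/
theorem exists_fraction (hD : D.Assumptions) {m₀ : ℝ}
    (hm₀ : ∀ s ∈ Icc (0 : ℝ) 1, m₀ ≤ D.totalMobility s) {a b : ℝ}
    (ha : a ∈ Icc (0 : ℝ) 1) (hb : b ∈ Icc (0 : ℝ) 1) :
    ∃ θ : ℝ, 0 ≤ θ ∧ θ ≤ 1 ∧ D.pBar b - D.pBar a = θ * (D.pc b - D.pc a) ∧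
      D.pTilde b - D.pTilde a = -((1 - θ) * (D.pc b - D.pc a)) ∧
      |D.calB b - D.calB a| ≤ (D.M .l 1 + D.M .g 1) * θ * |D.pc b - D.pc a| ∧
      |D.calB b - D.calB a| ≤ (D.M .l 1 + D.M .g 1) * (1 - θ) * |D.pc b - D.pc a| ∧
      (∀ c, (∀ z ∈ uIcc a b, D.M .g (1 - z) ≤ c) → m₀ * θ ≤ c) ∧
      (∀ c, (∀ z ∈ uIcc a b, D.M .l z ≤ c) → m₀ * (1 - θ) ≤ c) := by
  wlog hab : a ≤ b generalizing a b
  · obtain ⟨θ, h0, h1, h2, h3, h4, h5, h6, h7⟩ := this hb ha (le_of_not_ge hab)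
    refine ⟨θ, h0, h1, by linarith, by linarith, ?_, ?_, ?_, ?_⟩
    · rwa [abs_sub_comm, abs_sub_comm (D.pc b)]
    · rwa [abs_sub_comm, abs_sub_comm (D.pc b)]
    · rwa [uIcc_comm]
    · rwa [uIcc_comm]
  have hfrac : ∀ z ∈ Icc (0 : ℝ) 1,
      D.M .l z / D.totalMobility z = 1 - D.M .g (1 - z) / D.totalMobility z := by
    intro z hz
    have := (hD.totalMobility_pos hz).ne'
    field_simp
    simp [totalMobility]
  have hq0 : ∀ z ∈ Icc (0 : ℝ) 1, 0 ≤ D.M .g (1 - z) / D.totalMobility z := fun z hz =>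
    div_nonneg (hD.M_nonneg _ _ (one_sub_mem hz)) (hD.totalMobility_pos hz).le
  have hq1 : ∀ z ∈ Icc (0 : ℝ) 1, D.M .g (1 - z) / D.totalMobility z ≤ 1 := fun z hz => by
    rw [div_le_one (hD.totalMobility_pos hz), totalMobility]
    linarith [hD.M_nonneg .l z hz]
  have hqm : ∀ z ∈ Icc (0 : ℝ) 1, m₀ * (D.M .g (1 - z) / D.totalMobility z) ≤ D.M .g (1 - z) := by
    intro z hz
    have hp := hD.totalMobility_pos hz
    rw [mul_div_assoc', div_le_iff₀ hp, mul_comm]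
    exact mul_le_mul_of_nonneg_left (hm₀ z hz) (hD.M_nonneg _ _ (one_sub_mem hz))
  have hqm' : ∀ z ∈ Icc (0 : ℝ) 1, m₀ * (1 - D.M .g (1 - z) / D.totalMobility z) ≤ D.M .l z := by
    intro z hz
    have hp := hD.totalMobility_pos hz
    rw [← hfrac z hz, mul_div_assoc', div_le_iff₀ hp, mul_comm]
    exact mul_le_mul_of_nonneg_left (hm₀ z hz) (hD.M_nonneg _ _ hz)
  -- For equal saturations the averaging weight vanishes, so the pointwise fractional flow serves as
  -- `θ`.
  rcases hab.eq_or_lt with rfl | hlt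
  · refine ⟨D.M .g (1 - a) / D.totalMobility a, hq0 a ha, hq1 a ha, by simp, by simp, by simp,
      by simp, fun c hc => (hqm a ha).trans (hc a left_mem_uIcc),
      fun c hc => (hqm' a ha).trans (hc a left_mem_uIcc)⟩
  have hsub : ∀ z ∈ Icc a b, z ∈ Icc (0 : ℝ) 1 := fun z hz => ⟨ha.1.trans hz.1, hz.2.trans hb.2⟩
  set q : ℝ → ℝ := fun z => D.M .g (1 - z) / D.totalMobility z with hq
  have hqc : ContinuousOn q (Icc 0 1) := hD.continuousOn_Mg.div hD.continuousOn_totalMobility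
    fun _ hz => (hD.totalMobility_pos hz).ne'
  have hdc := hD.continuousOn_dpc
  set T := D.pc a - D.pc b with hT
  have hTpos : 0 < T := sub_pos.2 (hD.pc_anti ha hb hlt)
  have hTint : ∫ z in a..b, -D.dpc z = T := by
    rw [intervalIntegral.integral_neg, hD.integral_dpc ha hb hab]; ring
  set J := ∫ z in a..b, q z * (-D.dpc z) with hJ
  have hJi : IntervalIntegrable (fun z => q z * (-D.dpc z)) volume a b :=
    intervalIntegrable (hqc.mul hdc.neg) ha hb
  have hci : ∀ c : ℝ, IntervalIntegrable (fun z => c * (-D.dpc z)) volume a b := fun c =>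
    intervalIntegrable (continuousOn_const.mul hdc.neg) ha hb
  have hcint : ∀ c : ℝ, ∫ z in a..b, c * (-D.dpc z) = c * T := fun c => by
    rw [intervalIntegral.integral_const_mul, hTint]
  have hJ' : ∫ z in a..b, (1 - q z) * (-D.dpc z) = T - J := by
    rw [← hTint, hJ, ← intervalIntegral.integral_sub (by simpa using hci 1) hJi]
    congr 1; ext z; ring
  have hJ'i : IntervalIntegrable (fun z => (1 - q z) * (-D.dpc z)) volume a b :=
    intervalIntegrable ((continuousOn_const.sub hqc).mul hdc.neg) ha hb
  have hd0 : ∀ z, 0 ≤ -D.dpc z := fun z => neg_nonneg.2 (hD.dpc_nonpos z)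
  have hθT : J / T * T = J := div_mul_cancel₀ _ hTpos.ne'
  have hgi : IntervalIntegrable D.gam volume a b :=
    intervalIntegrable hD.gam_contDiff.continuousOn ha hb
  have hgam0 : ∀ z ∈ Icc (0 : ℝ) 1, 0 ≤ D.gam z := by
    intro z hz
    rw [gam, neg_nonneg]
    exact mul_nonpos_of_nonneg_of_nonpos (div_nonneg (mul_nonneg (hD.M_nonneg _ _ hz)
      (hD.M_nonneg _ _ (one_sub_mem hz))) (hD.totalMobility_pos hz).le) (hD.dpc_nonpos z)
  have habs : |D.pc b - D.pc a| = T := by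
    rw [abs_sub_comm, abs_of_pos hTpos]
  have hB : |D.calB b - D.calB a| = ∫ z in a..b, D.gam z := by
    rw [hD.calB_sub ha hb, abs_of_nonneg]
    exact intervalIntegral.integral_nonneg hab fun z hz => hgam0 z (hsub z hz)
  set X := D.M .l 1 + D.M .g 1 with hX
  -- The witness is the mean of the fractional flow `q` between the saturations, with the positive
  -- weight `-p_c'` of total mass `T`.
  refine ⟨J / T, ?_, ?_, ?_, ?_, ?_, ?_, ?_, ?_⟩
  · exact div_nonneg (intervalIntegral.integral_nonneg hab fun z hz =>
      mul_nonneg (hq0 z (hsub z hz)) (hd0 z)) hTpos.le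
  · rw [div_le_one hTpos]
    have h := intervalIntegral.integral_mono_on hab hJi (hci 1) fun z hz =>
      mul_le_mul_of_nonneg_right (hq1 z (hsub z hz)) (hd0 z)
    rwa [hcint, one_mul] at h
  · rw [hD.pBar_sub ha hb, show D.pc b - D.pc a = -T by rw [hT]; ring, mul_neg, hθT, hJ,
      ← intervalIntegral.integral_neg]
    congr 1; ext z; ring
  · rw [hD.pTilde_sub ha hb, show D.pc b - D.pc a = -T by rw [hT]; ring, mul_neg, neg_neg, sub_mul,
      hθT, one_mul, ← hJ', ← intervalIntegral.integral_neg]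
    refine intervalIntegral.integral_congr fun z hz => ?_
    rw [uIcc_of_le hab] at hz
    simp only [hfrac z (hsub z hz), hq]
    ring
  -- The capillary term factors both as `M_l * q * (-p_c')` and as `M_g * (1 - q) * (-p_c')`.
  -- Bounding the mobility by `X` gives the factor `θ` in one case and `1 - θ` in the other.
  · rw [hB, habs, mul_assoc, hθT, hJ, ← intervalIntegral.integral_const_mul]
    refine intervalIntegral.integral_mono_on hab hgi (hJi.const_mul X) fun z hz => ?_
    have hz' := hsub z hz
    have e : D.gam z = D.M .l z * (q z * -D.dpc z) := by rw [gam, hq]; ring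
    rw [e]
    exact mul_le_mul_of_nonneg_right (hD.M_le .l hz') (mul_nonneg (hq0 z hz') (hd0 z))
  · rw [hB, habs, mul_assoc, sub_mul, hθT, one_mul, ← hJ', ← intervalIntegral.integral_const_mul]
    refine intervalIntegral.integral_mono_on hab hgi (hJ'i.const_mul X) fun z hz => ?_
    have hz' := hsub z hz
    have e : D.gam z = D.M .g (1 - z) * ((1 - q z) * -D.dpc z) := by
      rw [gam, hq]; simp only; rw [← hfrac z hz']; ring
    rw [e]
    exact mul_le_mul_of_nonneg_right (hD.M_le .g (one_sub_mem hz'))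
      (mul_nonneg (sub_nonneg.2 (hq1 z hz')) (hd0 z))
  · intro c hc
    rw [mul_div_assoc', div_le_iff₀ hTpos, hJ, ← intervalIntegral.integral_const_mul, ← hcint]
    refine intervalIntegral.integral_mono_on hab (hJi.const_mul m₀) (hci c) fun z hz => ?_
    rw [← mul_assoc]
    refine mul_le_mul_of_nonneg_right ((hqm z (hsub z hz)).trans (hc z ?_)) (hd0 z)
    rwa [uIcc_of_le hab]
  · intro c hc
    have : m₀ * (1 - J / T) = m₀ * (T - J) / T := by field_simp
    rw [this, div_le_iff₀ hTpos, ← hJ', ← intervalIntegral.integral_const_mul, ← hcint]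
    refine intervalIntegral.integral_mono_on hab (hJ'i.const_mul m₀) (hci c) fun z hz => ?_
    rw [← mul_assoc]
    refine mul_le_mul_of_nonneg_right ((hqm' z (hsub z hz)).trans (hc z ?_)) (hd0 z)
    rwa [uIcc_of_le hab]

end Assumptions

/-- The dissipation on a face. -/
def diss (D : FlowData ℓ) (sK sL lK lL gK gL : ℝ) : ℝ :=
  D.upwindM .l sK sL lK lL * (lL - lK) ^ 2 +
    D.upwindM .g (1 - sK) (1 - sL) gK gL * (gL - gK) ^ 2

namespace Assumptions

theorem upwindM_nonneg (hD : D.Assumptions) (α : Phase) (sK sL pK pL : ℝ) :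
    0 ≤ D.upwindM α sK sL pK pL := by
  unfold upwindM
  split_ifs <;> exact hD.Mext_nonneg _ _

theorem upwindM_le (hD : D.Assumptions) (α : Phase) {sK sL : ℝ} (pK pL : ℝ)
    (hK : sK ∈ Icc (0 : ℝ) 1) (hL : sL ∈ Icc (0 : ℝ) 1) :
    D.upwindM α sK sL pK pL ≤ D.M .l 1 + D.M .g 1 := by
  unfold upwindM
  split_ifs
  · rw [Mext_eq hK]; exact hD.M_le _ hK
  · rw [Mext_eq hL]; exact hD.M_le _ hL

theorem diss_nonneg (hD : D.Assumptions) (sK sL lK lL gK gL : ℝ) :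
    0 ≤ D.diss sK sL lK lL gK gL :=
  add_nonneg (mul_nonneg (hD.upwindM_nonneg _ _ _ _ _) (sq_nonneg _))
    (mul_nonneg (hD.upwindM_nonneg _ _ _ _ _) (sq_nonneg _))

section Face

variable {sK sL lK lL gK gL m₀ : ℝ}

/-- If the upwind side has the larger liquid saturation, monotonicity of `M_l` gives the first
alternative. Otherwise, since `p_c` decreases, the gas increment has the same sign and is at least
as large in modulus. Both phases are then upwinded from the same side, where their mobilities add up
to at least `m₀`. -/
theorem upwind_l_or (hD : D.Assumptions) (hm₀ : ∀ s ∈ Icc (0 : ℝ) 1, m₀ ≤ D.totalMobility s)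
    (hK : sK ∈ Icc (0 : ℝ) 1) (hL : sL ∈ Icc (0 : ℝ) 1) (hcK : D.pc sK = gK - lK)
    (hcL : D.pc sL = gL - lL) :
    (∀ z ∈ uIcc sK sL, D.M .l z ≤ D.upwindM .l sK sL lK lL) ∨
      m₀ * (lL - lK) ^ 2 ≤ D.diss sK sL lK lL gK gL := by
  rcases le_or_gt (lL - lK) 0 with hx | hx
  · have hup : D.upwindM .l sK sL lK lL = D.M .l sK := by rw [upwindM, if_pos hx, Mext_eq hK]
    rcases le_or_gt sL sK with h | h
    · refine Or.inl fun z hz => ?_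
      rw [uIcc_of_ge h] at hz
      rw [hup]
      exact hD.M_mono .l ⟨hL.1.trans hz.1, hz.2.trans hK.2⟩ hK hz.2
    · refine Or.inr ?_
      have hpc := hD.pc_anti hK hL h
      have hy : gL - gK ≤ lL - lK := by linarith
      have hupg : D.upwindM .g (1 - sK) (1 - sL) gK gL = D.M .g (1 - sK) := by
        rw [upwindM, if_pos (hy.trans hx), Mext_eq (one_sub_mem hK)]
      rw [diss, hup, hupg]
      have h1 : (lL - lK) ^ 2 ≤ (gL - gK) ^ 2 := by nlinarith
      have h2 := mul_le_mul_of_nonneg_left h1 (hD.M_nonneg .g _ (one_sub_mem hK))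
      have h3 := mul_le_mul_of_nonneg_right (hm₀ sK hK) (sq_nonneg (lL - lK))
      rw [totalMobility] at h3
      linarith
  · have hup : D.upwindM .l sK sL lK lL = D.M .l sL := by
      rw [upwindM, if_neg (not_le.2 hx), Mext_eq hL]
    rcases le_or_gt sK sL with h | h
    · refine Or.inl fun z hz => ?_
      rw [uIcc_of_le h] at hz
      rw [hup]
      exact hD.M_mono .l ⟨hK.1.trans hz.1, hz.2.trans hL.2⟩ hL hz.2
    · refine Or.inr ?_
      have hpc := hD.pc_anti hL hK h
      have hy : lL - lK ≤ gL - gK := by linarith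
      have hupg : D.upwindM .g (1 - sK) (1 - sL) gK gL = D.M .g (1 - sL) := by
        rw [upwindM, if_neg (not_le.2 (hx.trans_le hy)), Mext_eq (one_sub_mem hL)]
      rw [diss, hup, hupg]
      have h1 : (lL - lK) ^ 2 ≤ (gL - gK) ^ 2 := by nlinarith
      have h2 := mul_le_mul_of_nonneg_left h1 (hD.M_nonneg .g _ (one_sub_mem hL))
      have h3 := mul_le_mul_of_nonneg_right (hm₀ sL hL) (sq_nonneg (lL - lK))
      rw [totalMobility] at h3
      linarith

theorem upwind_g_or (hD : D.Assumptions) (hm₀ : ∀ s ∈ Icc (0 : ℝ) 1, m₀ ≤ D.totalMobility s)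
    (hK : sK ∈ Icc (0 : ℝ) 1) (hL : sL ∈ Icc (0 : ℝ) 1) (hcK : D.pc sK = gK - lK)
    (hcL : D.pc sL = gL - lL) :
    (∀ z ∈ uIcc sK sL, D.M .g (1 - z) ≤ D.upwindM .g (1 - sK) (1 - sL) gK gL) ∨
      m₀ * (gL - gK) ^ 2 ≤ D.diss sK sL lK lL gK gL := by
  rcases le_or_gt (gL - gK) 0 with hx | hx
  · have hup : D.upwindM .g (1 - sK) (1 - sL) gK gL = D.M .g (1 - sK) := by
      rw [upwindM, if_pos hx, Mext_eq (one_sub_mem hK)]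
    rcases le_or_gt sK sL with h | h
    · refine Or.inl fun z hz => ?_
      rw [uIcc_of_le h] at hz
      rw [hup]
      exact hD.M_mono .g (one_sub_mem ⟨hK.1.trans hz.1, hz.2.trans hL.2⟩) (one_sub_mem hK)
        (by linarith [hz.1])
    · refine Or.inr ?_
      have hpc := hD.pc_anti hL hK h
      have hy : lL - lK ≤ gL - gK := by linarith
      have hupl : D.upwindM .l sK sL lK lL = D.M .l sK := by
        rw [upwindM, if_pos (hy.trans hx), Mext_eq hK]
      rw [diss, hup, hupl]
      have h1 : (gL - gK) ^ 2 ≤ (lL - lK) ^ 2 := by nlinarith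
      have h2 := mul_le_mul_of_nonneg_left h1 (hD.M_nonneg .l _ hK)
      have h3 := mul_le_mul_of_nonneg_right (hm₀ sK hK) (sq_nonneg (gL - gK))
      rw [totalMobility] at h3
      linarith
  · have hup : D.upwindM .g (1 - sK) (1 - sL) gK gL = D.M .g (1 - sL) := by
      rw [upwindM, if_neg (not_le.2 hx), Mext_eq (one_sub_mem hL)]
    rcases le_or_gt sL sK with h | h
    · refine Or.inl fun z hz => ?_
      rw [uIcc_of_ge h] at hz
      rw [hup]
      exact hD.M_mono .g (one_sub_mem ⟨hL.1.trans hz.1, hz.2.trans hK.2⟩) (one_sub_mem hL)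
        (by linarith [hz.1])
    · refine Or.inr ?_
      have hpc := hD.pc_anti hK hL h
      have hy : gL - gK ≤ lL - lK := by linarith
      have hupl : D.upwindM .l sK sL lK lL = D.M .l sL := by
        rw [upwindM, if_neg (not_le.2 (hx.trans_le hy)), Mext_eq hL]
      rw [diss, hup, hupl]
      have h1 : (gL - gK) ^ 2 ≤ (lL - lK) ^ 2 := by nlinarith
      have h2 := mul_le_mul_of_nonneg_left h1 (hD.M_nonneg .l _ hL)
      have h3 := mul_le_mul_of_nonneg_right (hm₀ sL hL) (sq_nonneg (gL - gK))
      rw [totalMobility] at h3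
      linarith

/-- Serves the gravity fluxes, whose mobilities are upwinded with respect to gravity and not to the
pressure. -/
theorem sq_mul_le_of_or {X M U x d : ℝ} (hm₀ : 0 < m₀) (hM0 : 0 ≤ M) (hMX : M ≤ X)
    (hUd : U * x ^ 2 ≤ d) (h : M ≤ U ∨ m₀ * x ^ 2 ≤ d) :
    (M * x) ^ 2 ≤ (X + X ^ 2 / m₀) * d := by
  have hX : 0 ≤ X := hM0.trans hMX
  have hx := sq_nonneg x
  rcases h with h | h
  · have h1 : M * x ^ 2 ≤ d := (mul_le_mul_of_nonneg_right h hx).trans hUd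
    have hd : 0 ≤ d := (mul_nonneg hM0 hx).trans h1
    calc (M * x) ^ 2 = M * (M * x ^ 2) := by ring
      _ ≤ X * d := mul_le_mul hMX h1 (mul_nonneg hM0 hx) hX
      _ ≤ _ := mul_le_mul_of_nonneg_right (le_add_of_nonneg_right (by positivity)) hd
  · have hd : 0 ≤ d := (mul_nonneg hm₀.le hx).trans h
    calc (M * x) ^ 2 = M ^ 2 / m₀ * (m₀ * x ^ 2) := by field_simp
      _ ≤ X ^ 2 / m₀ * d := by gcongr
      _ ≤ _ := mul_le_mul_of_nonneg_right (le_add_of_nonneg_left hX) hd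

theorem sq_mul_sub_le {θ : ℝ} (h0 : 0 ≤ θ) (h1 : θ ≤ 1) (x y : ℝ) :
    (θ * (y - x)) ^ 2 ≤ 2 * x ^ 2 + 2 * (θ * y ^ 2) := by
  have h2 : 0 ≤ 1 - θ := sub_nonneg.2 h1
  have e : 2 * x ^ 2 + 2 * (θ * y ^ 2) - (θ * (y - x)) ^ 2 = (θ * (y + x)) ^ 2 +
      2 * (θ * (1 - θ)) * y ^ 2 + 2 * ((1 - θ) * (1 + θ)) * x ^ 2 := by ring
  rw [← sub_nonneg, e]
  positivity

set_option maxHeartbeats 800000 in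
/-- All the increments across a face that matter are controlled by the dissipation. -/
theorem exists_face_estimate (hD : D.Assumptions) : ∃ C : ℝ, 0 < C ∧
    ∀ sK ∈ Icc (0 : ℝ) 1, ∀ sL ∈ Icc (0 : ℝ) 1, ∀ lK lL gK gL : ℝ, D.pc sK = gK - lK →
      D.pc sL = gL - lL →
      (D.calB sL - D.calB sK) ^ 2 ≤ C * D.diss sK sL lK lL gK gL ∧
      D.upwindM .l sK sL lK lL * (D.pBar sL - D.pBar sK) ^ 2 ≤ C * D.diss sK sL lK lL gK gL ∧
      D.upwindM .g (1 - sK) (1 - sL) gK gL * (D.pTilde sL - D.pTilde sK) ^ 2 ≤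
        C * D.diss sK sL lK lL gK gL ∧
      ((lL + D.pBar sL) - (lK + D.pBar sK)) ^ 2 ≤ C * D.diss sK sL lK lL gK gL ∧
      (D.M .l sK * (lL - lK)) ^ 2 ≤ C * D.diss sK sL lK lL gK gL ∧
      (D.M .l sL * (lL - lK)) ^ 2 ≤ C * D.diss sK sL lK lL gK gL ∧
      (D.M .g (1 - sK) * (gL - gK)) ^ 2 ≤ C * D.diss sK sL lK lL gK gL ∧
      (D.M .g (1 - sL) * (gL - gK)) ^ 2 ≤ C * D.diss sK sL lK lL gK gL := by
  obtain ⟨m₀, hm₀, hM⟩ := hD.M_lower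
  set X := D.M .l 1 + D.M .g 1 with hX
  have hX0 : 0 ≤ X := add_nonneg (hD.M_nonneg _ _ one_mem) (hD.M_nonneg _ _ one_mem)
  refine ⟨4 * X ^ 2 / m₀ + (2 + 2 * X / m₀) + 2 / m₀ + (X + X ^ 2 / m₀), by positivity, ?_⟩
  intro sK hK sL hL lK lL gK gL hcK hcL
  have hd := hD.diss_nonneg sK sL lK lL gK gL
  set d := D.diss sK sL lK lL gK gL with hdd
  obtain ⟨θ, h0, h1, hb, ht, hB1, hB2, hc1, hc2⟩ := hD.exists_fraction hM hK hL
  have hl := hD.upwind_l_or hM hK hL hcK hcL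
  have hg := hD.upwind_g_or hM hK hL hcK hcL
  set U := D.upwindM .l sK sL lK lL with hU
  set V := D.upwindM .g (1 - sK) (1 - sL) gK gL with hV
  have hU0 : 0 ≤ U := hD.upwindM_nonneg _ _ _ _ _
  have hV0 : 0 ≤ V := hD.upwindM_nonneg _ _ _ _ _
  have hUX : U ≤ X := hD.upwindM_le _ _ _ hK hL
  have hVX : V ≤ X := hD.upwindM_le _ _ _ (one_sub_mem hK) (one_sub_mem hL)
  set x := lL - lK with hx
  set y := gL - gK with hy
  have hpc : D.pc sL - D.pc sK = y - x := by rw [hcK, hcL]; ring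
  rw [hpc] at hb ht hB1 hB2
  have hdeq : d = U * x ^ 2 + V * y ^ 2 := rfl
  have hUx : 0 ≤ U * x ^ 2 := mul_nonneg hU0 (sq_nonneg _)
  have hVy : 0 ≤ V * y ^ 2 := mul_nonneg hV0 (sq_nonneg _)
  -- If the upwind gas mobility dominates, then `m₀ θ ≤ V`; otherwise `m₀ y² ≤ d` and `θ ≤ 1`.
  have k1 : θ * y ^ 2 ≤ d / m₀ := by
    rw [le_div_iff₀ hm₀]
    rcases hg with h | h
    · have := mul_le_mul_of_nonneg_right (hc1 _ h) (sq_nonneg y)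
      linarith
    · have := mul_le_mul_of_nonneg_right h1 (mul_nonneg hm₀.le (sq_nonneg y))
      linarith
  have k2 : (1 - θ) * x ^ 2 ≤ d / m₀ := by
    rw [le_div_iff₀ hm₀]
    rcases hl with h | h
    · have := mul_le_mul_of_nonneg_right (hc2 _ h) (sq_nonneg x)
      linarith
    · have := mul_nonneg h0 (mul_nonneg hm₀.le (sq_nonneg x))
      linarith
  have hθ' : 0 ≤ 1 - θ := sub_nonneg.2 h1
  have t1 : 0 ≤ 4 * X ^ 2 / m₀ * d := by positivity
  have t2 : 0 ≤ (2 + 2 * X / m₀) * d := by positivity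
  have t3 : 0 ≤ 2 / m₀ * d := by positivity
  have t4 : 0 ≤ (X + X ^ 2 / m₀) * d := by positivity
  have r1 : (D.calB sL - D.calB sK) ^ 2 ≤ 4 * X ^ 2 / m₀ * d := by
    -- One factor is estimated with `θ` and the other with `1 - θ`: the product `θ (1 - θ)`
    -- compensates the degeneracy of both phases.
    have e1 : (D.calB sL - D.calB sK) ^ 2 ≤ (X * θ * |y - x|) * (X * (1 - θ) * |y - x|) := by
      rw [← sq_abs, sq]
      exact mul_le_mul hB1 hB2 (abs_nonneg _) (by positivity)
    have e2 : (X * θ * |y - x|) * (X * (1 - θ) * |y - x|) =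
        X ^ 2 * (θ * (1 - θ) * (y - x) ^ 2) := by rw [← sq_abs (y - x)]; ring
    have e3 : θ * (1 - θ) * (y - x) ^ 2 ≤ 2 * (θ * y ^ 2 + (1 - θ) * x ^ 2) := by
      have e : 2 * (θ * y ^ 2 + (1 - θ) * x ^ 2) - θ * (1 - θ) * (y - x) ^ 2 =
          θ * (1 - θ) * (y + x) ^ 2 + 2 * (θ * y) ^ 2 + 2 * ((1 - θ) * x) ^ 2 := by ring
      rw [← sub_nonneg, e]
      positivity
    calc _ ≤ X ^ 2 * (θ * (1 - θ) * (y - x) ^ 2) := e1.trans_eq e2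
      _ ≤ X ^ 2 * (2 * (d / m₀ + d / m₀)) :=
        mul_le_mul_of_nonneg_left (e3.trans (by linarith)) (sq_nonneg X)
      _ = _ := by ring
  have r2 : U * (D.pBar sL - D.pBar sK) ^ 2 ≤ (2 + 2 * X / m₀) * d := by
    rw [hb]
    have e1 : (θ * (y - x)) ^ 2 ≤ 2 * x ^ 2 + 2 * (θ * y ^ 2) := by
      exact sq_mul_sub_le h0 h1 x y
    calc U * (θ * (y - x)) ^ 2 ≤ U * (2 * x ^ 2 + 2 * (θ * y ^ 2)) := by gcongr
      _ = 2 * (U * x ^ 2) + 2 * (U * (θ * y ^ 2)) := by ring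
      _ ≤ 2 * d + 2 * (X * (d / m₀)) := by
        have := mul_le_mul hUX k1 (mul_nonneg h0 (sq_nonneg y)) hX0
        linarith
      _ = _ := by ring
  have r3 : V * (D.pTilde sL - D.pTilde sK) ^ 2 ≤ (2 + 2 * X / m₀) * d := by
    rw [ht]
    have e1 : (-((1 - θ) * (y - x))) ^ 2 ≤ 2 * y ^ 2 + 2 * ((1 - θ) * x ^ 2) := by
      rw [← mul_neg, neg_sub]
      exact sq_mul_sub_le hθ' (by linarith) y x
    calc V * (-((1 - θ) * (y - x))) ^ 2 ≤ V * (2 * y ^ 2 + 2 * ((1 - θ) * x ^ 2)) := by gcongr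
      _ = 2 * (V * y ^ 2) + 2 * (V * ((1 - θ) * x ^ 2)) := by ring
      _ ≤ 2 * d + 2 * (X * (d / m₀)) := by
        have := mul_le_mul hVX k2 (mul_nonneg hθ' (sq_nonneg x)) hX0
        linarith
      _ = _ := by ring
  have r4 : ((lL + D.pBar sL) - (lK + D.pBar sK)) ^ 2 ≤ 2 / m₀ * d := by
    have e1 : (lL + D.pBar sL) - (lK + D.pBar sK) = (1 - θ) * x + θ * y := by
      rw [hx]; linear_combination hb
    -- The increment of the global pressure is a convex combination of the two pressure increments,
    -- so convexity of the square applies.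
    have e2 : ((1 - θ) * x + θ * y) ^ 2 ≤ (1 - θ) * x ^ 2 + θ * y ^ 2 := by
      have e : (1 - θ) * x ^ 2 + θ * y ^ 2 - ((1 - θ) * x + θ * y) ^ 2 =
          θ * (1 - θ) * (y - x) ^ 2 := by ring
      rw [← sub_nonneg, e]
      positivity
    rw [e1]
    calc _ ≤ _ := e2
      _ ≤ d / m₀ + d / m₀ := add_le_add k2 k1
      _ = _ := by ring
  have hUx' : U * x ^ 2 ≤ d := by linarith
  have hVy' : V * y ^ 2 ≤ d := by linarith
  have r5 := sq_mul_le_of_or hm₀ (hD.M_nonneg .l _ hK) (hD.M_le .l hK) hUx'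
    (hl.imp_left fun h => h _ left_mem_uIcc)
  have r6 := sq_mul_le_of_or hm₀ (hD.M_nonneg .l _ hL) (hD.M_le .l hL) hUx'
    (hl.imp_left fun h => h _ right_mem_uIcc)
  have r7 := sq_mul_le_of_or hm₀ (hD.M_nonneg .g _ (one_sub_mem hK))
    (hD.M_le .g (one_sub_mem hK)) hVy' (hg.imp_left fun h => h _ left_mem_uIcc)
  have r8 := sq_mul_le_of_or hm₀ (hD.M_nonneg .g _ (one_sub_mem hL))
    (hD.M_le .g (one_sub_mem hL)) hVy' (hg.imp_left fun h => h _ right_mem_uIcc)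
  rw [← hX] at r5 r6 r7 r8
  simp only [add_mul _ _ d] at t1 t2 t3 t4 r1 r2 r3 r4 r5 r6 r7 r8 ⊢
  refine ⟨?_, ?_, ?_, ?_, ?_, ?_, ?_, ?_⟩ <;> linarith

end Face

end Assumptions

end FlowData

end TwoPhase

end

/-! ### Entropies, capillary energy and tested fluxes. -/

open scoped MeasureTheory RealInnerProductSpace ENNReal

noncomputable section

namespace TwoPhase

open MeasureTheory Set

namespace FlowData

variable {ℓ : ℕ} {D : FlowData ℓ}

/-- The primitive of `1 / ρ_α`, which is used as a test function. -/
def kirchhoff (D : FlowData ℓ) (α : Phase) (p : ℝ) : ℝ := ∫ ζ in (0 : ℝ)..p, 1 / D.ρ α ζ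

/-- The entropy associated with the compressibility of the phase `α`. -/
def entropy (D : FlowData ℓ) (α : Phase) (p : ℝ) : ℝ := D.ρ α p * D.kirchhoff α p - p

/-- The primitive of the capillary pressure. -/
def capEnergy (D : FlowData ℓ) (s : ℝ) : ℝ := ∫ z in (0 : ℝ)..s, D.pc z

namespace Assumptions

theorem ρ_pos (hD : D.Assumptions) (α : Phase) (p : ℝ) : 0 < D.ρ α p := by
  obtain ⟨ρm, ρM, h, _, hb⟩ := hD.ρ_bounds
  exact h.trans_le (hb α p).1

theorem continuous_inv_ρ (hD : D.Assumptions) (α : Phase) : Continuous fun ζ => 1 / D.ρ α ζ :=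
  continuous_const.div (hD.ρ_contDiff α).continuous fun p => (hD.ρ_pos α p).ne'

theorem kirchhoff_zero (α : Phase) : D.kirchhoff α 0 = 0 := intervalIntegral.integral_same

theorem kirchhoff_sub (hD : D.Assumptions) (α : Phase) (a b : ℝ) :
    D.kirchhoff α b - D.kirchhoff α a = ∫ ζ in a..b, 1 / D.ρ α ζ :=
  intervalIntegral.integral_interval_sub_left ((hD.continuous_inv_ρ α).intervalIntegrable _ _)
    ((hD.continuous_inv_ρ α).intervalIntegrable _ _)

theorem kirchhoff_sub_le_of_le (hD : D.Assumptions) (α : Phase) {a b c : ℝ} (hab : a ≤ b)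
    (h : ∀ ζ ∈ Icc a b, 1 / D.ρ α ζ ≤ c) : D.kirchhoff α b - D.kirchhoff α a ≤ c * (b - a) := by
  rw [hD.kirchhoff_sub]
  have := intervalIntegral.integral_mono_on (g := fun _ => c) hab
    ((hD.continuous_inv_ρ α).intervalIntegrable (μ := volume) a b) (by simp) h
  rwa [intervalIntegral.integral_const, smul_eq_mul, mul_comm] at this

theorem le_kirchhoff_sub_of_le (hD : D.Assumptions) (α : Phase) {a b c : ℝ} (hab : a ≤ b)
    (h : ∀ ζ ∈ Icc a b, c ≤ 1 / D.ρ α ζ) : c * (b - a) ≤ D.kirchhoff α b - D.kirchhoff α a := by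
  rw [hD.kirchhoff_sub]
  have := intervalIntegral.integral_mono_on (f := fun _ => c) hab (by simp)
    ((hD.continuous_inv_ρ α).intervalIntegrable (μ := volume) a b) h
  rwa [intervalIntegral.integral_const, smul_eq_mul, mul_comm] at this

/-- The primitive of `1 / ρ_α` is concave, since `ρ_α` is non-decreasing. -/
theorem kirchhoff_le (hD : D.Assumptions) (α : Phase) (a b : ℝ) :
    D.kirchhoff α b - D.kirchhoff α a ≤ 1 / D.ρ α a * (b - a) := by
  rcases le_total a b with h | h
  · exact hD.kirchhoff_sub_le_of_le α h fun ζ hζ =>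
      one_div_le_one_div_of_le (hD.ρ_pos α a) (hD.ρ_mono α hζ.1)
  · have := hD.le_kirchhoff_sub_of_le α h (c := 1 / D.ρ α a) fun ζ hζ =>
      one_div_le_one_div_of_le (hD.ρ_pos α ζ) (hD.ρ_mono α hζ.2)
    linarith

theorem abs_kirchhoff_sub_le (hD : D.Assumptions) (α : Phase) {ρm : ℝ} (h0 : 0 < ρm)
    (h : ∀ p, ρm ≤ D.ρ α p) (a b : ℝ) :
    |D.kirchhoff α b - D.kirchhoff α a| ≤ 1 / ρm * |b - a| := by
  have key : ∀ a b, a ≤ b → |D.kirchhoff α b - D.kirchhoff α a| ≤ 1 / ρm * |b - a| := by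
    intro a b hab
    have h1 := hD.kirchhoff_sub_le_of_le α hab (c := 1 / ρm) fun ζ _ =>
      one_div_le_one_div_of_le h0 (h ζ)
    have h2 := hD.le_kirchhoff_sub_of_le α hab (c := 0) fun ζ _ =>
      (one_div_pos.2 (hD.ρ_pos α ζ)).le
    rw [zero_mul] at h2
    rwa [abs_of_nonneg h2, abs_of_nonneg (sub_nonneg.2 hab)]
  rcases le_total a b with hab | hab
  · exact key a b hab
  · rw [abs_sub_comm, abs_sub_comm b]
    exact key b a hab

theorem abs_kirchhoff_le (hD : D.Assumptions) (α : Phase) {ρm : ℝ} (h0 : 0 < ρm)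
    (h : ∀ p, ρm ≤ D.ρ α p) (p : ℝ) : |D.kirchhoff α p| ≤ 1 / ρm * |p| := by
  simpa [kirchhoff_zero] using hD.abs_kirchhoff_sub_le α h0 h 0 p

theorem meanρ_comm (α : Phase) (a b : ℝ) : D.meanρ α a b = D.meanρ α b a := by
  unfold meanρ
  by_cases h : a = b
  · simp [h]
  · rw [if_neg h, if_neg (Ne.symm h), intervalIntegral.integral_symm, ← neg_sub a b]
    congr 1
    rw [one_div_neg_eq_neg_one_div]
    ring

theorem one_div_meanρ_mul (hD : D.Assumptions) (α : Phase) {a b : ℝ} (h : a ≠ b) :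
    (D.meanρ α a b)⁻¹ * (b - a) = D.kirchhoff α b - D.kirchhoff α a := by
  have h' : b - a ≠ 0 := sub_ne_zero.2 h.symm
  rw [meanρ, if_neg h, inv_inv, ← hD.kirchhoff_sub]
  field_simp

theorem meanρ_bounds (hD : D.Assumptions) (α : Phase) {ρM : ℝ}
    (hM : ∀ p, D.ρ α p ≤ ρM) (a b : ℝ) :
    0 < D.meanρ α a b ∧ D.meanρ α a b ≤ ρM := by
  have hM0 : 0 < ρM := (hD.ρ_pos α 0).trans_le (hM 0)
  wlog hab : a ≤ b generalizing a b
  · rw [meanρ_comm]; exact this b a (le_of_not_ge hab)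
  rcases hab.eq_or_lt with rfl | hlt
  · rw [meanρ, if_pos rfl]; exact ⟨hD.ρ_pos α a, hM a⟩
  · have h1 := hD.le_kirchhoff_sub_of_le α hab (c := 1 / ρM) fun ζ _ =>
      one_div_le_one_div_of_le (hD.ρ_pos α ζ) (hM ζ)
    rw [← hD.one_div_meanρ_mul α hlt.ne] at h1
    have h2 := le_of_mul_le_mul_right h1 (sub_pos.2 hlt)
    have h3 : 0 < (D.meanρ α a b)⁻¹ := (one_div_pos.2 hM0).trans_le h2
    have h4 := inv_pos.1 h3
    refine ⟨h4, ?_⟩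
    rw [one_div] at h2
    exact (inv_le_inv₀ hM0 h4).1 h2

/-- The choice of the mean density on a face makes the chain rule exact. -/
theorem meanρ_mul_sub (hD : D.Assumptions) (α : Phase) (a b : ℝ) :
    D.meanρ α a b * (D.kirchhoff α b - D.kirchhoff α a) = b - a := by
  by_cases h : a = b
  · simp [h]
  · obtain ⟨_, ρM, _, _, hb⟩ := hD.ρ_bounds
    rw [← hD.one_div_meanρ_mul α h, mul_inv_cancel_left₀]
    exact (hD.meanρ_bounds α (fun p => (hb α p).2) a b).1.ne'

theorem entropy_nonneg (hD : D.Assumptions) (α : Phase) (p : ℝ) : 0 ≤ D.entropy α p := by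
  have h := hD.kirchhoff_le α p 0
  rw [kirchhoff_zero] at h
  have hp := hD.ρ_pos α p
  rw [div_mul_eq_mul_div, le_div_iff₀ hp] at h
  rw [entropy]
  linarith

theorem entropy_le (hD : D.Assumptions) (α : Phase) {ρm ρM : ℝ} (h0 : 0 < ρm)
    (h : ∀ p, ρm ≤ D.ρ α p) (hM : ∀ p, D.ρ α p ≤ ρM) (p : ℝ) :
    D.entropy α p ≤ (ρM * (1 / ρm) + 1) * |p| := by
  have h1 := hD.abs_kirchhoff_le α h0 h p
  have h2 : D.ρ α p * D.kirchhoff α p ≤ ρM * (1 / ρm * |p|) :=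
    (mul_le_mul_of_nonneg_left (le_abs_self _) (hD.ρ_pos α p).le).trans
      (mul_le_mul (hM p) h1 (abs_nonneg _) ((hD.ρ_pos α p).le.trans (hM p)))
  rw [entropy]
  linarith [neg_abs_le p]

/-- The difference of the two sides is `t` times the gap between the concave function `kirchhoff`
and its tangent at `q`, multiplied by `ρ_α(q)`. -/
theorem entropy_ineq (hD : D.Assumptions) (α : Phase) (p q s t : ℝ) (ht : 0 ≤ t) :
    D.entropy α p * s - D.entropy α q * t + (s - t) * p ≤
      (D.ρ α p * s - D.ρ α q * t) * D.kirchhoff α p := by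
  have h := mul_le_mul_of_nonneg_left (hD.kirchhoff_le α q p)
    (mul_nonneg ht (hD.ρ_pos α q).le)
  have hq := (hD.ρ_pos α q).ne'
  have e : t * D.ρ α q * (1 / D.ρ α q * (p - q)) = t * (p - q) := by field_simp
  rw [e] at h
  simp only [entropy]
  linarith

theorem capEnergy_sub (hD : D.Assumptions) {a b : ℝ} (ha : a ∈ Icc (0 : ℝ) 1)
    (hb : b ∈ Icc (0 : ℝ) 1) : D.capEnergy b - D.capEnergy a = ∫ z in a..b, D.pc z :=
  intervalIntegral.integral_interval_sub_left
    (intervalIntegrable hD.pc_contDiff.continuousOn zero_mem hb)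
    (intervalIntegrable hD.pc_contDiff.continuousOn zero_mem ha)

/-- A primitive of the decreasing function `pc` is concave and lies below its tangents. -/
theorem capEnergy_le (hD : D.Assumptions) {a b : ℝ} (ha : a ∈ Icc (0 : ℝ) 1)
    (hb : b ∈ Icc (0 : ℝ) 1) : D.capEnergy b - D.capEnergy a ≤ D.pc a * (b - a) := by
  have hc := fun (x y : ℝ) (hx : x ∈ Icc (0 : ℝ) 1) (hy : y ∈ Icc (0 : ℝ) 1) =>
    intervalIntegrable hD.pc_contDiff.continuousOn hx hy
  rcases le_total a b with h | h
  · rw [hD.capEnergy_sub ha hb]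
    have := intervalIntegral.integral_mono_on (g := fun _ => D.pc a) h (hc a b ha hb) (by simp)
      fun z hz => hD.pc_anti.antitoneOn ha ⟨ha.1.trans hz.1, hz.2.trans hb.2⟩ hz.1
    rwa [intervalIntegral.integral_const, smul_eq_mul, mul_comm] at this
  · have h1 := hD.capEnergy_sub hb ha
    have := intervalIntegral.integral_mono_on (f := fun _ => D.pc a) h (by simp) (hc b a hb ha)
      fun z hz => hD.pc_anti.antitoneOn ⟨hb.1.trans hz.1, hz.2.trans ha.2⟩ ha hz.2
    rw [intervalIntegral.integral_const, smul_eq_mul, ← h1] at this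
    linarith

theorem pc_le (hD : D.Assumptions) {s : ℝ} (hs : s ∈ Icc (0 : ℝ) 1) : D.pc s ≤ D.pc 0 :=
  hD.pc_anti.antitoneOn zero_mem hs hs.1

theorem capEnergy_bounds (hD : D.Assumptions) {s : ℝ} (hs : s ∈ Icc (0 : ℝ) 1) :
    0 ≤ D.capEnergy s ∧ D.capEnergy s ≤ D.pc 0 := by
  have h0 : D.capEnergy 0 = 0 := intervalIntegral.integral_same
  constructor
  · exact intervalIntegral.integral_nonneg hs.1 fun z hz => hD.pc_nonneg z ⟨hz.1, hz.2.trans hs.2⟩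
  · have h1 := hD.capEnergy_le zero_mem hs
    have h2 := mul_le_mul_of_nonneg_left hs.2 (hD.pc_nonneg 0 zero_mem)
    rw [h0] at h1
    linarith

/-- The total free energy per unit pore volume. -/
def _root_.TwoPhase.FlowData.freeEnergy (D : FlowData ℓ) (pl pg sl sg : ℝ) : ℝ :=
  D.entropy .l pl * sl + D.entropy .g pg * sg - D.capEnergy sl

/-- Since the saturations sum to one, the terms `(s - t) * p` of `entropy_ineq` add up to `-p_c(s_l)
(s_l - t_l)`, which concavity bounds below by minus the increment of `capEnergy`. The capillary law
is needed only for the new state. -/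
theorem freeEnergy_sub_le (hD : D.Assumptions) {pl pg sl sg ql qg tl tg : ℝ}
    (hsl : sl ∈ Icc (0 : ℝ) 1) (htl : tl ∈ Icc (0 : ℝ) 1) (htg : 0 ≤ tg) (hs : sl + sg = 1)
    (ht : tl + tg = 1) (hpc : D.pc sl = pg - pl) :
    D.freeEnergy pl pg sl sg - D.freeEnergy ql qg tl tg ≤
      (D.ρ .l pl * sl - D.ρ .l ql * tl) * D.kirchhoff .l pl +
        (D.ρ .g pg * sg - D.ρ .g qg * tg) * D.kirchhoff .g pg := by
  have h1 := hD.entropy_ineq .l pl ql sl tl htl.1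
  have h2 := hD.entropy_ineq .g pg qg sg tg htg
  have h3 := hD.capEnergy_le hsl htl
  rw [hpc] at h3
  obtain rfl : sg = 1 - sl := by linarith
  obtain rfl : tg = 1 - tl := by linarith
  unfold freeEnergy
  linarith

/-! ### Fluxes -/

theorem massFlux_neg (α : Phase) (a d : ℝ) (η : Space ℓ) (sK sL pK pL : ℝ) :
    D.massFlux α a d (-η) sL sK pL pK = -D.massFlux α a d η sK sL pK pL := by
  simp only [massFlux, G, meanρ_comm α pL pK, inner_neg_right, neg_neg, neg_sub]
  rw [← neg_sub pL pK]
  ring_nf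

theorem neg_G_mul (α : Phase) (sK sL pK pL : ℝ) :
    -(D.G α sK sL (pL - pK) * (pL - pK)) = D.upwindM α sK sL pK pL * (pL - pK) ^ 2 := by
  unfold G upwindM
  split_ifs with h
  · rw [max_eq_right h, max_eq_left (by linarith)]; ring
  · rw [max_eq_left (by linarith), max_eq_right (by linarith)]; ring

theorem abs_gravity_le {η : Space ℓ} (hη : ‖η‖ = 1) (A B : ℝ) (hA : 0 ≤ A)
    (hB : 0 ≤ B) :
    |A * max ⟪D.grav, η⟫ 0 - B * max (-⟪D.grav, η⟫) 0| ≤ ‖D.grav‖ * A + ‖D.grav‖ * B := by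
  have h := abs_real_inner_le_norm D.grav η
  rw [hη, mul_one] at h
  have h1 : 0 ≤ max ⟪D.grav, η⟫ 0 := le_max_right _ _
  have h2 : 0 ≤ max (-⟪D.grav, η⟫) 0 := le_max_right _ _
  have h3 : max ⟪D.grav, η⟫ 0 ≤ ‖D.grav‖ := max_le ((le_abs_self _).trans h) (norm_nonneg _)
  have h4 : max (-⟪D.grav, η⟫) 0 ≤ ‖D.grav‖ := max_le ((neg_le_abs _).trans h) (norm_nonneg _)
  rw [abs_le]
  constructor <;> nlinarith [mul_nonneg hA h1, mul_nonneg hB h2,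
    mul_le_mul_of_nonneg_left h3 hA, mul_le_mul_of_nonneg_left h4 hB]

/-- One factor of the mean density turns the increment of `kirchhoff` into a pressure increment.
This makes the Darcy part exact and leaves a single bounded density in the gravity part. -/
theorem massFlux_mul_ge (hD : D.Assumptions) (α : Phase) {a d ρM : ℝ} (ha : 0 ≤ a) {η : Space ℓ}
    (hη : ‖η‖ = 1) (hM : ∀ p, D.ρ α p ≤ ρM) (sK sL pK pL : ℝ) :
    a / d * (D.upwindM α sK sL pK pL * (pL - pK) ^ 2) -
      a * (ρM * ‖D.grav‖) * (|D.Mext α sK * (pL - pK)| + |D.Mext α sL * (pL - pK)|) ≤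
    D.massFlux α a d η sK sL pK pL * (D.kirchhoff α pK - D.kirchhoff α pL) := by
  obtain ⟨hρ0, hρM⟩ := hD.meanρ_bounds α hM pK pL
  have hM0 := hρ0.le.trans hρM
  have hm := hD.meanρ_mul_sub α pK pL
  set R := D.meanρ α pK pL with hR
  set Z := D.Mext α sK * max ⟪D.grav, η⟫ 0 - D.Mext α sL * max (-⟪D.grav, η⟫) 0 with hZ
  have hZb : |Z| ≤ ‖D.grav‖ * D.Mext α sK + ‖D.grav‖ * D.Mext α sL :=
    abs_gravity_le hη _ _ (hD.Mext_nonneg α sK) (hD.Mext_nonneg α sL)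
  have e : D.massFlux α a d η sK sL pK pL * (D.kirchhoff α pK - D.kirchhoff α pL) =
      a / d * (D.upwindM α sK sL pK pL * (pL - pK) ^ 2) - a * R * (Z * (pL - pK)) := by
    rw [← neg_G_mul, massFlux, ← hR, ← hZ]
    linear_combination (-(a / d * D.G α sK sL (pL - pK) + a * R * Z)) * hm
  rw [e]
  have h1 : R * (Z * (pL - pK)) ≤
      ρM * ‖D.grav‖ * (|D.Mext α sK * (pL - pK)| + |D.Mext α sL * (pL - pK)|) := by
    calc R * (Z * (pL - pK)) ≤ R * (|Z| * |pL - pK|) := by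
          rw [← abs_mul]; exact mul_le_mul_of_nonneg_left (le_abs_self _) hρ0.le
      _ ≤ ρM * ((‖D.grav‖ * D.Mext α sK + ‖D.grav‖ * D.Mext α sL) * |pL - pK|) := by gcongr
      _ = _ := by
          rw [abs_mul, abs_mul, abs_of_nonneg (hD.Mext_nonneg α sK),
            abs_of_nonneg (hD.Mext_nonneg α sL)]
          ring
  have h2 := mul_le_mul_of_nonneg_left h1 ha
  linarith

/-- The share `E / 8` is taken because four gravity terms, two per phase, are to be absorbed by half
of the dissipation. -/
theorem young_face {a d c C E y : ℝ} (ha : 0 ≤ a) (hd : 0 < d) (hC : 0 < C)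
    (h : y ^ 2 ≤ C * E) : a * c * |y| ≤ a / d * (E / 8) + a * d * (2 * C * c ^ 2) := by
  have hk : c * |y| ≤ y ^ 2 / (8 * C * d) + 2 * C * d * c ^ 2 := by
    have e : y ^ 2 / (8 * C * d) + 2 * C * d * c ^ 2 - c * |y| =
        (|y| - 4 * C * d * c) ^ 2 / (8 * C * d) := by
      rw [← sq_abs y]; field_simp; ring
    rw [← sub_nonneg, e]
    positivity
  have h1 : y ^ 2 / (8 * C * d) ≤ 1 / d * (E / 8) := by
    rw [div_le_iff₀ (by positivity)]
    have : 1 / d * (E / 8) * (8 * C * d) = C * E := by field_simp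
    rwa [this]
  calc a * c * |y| = a * (c * |y|) := by ring
    _ ≤ a * (1 / d * (E / 8) + 2 * C * d * c ^ 2) :=
        mul_le_mul_of_nonneg_left (hk.trans (add_le_add h1 le_rfl)) ha
    _ = _ := by ring

/-- The fluxes tested with the primitives of the inverse densities dissipate, up to the effect of
gravity. -/
theorem exists_flux_lower (hD : D.Assumptions) : ∃ C : ℝ, 0 < C ∧
    ∀ sK ∈ Icc (0 : ℝ) 1, ∀ sL ∈ Icc (0 : ℝ) 1, ∀ lK lL gK gL : ℝ, D.pc sK = gK - lK →
      D.pc sL = gL - lL → ∀ (a d : ℝ) (η : Space ℓ), 0 ≤ a → 0 < d → ‖η‖ = 1 →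
      a / d * (D.diss sK sL lK lL gK gL / 2) - C * (a * d) ≤
        D.massFlux .l a d η sK sL lK lL * (D.kirchhoff .l lK - D.kirchhoff .l lL) +
        D.massFlux .g a d η (1 - sK) (1 - sL) gK gL *
          (D.kirchhoff .g gK - D.kirchhoff .g gL) := by
  obtain ⟨C, hC, hface⟩ := hD.exists_face_estimate
  obtain ⟨ρm, ρM, hρm, hρM, hρ⟩ := hD.ρ_bounds
  refine ⟨8 * C * (ρM * ‖D.grav‖) ^ 2 + 1, by positivity, ?_⟩
  intro sK hK sL hL lK lL gK gL hcK hcL a d η ha hd hη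
  obtain ⟨_, _, _, _, h5, h6, h7, h8⟩ := hface sK hK sL hL lK lL gK gL hcK hcL
  have k1 := hD.massFlux_mul_ge .l (d := d) ha hη (fun p => (hρ .l p).2) sK sL lK lL
  have k2 := hD.massFlux_mul_ge .g (d := d) ha hη (fun p => (hρ .g p).2) (1 - sK) (1 - sL) gK gL
  rw [Mext_eq hK, Mext_eq hL] at k1
  rw [Mext_eq (one_sub_mem hK), Mext_eq (one_sub_mem hL)] at k2
  have y5 := young_face (c := ρM * ‖D.grav‖) ha hd hC h5
  have y6 := young_face (c := ρM * ‖D.grav‖) ha hd hC h6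
  have y7 := young_face (c := ρM * ‖D.grav‖) ha hd hC h7
  have y8 := young_face (c := ρM * ‖D.grav‖) ha hd hC h8
  have hE : D.diss sK sL lK lL gK gL = D.upwindM .l sK sL lK lL * (lL - lK) ^ 2 +
    D.upwindM .g (1 - sK) (1 - sL) gK gL * (gL - gK) ^ 2 := rfl
  have had : 0 ≤ a * d := mul_nonneg ha hd.le
  set E := D.diss sK sL lK lL gK gL
  have e1 : a / d * (D.upwindM .l sK sL lK lL * (lL - lK) ^ 2) +
    a / d * (D.upwindM .g (1 - sK) (1 - sL) gK gL * (gL - gK) ^ 2) = a / d * E := by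
    rw [hE]; ring
  linarith

end Assumptions

end FlowData

end TwoPhase

end

/-! ### Mean values of the data and the maximum principle. -/

open scoped MeasureTheory RealInnerProductSpace ENNReal

noncomputable section

set_option linter.unusedSectionVars false

namespace TwoPhase

open MeasureTheory Set

section Mean

variable {X : Type*} [MeasurableSpace X] {μ : Measure X} {S : Set X} {f : X → ℝ}

theorem le_setMean {a : ℝ} (h0 : 0 < μ.real S) (hf : IntegrableOn f S μ)
    (h : ∀ᵐ x ∂μ.restrict S, a ≤ f x) : a ≤ (μ.real S)⁻¹ * ∫ x in S, f x ∂μ := by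
  have ht : μ S ≠ ∞ := by
    intro h'; rw [measureReal_def, h'] at h0; simp at h0
  have := setIntegral_mono_ae_restrict (integrableOn_const ht) hf h
  rw [setIntegral_const, smul_eq_mul] at this
  rw [inv_mul_eq_div, le_div_iff₀ h0]
  linarith

theorem setMean_le {b : ℝ} (h0 : 0 < μ.real S) (hf : IntegrableOn f S μ)
    (h : ∀ᵐ x ∂μ.restrict S, f x ≤ b) : (μ.real S)⁻¹ * ∫ x in S, f x ∂μ ≤ b := by
  have ht : μ S ≠ ∞ := by
    intro h'; rw [measureReal_def, h'] at h0; simp at h0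
  have := setIntegral_mono_ae_restrict hf (integrableOn_const ht) h
  rw [setIntegral_const, smul_eq_mul] at this
  rw [inv_mul_eq_div, div_le_iff₀ h0]
  linarith

/-- Jensen's inequality for the square. -/
theorem measure_mul_setMean_sq_le (h0 : 0 < μ.real S) (hf : IntegrableOn f S μ)
    (hf2 : IntegrableOn (fun x => f x ^ 2) S μ) :
    μ.real S * ((μ.real S)⁻¹ * ∫ x in S, f x ∂μ) ^ 2 ≤ ∫ x in S, f x ^ 2 ∂μ := by
  have ht : μ S ≠ ∞ := by
    intro h'; rw [measureReal_def, h'] at h0; simp at h0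
  set c := (μ.real S)⁻¹ * ∫ x in S, f x ∂μ with hc
  have hI : ∫ x in S, f x ∂μ = μ.real S * c := by rw [hc, mul_inv_cancel_left₀ h0.ne']
  -- The tangent to the square at the mean value is integrated.
  have h1 : ∫ x in S, (2 * c * f x - c ^ 2) ∂μ ≤ ∫ x in S, f x ^ 2 ∂μ := by
    refine setIntegral_mono ((hf.const_mul _).sub (integrableOn_const ht)) hf2 fun x => ?_
    nlinarith [sq_nonneg (f x - c)]
  rw [integral_sub (hf.const_mul _) (integrableOn_const ht), integral_const_mul, hI,
    setIntegral_const, smul_eq_mul] at h1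
  linarith

theorem integrableOn_of_ae_mem_Icc {a b : ℝ} (ht : μ S ≠ ∞)
    (hf : AEStronglyMeasurable f (μ.restrict S)) (h : ∀ᵐ x ∂μ.restrict S, f x ∈ Icc a b) :
    IntegrableOn f S μ := by
  have : IsFiniteMeasure (μ.restrict S) :=
    ⟨by rw [Measure.restrict_apply_univ]; exact lt_top_iff_ne_top.2 ht⟩
  refine Integrable.of_bound hf (max |a| |b|) ?_
  filter_upwards [h] with x hx
  rw [Real.norm_eq_abs, abs_le']
  refine ⟨hx.2.trans ((le_abs_self b).trans (le_max_right _ _)), ?_⟩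
  have := neg_le_abs a
  linarith [hx.1, le_max_left |a| |b|]

end Mean

namespace FlowData

variable {ℓ : ℕ} {D : FlowData ℓ} {ι κ : Type} [Fintype ι] [Fintype κ] {m : MeshData ℓ ι κ} {ξ : ℝ}
  {N : ℕ}

namespace Assumptions

theorem timeStep_pos (hD : D.Assumptions) (N : ℕ) : 0 < D.timeStep N :=
  div_pos hD.T_pos (by positivity)

theorem timeStep_mul (N : ℕ) : D.timeStep N * (N + 1) = D.T := by
  rw [timeStep]; field_simp

/-- The space-time box of a control volume. -/
def _root_.TwoPhase.FlowData.box (D : FlowData ℓ) (m : MeshData ℓ ι κ) (N n : ℕ) (K : ι) :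
    Set (ℝ × Space ℓ) :=
  Ioo (n * D.timeStep N) ((n + 1) * D.timeStep N) ×ˢ m.cell K

theorem volume_box (hD : D.Assumptions) (m : MeshData ℓ ι κ) (N n : ℕ) (K : ι) :
    volume.real (D.box m N n K) = D.timeStep N * m.vol K := by
  rw [box, measureReal_def, Measure.volume_eq_prod, Measure.prod_prod, Real.volume_Ioo,
    ENNReal.toReal_mul, ← measureReal_def, MeshData.vol, ENNReal.toReal_ofReal]
  · ring
  · have := (hD.timeStep_pos N).le
    linarith

theorem box_subset (hD : D.Assumptions) (hm : m.IsAdmissible D.Ω D.Γ ξ) {n : ℕ} (hn : n ≤ N)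
    (K : ι) : D.box m N n K ⊆ Ioo 0 D.T ×ˢ D.Ω := by
  have h0 := hD.timeStep_pos N
  refine prod_mono (Ioo_subset_Ioo (by positivity) ?_) (hm.subset K)
  rw [← timeStep_mul (D := D) N, mul_comm]
  gcongr

theorem measurableSet_box (hm : m.IsAdmissible D.Ω D.Γ ξ) (n : ℕ) (K : ι) :
    MeasurableSet (D.box m N n K) := measurableSet_Ioo.prod (hm.isOpen K).measurableSet

theorem box_disjoint (hD : D.Assumptions) (hm : m.IsAdmissible D.Ω D.Γ ξ) {n n' : ℕ} {K K' : ι}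
    (h : (n, K) ≠ (n', K')) : Disjoint (D.box m N n K) (D.box m N n' K') := by
  have h0 := hD.timeStep_pos N
  rw [Set.disjoint_left]
  rintro ⟨t, x⟩ ⟨⟨h1, h2⟩, h3⟩ ⟨⟨h4, h5⟩, h6⟩
  apply h
  simp only at h1 h2 h3 h4 h5 h6
  have a1 : (n : ℝ) < n' + 1 := by
    have := h1.trans h5
    exact lt_of_mul_lt_mul_right this h0.le
  have a2 : (n' : ℝ) < n + 1 := by
    have := h4.trans h2
    exact lt_of_mul_lt_mul_right this h0.le
  have a3 : n < n' + 1 := by exact_mod_cast a1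
  have a4 : n' < n + 1 := by exact_mod_cast a2
  rw [hm.mem_cell_unique h3 h6, show n = n' by omega]

theorem ae_box (hD : D.Assumptions) (hm : m.IsAdmissible D.Ω D.Γ ξ) {n : ℕ} (hn : n ≤ N) (K : ι)
    {P : ℝ × Space ℓ → Prop} (h : ∀ᵐ z ∂D.cylinderMeasure, P z) :
    ∀ᵐ z ∂volume.restrict (D.box m N n K), P z :=
  ae_restrict_of_ae_restrict_of_subset (hD.box_subset hm hn K) h

theorem volume_box_pos (hD : D.Assumptions) (hm : m.IsAdmissible D.Ω D.Γ ξ) (n : ℕ) (K : ι) :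
    0 < volume.real (D.box m N n K) := by
  rw [hD.volume_box]
  exact mul_pos (hD.timeStep_pos N) (hm.vol_pos K)

theorem volume_box_ne_top (hD : D.Assumptions) (hm : m.IsAdmissible D.Ω D.Γ ξ) (n : ℕ) (K : ι) :
    volume (D.box m N n K) ≠ ∞ := by
  intro h
  have := hD.volume_box_pos (N := N) hm n K
  rw [measureReal_def, h] at this
  simp at this

theorem spaceTimeMean_eq (hD : D.Assumptions) (m : MeshData ℓ ι κ) (N n : ℕ) (K : ι)
    (f : ℝ × Space ℓ → ℝ) : D.spaceTimeMean m N n K f =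
      (volume.real (D.box m N n K))⁻¹ * ∫ z in D.box m N n K, f z := by
  rw [hD.volume_box]; rfl

theorem isFiniteMeasure_cylinder (hD : D.Assumptions) : IsFiniteMeasure D.cylinderMeasure := by
  refine ⟨?_⟩
  rw [cylinderMeasure, Measure.restrict_apply_univ]
  exact ((Metric.isBounded_Ioo 0 D.T).prod hD.isBounded_Ω).measure_lt_top

theorem integrableOn_box (hD : D.Assumptions) (hm : m.IsAdmissible D.Ω D.Γ ξ) {n : ℕ} (hn : n ≤ N)
    (K : ι) {f : ℝ × Space ℓ → ℝ} (hf : Integrable f D.cylinderMeasure) :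
    IntegrableOn f (D.box m N n K) :=
  IntegrableOn.mono_set (t := Ioo 0 D.T ×ˢ D.Ω) hf (hD.box_subset hm hn K)

theorem spaceTimeMean_nonneg (hD : D.Assumptions) (hm : m.IsAdmissible D.Ω D.Γ ξ) {n : ℕ}
    (hn : n ≤ N) (K : ι) {f : ℝ × Space ℓ → ℝ} (h : ∀ᵐ z ∂D.cylinderMeasure, 0 ≤ f z) :
    0 ≤ D.spaceTimeMean m N n K f := by
  rw [hD.spaceTimeMean_eq]
  exact mul_nonneg (inv_nonneg.2 measureReal_nonneg)
    (integral_nonneg_of_ae (hD.ae_box hm hn K h))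

theorem spaceTimeMean_sI_mem (hD : D.Assumptions) (hm : m.IsAdmissible D.Ω D.Γ ξ) {n : ℕ}
    (hn : n ≤ N) (α : Phase) (K : ι) : D.spaceTimeMean m N n K (D.sI α) ∈ Icc (0 : ℝ) 1 := by
  have hmem := hD.ae_box hm hn K (hD.sI_mem α)
  have hi : IntegrableOn (D.sI α) (D.box m N n K) :=
    integrableOn_of_ae_mem_Icc (hD.volume_box_ne_top hm n K)
      ((hD.sI_meas α).mono_measure (Measure.restrict_mono (hD.box_subset hm hn K) le_rfl)) hmem
  rw [hD.spaceTimeMean_eq]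
  exact ⟨le_setMean (hD.volume_box_pos hm n K) hi (hmem.mono fun _ h => h.1),
    setMean_le (hD.volume_box_pos hm n K) hi (hmem.mono fun _ h => h.2)⟩

/-- The discrete `L²` norm of the means is bounded by the `L²` norm. -/
theorem sum_spaceTimeMean_sq_le (hD : D.Assumptions) (hm : m.IsAdmissible D.Ω D.Γ ξ) (N : ℕ)
    {f : ℝ × Space ℓ → ℝ} (hf : MemLp f 2 D.cylinderMeasure) :
    ∑ n ∈ Finset.range (N + 1), D.timeStep N * ∑ K, m.vol K * D.spaceTimeMean m N n K f ^ 2 ≤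
      ∫ z, f z ^ 2 ∂D.cylinderMeasure := by
  have := hD.isFiniteMeasure_cylinder
  have hf1 : Integrable f D.cylinderMeasure := hf.integrable (by norm_num)
  have hf2 : Integrable (fun z => f z ^ 2) D.cylinderMeasure := hf.integrable_sq
  have h1 : ∀ n ∈ Finset.range (N + 1), D.timeStep N * ∑ K, m.vol K *
      D.spaceTimeMean m N n K f ^ 2 ≤ ∑ K, ∫ z in D.box m N n K, f z ^ 2 := by
    intro n hn
    have hn' : n ≤ N := Nat.lt_succ_iff.1 (Finset.mem_range.1 hn)
    rw [Finset.mul_sum]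
    refine Finset.sum_le_sum fun K _ => ?_
    rw [← mul_assoc, ← hD.volume_box m N n K, hD.spaceTimeMean_eq]
    exact measure_mul_setMean_sq_le (hD.volume_box_pos hm n K) (hD.integrableOn_box hm hn' K hf1)
      (hD.integrableOn_box hm hn' K hf2)
  refine (Finset.sum_le_sum h1).trans ?_
  rw [← Finset.sum_product' (f := fun n K => ∫ z in D.box m N n K, f z ^ 2),
    ← integral_biUnion_finset (s := fun q : ℕ × ι => D.box m N q.1 q.2)]
  · refine setIntegral_mono_set hf2 (Filter.Eventually.of_forall fun z => sq_nonneg _)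
      (LE.le.eventuallyLE ?_)
    refine iUnion₂_subset fun q hq => hD.box_subset hm ?_ q.2
    exact Nat.lt_succ_iff.1 (Finset.mem_range.1 (Finset.mem_product.1 hq).1)
  · exact fun q _ => measurableSet_box hm q.1 q.2
  · exact fun q _ q' _ hne => hD.box_disjoint hm hne
  · intro q hq
    exact hD.integrableOn_box hm (Nat.lt_succ_iff.1 (Finset.mem_range.1 (Finset.mem_product.1 hq).1))
      q.2 hf2

theorem ae_cell (hm : m.IsAdmissible D.Ω D.Γ ξ) (K : ι) {P : Space ℓ → Prop}
    (h : ∀ᵐ x ∂volume.restrict D.Ω, P x) : ∀ᵐ x ∂volume.restrict (m.cell K), P x :=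
  ae_restrict_of_ae_restrict_of_subset (hm.subset K) h

theorem spaceMean_mem (hm : m.IsAdmissible D.Ω D.Γ ξ) (K : ι) {f : Space ℓ → ℝ} {a b : ℝ}
    (hf : AEStronglyMeasurable f (volume.restrict D.Ω))
    (h : ∀ᵐ x ∂volume.restrict D.Ω, f x ∈ Icc a b) : spaceMean m K f ∈ Icc a b := by
  have hmem := ae_cell hm K h
  have hi : IntegrableOn f (m.cell K) := integrableOn_of_ae_mem_Icc (hm.volume_lt_top K).ne
    (hf.mono_measure (Measure.restrict_mono (hm.subset K) le_rfl)) hmem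
  exact ⟨le_setMean (hm.vol_pos K) hi (hmem.mono fun _ h => h.1),
    setMean_le (hm.vol_pos K) hi (hmem.mono fun _ h => h.2)⟩

theorem spaceMean_s0_add (hD : D.Assumptions) (hm : m.IsAdmissible D.Ω D.Γ ξ) (K : ι) :
    spaceMean m K (D.s0 .l) + spaceMean m K (D.s0 .g) = 1 := by
  have hi : ∀ α, IntegrableOn (D.s0 α) (m.cell K) := fun α =>
    integrableOn_of_ae_mem_Icc (hm.volume_lt_top K).ne
      ((hD.s0_meas α).mono_measure (Measure.restrict_mono (hm.subset K) le_rfl))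
      (ae_cell hm K (hD.s0_mem α))
  have h1 : ∫ x in m.cell K, (D.s0 .l x + D.s0 .g x) = m.vol K := by
    rw [integral_congr_ae (ae_cell hm K hD.s0_sum), setIntegral_const, smul_eq_mul, mul_one]
    rfl
  rw [spaceMean, spaceMean, ← mul_add, ← integral_add (hi .l) (hi .g), h1,
    inv_mul_cancel₀ (hm.vol_pos K).ne']

theorem integrable_p0 (hD : D.Assumptions) (α : Phase) : IntegrableOn (D.p0 α) D.Ω := by
  have : IsFiniteMeasure (volume.restrict D.Ω) :=
    ⟨by rw [Measure.restrict_apply_univ]; exact hD.isBounded_Ω.measure_lt_top⟩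
  exact (hD.p0_memLp α).integrable (by norm_num)

theorem sum_vol_mul_abs_p0_le (hD : D.Assumptions) (hm : m.IsAdmissible D.Ω D.Γ ξ) (α : Phase) :
    ∑ K, m.vol K * |spaceMean m K (D.p0 α)| ≤ ∫ x in D.Ω, |D.p0 α x| := by
  have hi := hD.integrable_p0 α
  have h1 : ∀ K, m.vol K * |spaceMean m K (D.p0 α)| ≤ ∫ x in m.cell K, |D.p0 α x| := by
    intro K
    rw [spaceMean, abs_mul, abs_of_pos (inv_pos.2 (hm.vol_pos K)),
      mul_inv_cancel_left₀ (hm.vol_pos K).ne']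
    exact abs_integral_le_integral_abs
  refine (Finset.sum_le_sum fun K _ => h1 K).trans ?_
  rw [← integral_biUnion_finset _ (fun K _ => (hm.isOpen K).measurableSet)]
  · refine setIntegral_mono_set hi.abs (Filter.Eventually.of_forall fun z => abs_nonneg _)
      (LE.le.eventuallyLE (iUnion₂_subset fun K _ => hm.subset K))
  · exact fun K _ L _ hne => disjoint_iff_inter_eq_empty.2 (hm.disjoint K L hne)
  · exact fun K _ => (hi.mono_set (hm.subset K)).abs

/-! ### The maximum principle -/

theorem massFlux_nonpos (hD : D.Assumptions) {α : Phase} {a d : ℝ} (ha : 0 ≤ a) (hd : 0 < d)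
    (η : Space ℓ) {sK : ℝ} (hs : sK < 0) (sL pK pL : ℝ) :
    D.massFlux α a d η sK sL pK pL ≤ 0 := by
  have h0 : D.Mext α sK = 0 := by
    rw [Mext, max_eq_left ((min_le_right _ _).trans hs.le), hD.M_zero]
  obtain ⟨_, ρM, _, _, hb⟩ := hD.ρ_bounds
  have hρ := (hD.meanρ_bounds α (fun p => (hb α p).2) pK pL).1
  have hM := hD.Mext_nonneg α sL
  have h1 : 0 ≤ D.Mext α sL * max (pL - pK) 0 := mul_nonneg hM (le_max_right _ _)
  have h2 : 0 ≤ D.Mext α sL * max (-⟪D.grav, η⟫) 0 := mul_nonneg hM (le_max_right _ _)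
  rw [massFlux, G, h0, zero_mul, zero_mul, add_zero, zero_sub, mul_neg, mul_neg, ← neg_add,
    neg_nonpos]
  positivity

/-- At a negative saturation the extended mobility of the cell vanishes, so no mass flows out.
Accumulation is then strictly negative, fluxes and production are nonpositive, and injection is
nonnegative, which contradicts the balance. This is local to the cell, so no minimal cell has to be
selected. -/
theorem saturation_nonneg (hD : D.Assumptions) (hm : m.IsAdmissible D.Ω D.Γ ξ)
    {p s : Phase → ℕ → ι → ℝ} (hs : D.IsSchemeSolution m N p s) (α : Phase) :
    ∀ n ≤ N + 1, ∀ K, 0 ≤ s α n K := by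
  intro n
  induction n with
  | zero =>
    intro _ K
    rw [hs.init_s]
    exact (spaceMean_mem hm K (hD.s0_meas α) (hD.s0_mem α)).1
  | succ n ih =>
    intro hn K
    have hn' : n ≤ N := by omega
    by_contra hneg
    push Not at hneg
    have hb := hs.balance n hn' α K
    have hδ := hD.timeStep_pos N
    have hv := hm.vol_pos K
    obtain ⟨φ₀, φ₁, hφ₀, _, hφ⟩ := hD.φ_bounds
    have hφK := hφ₀.trans_le (spaceMean_mem hm K hD.φ_meas hφ).1
    have hρ := hD.ρ_pos α (p α (n + 1) K)
    have hρ' := hD.ρ_pos α (p α n K)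
    have hold := mul_nonneg hρ'.le (ih (by omega) K)
    have hnew := mul_neg_of_pos_of_neg hρ hneg
    have t1 : m.vol K * spaceMean m K D.φ * ((D.ρ α (p α (n + 1) K) * s α (n + 1) K -
        D.ρ α (p α n K) * s α n K) / D.timeStep N) < 0 :=
      mul_neg_of_pos_of_neg (mul_pos hv hφK) (div_neg_of_neg_of_pos (by linarith) hδ)
    have t2 : ∑ L ∈ m.nbrs K, D.massFlux α (m.area K L) (m.cdist K L) (m.normal K L)
        (s α (n + 1) K) (s α (n + 1) L) (p α (n + 1) K) (p α (n + 1) L) ≤ 0 :=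
      Finset.sum_nonpos fun L hL =>
        hD.massFlux_nonpos (m.area_nonneg K L) (hm.cdist_pos hL) _ hneg _ _ _
    have t3 : ∑ k ∈ m.extFaces K, D.massFlux α (m.extArea k) (m.extDist k) (m.extNormal k)
        (s α (n + 1) K) (bdrySat α) (p α (n + 1) K) 0 ≤ 0 :=
      Finset.sum_nonpos fun k _ =>
        hD.massFlux_nonpos (m.extArea_nonneg k) (hm.extDist_pos k) _ hneg _ _ _
    have t4 : m.vol K * D.ρ α (p α (n + 1) K) * s α (n + 1) K * D.spaceTimeMean m N n K D.fP ≤ 0 :=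
      mul_nonpos_of_nonpos_of_nonneg
        (mul_neg_of_pos_of_neg (mul_pos hv hρ) hneg).le
        (hD.spaceTimeMean_nonneg hm hn' K hD.fP_nonneg)
    have t5 : 0 ≤ m.vol K * D.ρ α (p α (n + 1) K) * D.spaceTimeMean m N n K (D.sI α) *
        D.spaceTimeMean m N n K D.fI :=
      mul_nonneg (mul_nonneg (mul_pos hv hρ).le (hD.spaceTimeMean_sI_mem hm hn' α K).1)
        (hD.spaceTimeMean_nonneg hm hn' K hD.fI_nonneg)
    linarith

theorem saturation_add (hD : D.Assumptions) (hm : m.IsAdmissible D.Ω D.Γ ξ)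
    {p s : Phase → ℕ → ι → ℝ} (hs : D.IsSchemeSolution m N p s) {n : ℕ} (hn : n ≤ N + 1) (K : ι) :
    s .l n K + s .g n K = 1 := by
  rcases n with _ | n
  · rw [hs.init_s, hs.init_s]
    exact hD.spaceMean_s0_add hm K
  · exact hs.saturated n (by omega) K

theorem saturation_mem (hD : D.Assumptions) (hm : m.IsAdmissible D.Ω D.Γ ξ)
    {p s : Phase → ℕ → ι → ℝ} (hs : D.IsSchemeSolution m N p s) {n : ℕ} (hn : n ≤ N + 1) (K : ι) :
    s .l n K ∈ Icc (0 : ℝ) 1 := by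
  refine ⟨hD.saturation_nonneg hm hs .l n hn K, ?_⟩
  linarith [hD.saturation_add hm hs hn K, hD.saturation_nonneg hm hs .g n hn K]

end Assumptions

end FlowData

end TwoPhase

end

/-! ### Dissipation and global pressure summed over all faces. -/

open scoped MeasureTheory RealInnerProductSpace ENNReal

noncomputable section

set_option linter.unusedSectionVars false

namespace TwoPhase

open MeasureTheory Set

section FaceSum

variable {ℓ : ℕ} {ι κ : Type} [Fintype ι] [Fintype κ] {m : MeshData ℓ ι κ} {Ω Γ : Set (Space ℓ)}
  {ξ : ℝ}

/-- The sum over all faces of quantities weighted with the transmissivities. -/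
def MeshData.faceSum (m : MeshData ℓ ι κ) (f : ι → ι → ℝ) (h : ι → ℝ) : ℝ :=
  ∑ K, (∑ L ∈ m.nbrs K, m.trans K L * f K L + ∑ k ∈ m.extFaces K, m.extTrans k * h K)

theorem MeshData.IsAdmissible.faceSum_le (hm : m.IsAdmissible Ω Γ ξ) {f f' : ι → ι → ℝ}
    {h h' : ι → ℝ} {C : ℝ} (hf : ∀ K L, f K L ≤ C * f' K L) (hh : ∀ K, h K ≤ C * h' K) :
    m.faceSum f h ≤ C * m.faceSum f' h' := by
  rw [MeshData.faceSum, MeshData.faceSum, Finset.mul_sum]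
  refine Finset.sum_le_sum fun K _ => ?_
  rw [mul_add, Finset.mul_sum, Finset.mul_sum]
  refine add_le_add (Finset.sum_le_sum fun L hL => ?_) (Finset.sum_le_sum fun k _ => ?_)
  · rw [mul_left_comm]
    exact mul_le_mul_of_nonneg_left (hf K L) (hm.trans_nonneg hL)
  · rw [mul_left_comm]
    exact mul_le_mul_of_nonneg_left (hh K) (hm.extTrans_nonneg k)

end FaceSum

namespace FlowData

variable {ℓ : ℕ} {D : FlowData ℓ} {ι κ : Type} [Fintype ι] [Fintype κ]

/-- The total dissipation of a state. -/
def stateDiss (D : FlowData ℓ) (m : MeshData ℓ ι κ) (s l g : ι → ℝ) : ℝ :=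
  m.faceSum (fun K L => D.diss (s K) (s L) (l K) (l L) (g K) (g L))
    (fun K => D.diss (s K) 1 (l K) 0 (g K) 0)

/-- The total mass flux of a phase out of a control volume. -/
def outFlux (D : FlowData ℓ) (m : MeshData ℓ ι κ) (α : Phase) (s p : ι → ℝ) (K : ι) : ℝ :=
  ∑ L ∈ m.nbrs K, D.massFlux α (m.area K L) (m.cdist K L) (m.normal K L) (s K) (s L) (p K) (p L) +
    ∑ k ∈ m.extFaces K, D.massFlux α (m.extArea k) (m.extDist k) (m.extNormal k)
      (s K) (bdrySat α) (p K) 0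

namespace Assumptions

/-- Discrete integration by parts for conservative fluxes; the factor `1/2` appears because each
interface is counted from both sides. -/
theorem sum_antisymm (m : MeshData ℓ ι κ) {F : ι → ι → ℝ} (hF : ∀ K L, F L K = -F K L)
    (u : ι → ℝ) : ∑ K, ∑ L ∈ m.nbrs K, F K L * u K =
      1 / 2 * ∑ K, ∑ L ∈ m.nbrs K, F K L * (u K - u L) := by
  have h := m.sum_nbrs_comm fun K L => F K L * u K
  have e : ∑ K, ∑ L ∈ m.nbrs K, F L K * u L = -∑ K, ∑ L ∈ m.nbrs K, F K L * u L := by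
    rw [← Finset.sum_neg_distrib]
    refine Finset.sum_congr rfl fun K _ => ?_
    rw [← Finset.sum_neg_distrib]
    exact Finset.sum_congr rfl fun L _ => by rw [hF K L, neg_mul]
  rw [e] at h
  simp only [mul_sub, Finset.sum_sub_distrib]
  linarith

theorem Γ_subset_closure (hD : D.Assumptions) : D.Γ ⊆ closure D.Ω :=
  hD.Γ_subset.trans frontier_subset_closure

theorem sum_outFlux_mul (α : Phase) (m : MeshData ℓ ι κ) (s p : ι → ℝ) :
    ∑ K, D.outFlux m α s p K * D.kirchhoff α (p K) =
      1 / 2 * ∑ K, ∑ L ∈ m.nbrs K, D.massFlux α (m.area K L) (m.cdist K L) (m.normal K L)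
        (s K) (s L) (p K) (p L) * (D.kirchhoff α (p K) - D.kirchhoff α (p L)) +
      ∑ K, ∑ k ∈ m.extFaces K, D.massFlux α (m.extArea k) (m.extDist k) (m.extNormal k)
        (s K) (bdrySat α) (p K) 0 * (D.kirchhoff α (p K) - D.kirchhoff α 0) := by
  rw [← sum_antisymm m (F := fun K L => D.massFlux α (m.area K L) (m.cdist K L) (m.normal K L)
    (s K) (s L) (p K) (p L))]
  · simp only [outFlux, add_mul, Finset.sum_mul, Finset.sum_add_distrib, kirchhoff_zero, sub_zero]
  · intro K L
    rw [m.area_comm L K, m.cdist_comm L K, m.normal_comm K L, massFlux_neg]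

/-- The fluxes tested with the primitives of the inverse densities control the dissipation. -/
theorem exists_sum_outFlux_ge (hD : D.Assumptions) (hℓ : 1 ≤ ℓ) {ξ : ℝ} (hξ : 0 < ξ) :
    ∃ C : ℝ, 0 < C ∧ ∀ (ι κ : Type) [Fintype ι] [Fintype κ] (m : MeshData ℓ ι κ)
      (s l g : ι → ℝ), m.IsAdmissible D.Ω D.Γ ξ → (∀ K, s K ∈ Icc (0 : ℝ) 1) →
      (∀ K, D.pc (s K) = g K - l K) →
      D.stateDiss m s l g / 4 - C ≤
        ∑ K, (D.outFlux m .l s l K * D.kirchhoff .l (l K) +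
          D.outFlux m .g (fun K => 1 - s K) g K * D.kirchhoff .g (g K)) := by
  obtain ⟨C, hC, hflux⟩ := hD.exists_flux_lower
  have hv : 0 ≤ volume.real D.Ω := measureReal_nonneg
  -- The gravity cost is `ξ / 2` on interior faces, halved by the symmetrization, and `2 ^ ℓ` on
  -- Dirichlet faces.
  refine ⟨C * (ξ / 2 + 2 ^ ℓ) * volume.real D.Ω + 1, by positivity, ?_⟩
  intro ι κ _ _ m s l g hm hs hpc
  rw [Finset.sum_add_distrib, sum_outFlux_mul, sum_outFlux_mul]
  have hint : ∀ K, ∀ L ∈ m.nbrs K, _ := fun K L hL => hflux (s K) (hs K) (s L) (hs L) (l K) (l L)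
    (g K) (g L) (hpc K) (hpc L) (m.area K L) (m.cdist K L) (m.normal K L) (m.area_nonneg K L)
    (hm.cdist_pos hL) (hm.norm_normal hL)
  -- The exterior state satisfies the capillary law because `pc 1 = 0`, so the face estimate also
  -- covers Dirichlet faces.
  have hext : ∀ K, ∀ k ∈ m.extFaces K, _ := fun K k _ => hflux (s K) (hs K) 1 one_mem (l K) 0
    (g K) 0 (hpc K) (by rw [hD.pc_one, sub_zero]) (m.extArea k) (m.extDist k) (m.extNormal k)
    (m.extArea_nonneg k) (hm.extDist_pos k) (hm.extNormal_unit k)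
  have s1 := Finset.sum_le_sum fun K (_ : K ∈ Finset.univ) => Finset.sum_le_sum (hint K)
  have s2 := Finset.sum_le_sum fun K (_ : K ∈ Finset.univ) => Finset.sum_le_sum (hext K)
  simp only [Finset.sum_add_distrib, Finset.sum_sub_distrib, ← Finset.mul_sum] at s1 s2
  have a1 : ∑ K, ∑ L ∈ m.nbrs K, m.area K L * m.cdist K L ≤ ξ * volume.real D.Ω := by
    rw [← hm.sum_vol, Finset.mul_sum]
    exact Finset.sum_le_sum fun K _ => hm.regular K
  have a2 : ∑ K, ∑ k ∈ m.extFaces K, m.extArea k * m.extDist k ≤ 2 ^ ℓ * volume.real D.Ω := by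
    rw [← hm.sum_vol, Finset.mul_sum]
    exact Finset.sum_le_sum fun K _ =>
      hm.sum_extArea_mul_extDist_le hℓ hD.isOpen_Ω hD.Γ_subset K
  have b1 := mul_le_mul_of_nonneg_left a1 hC.le
  have b2 := mul_le_mul_of_nonneg_left a2 hC.le
  have hdiss : D.stateDiss m s l g =
      ∑ K, ∑ L ∈ m.nbrs K, m.trans K L * D.diss (s K) (s L) (l K) (l L) (g K) (g L) +
      ∑ K, ∑ k ∈ m.extFaces K, m.extTrans k * D.diss (s K) 1 (l K) 0 (g K) 0 :=
    Finset.sum_add_distrib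
  have c1 : ∑ K, ∑ L ∈ m.nbrs K, m.area K L / m.cdist K L *
      (D.diss (s K) (s L) (l K) (l L) (g K) (g L) / 2) =
      1 / 2 * ∑ K, ∑ L ∈ m.nbrs K, m.trans K L * D.diss (s K) (s L) (l K) (l L) (g K) (g L) := by
    simp only [Finset.mul_sum]
    exact Finset.sum_congr rfl fun K _ => Finset.sum_congr rfl fun L _ => by
      rw [MeshData.trans]; ring
  have c2 : ∑ K, ∑ k ∈ m.extFaces K, m.extArea k / m.extDist k *
      (D.diss (s K) 1 (l K) 0 (g K) 0 / 2) =
      1 / 2 * ∑ K, ∑ k ∈ m.extFaces K, m.extTrans k * D.diss (s K) 1 (l K) 0 (g K) 0 := by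
    simp only [Finset.mul_sum]
    exact Finset.sum_congr rfl fun K _ => Finset.sum_congr rfl fun k _ => by
      rw [MeshData.extTrans]; ring
  -- Dirichlet faces carry half of their dissipation and interior ones only a quarter; the surplus
  -- is nonnegative and is dropped.
  have d2 : 0 ≤ ∑ K, ∑ k ∈ m.extFaces K, m.extTrans k * D.diss (s K) 1 (l K) 0 (g K) 0 :=
    Finset.sum_nonneg fun _ _ => Finset.sum_nonneg fun _ _ =>
      mul_nonneg (hm.extTrans_nonneg _) (hD.diss_nonneg _ _ _ _ _ _)
  rw [c1] at s1
  rw [c2] at s2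
  rw [show (1 : ℝ) - 1 = bdrySat .g by simp [bdrySat], show (1 : ℝ) = bdrySat .l from rfl] at s2
  rw [show (1 : ℝ) = bdrySat .l from rfl] at d2 hdiss
  simp only [bdrySat] at *
  linarith

/-- The artificial global pressure, normalized to vanish on the Dirichlet boundary. -/
def _root_.TwoPhase.FlowData.globalPressure (D : FlowData ℓ) (l s : ℝ) : ℝ :=
  l + D.pBar s - D.pBar 1

/-- The normalized global pressure vanishes for the exterior state, so the Poincaré inequality
applies, and its energy is bounded face by face by the dissipation. -/
theorem exists_sum_globalPressure_sq_le (hD : D.Assumptions) {ξ : ℝ} (hξ : 0 < ξ) :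
    ∃ C : ℝ, 0 < C ∧ ∀ (ι κ : Type) [Fintype ι] [Fintype κ] (m : MeshData ℓ ι κ)
      (s l g : ι → ℝ), m.IsAdmissible D.Ω D.Γ ξ → (∀ K, s K ∈ Icc (0 : ℝ) 1) →
      (∀ K, D.pc (s K) = g K - l K) →
      ∑ K, m.vol K * D.globalPressure (l K) (s K) ^ 2 ≤ C * D.stateDiss m s l g := by
  obtain ⟨C, hC, hP⟩ := exists_poincare_l2 hξ hD.isOpen_Ω hD.isBounded_Ω
    hD.isConnected_Ω.isPreconnected hD.Γ_subset_closure hD.Γ_measurable hD.Γ_pos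
  obtain ⟨C', hC', hface⟩ := hD.exists_face_estimate
  refine ⟨C * C', by positivity, fun ι κ _ _ m s l g hm hs hpc => ?_⟩
  refine (hP ι κ m _ hm).trans ?_
  rw [mul_assoc]
  refine mul_le_mul_of_nonneg_left ?_ hC.le
  refine hm.faceSum_le (C := C')
    (f := fun K L => (D.globalPressure (l L) (s L) - D.globalPressure (l K) (s K)) ^ 2)
    (h := fun K => D.globalPressure (l K) (s K) ^ 2) (fun K L => ?_) (fun K => ?_)
  · have h := (hface (s K) (hs K) (s L) (hs L) (l K) (l L) (g K) (g L) (hpc K) (hpc L)).2.2.2.1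
    refine (le_of_eq ?_).trans h
    simp only [globalPressure]; ring
  · have h := (hface (s K) (hs K) 1 one_mem (l K) 0 (g K) 0 (hpc K)
      (by rw [hD.pc_one, sub_zero])).2.2.2.1
    refine (le_of_eq ?_).trans h
    simp only [globalPressure]; ring

/-- By `exists_fraction` between `s` and `1`, the liquid pressure differs from the normalized global
pressure by `θ * pc s`. The gas pressure adds one more `pc s`. -/
theorem abs_pressure_le (hD : D.Assumptions) {l g s : ℝ} (hs : s ∈ Icc (0 : ℝ) 1)
    (hpc : D.pc s = g - l) :
    |l| ≤ |D.globalPressure l s| + D.pc 0 ∧ |g| ≤ |D.globalPressure l s| + 2 * D.pc 0 := by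
  obtain ⟨m₀, _, hm₀⟩ := hD.M_lower
  obtain ⟨θ, h0, h1, hb, _⟩ := hD.exists_fraction hm₀ hs one_mem
  have h2 := hD.pc_nonneg s hs
  have h3 := hD.pc_le hs
  rw [hD.pc_one, zero_sub] at hb
  have hl : |l| ≤ |D.globalPressure l s| + D.pc 0 := by
    have e : l = D.globalPressure l s + -(θ * D.pc s) := by
      rw [globalPressure]; linarith
    have h4 : |-(θ * D.pc s)| ≤ D.pc 0 := by
      rw [abs_neg, abs_of_nonneg (mul_nonneg h0 h2)]
      nlinarith
    calc |l| = |D.globalPressure l s + -(θ * D.pc s)| := by rw [← e]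
      _ ≤ _ := (abs_add_le _ _).trans (by linarith)
  refine ⟨hl, ?_⟩
  have e : g = l + D.pc s := by linarith
  have h5 := abs_add_le l (D.pc s)
  rw [abs_of_nonneg h2, ← e] at h5
  linarith

end Assumptions

end FlowData

end TwoPhase

end

/-! ### The discrete energy estimate. -/

open scoped MeasureTheory RealInnerProductSpace ENNReal

noncomputable section

set_option linter.unusedSectionVars false

namespace TwoPhase

open MeasureTheory Set

namespace FlowData

variable {ℓ : ℕ} {D : FlowData ℓ}

namespace Assumptions

theorem source_le (hD : D.Assumptions) {ρm ρM : ℝ} (hρm : 0 < ρm)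
    (hρ : ∀ α p, ρm ≤ D.ρ α p ∧ D.ρ α p ≤ ρM) (α : Phase) {p s sI fP fI : ℝ}
    (hs : s ∈ Icc (0 : ℝ) 1) (hsI : sI ∈ Icc (0 : ℝ) 1) (hfP : 0 ≤ fP) (hfI : 0 ≤ fI) :
    D.ρ α p * (sI * fI - s * fP) * D.kirchhoff α p ≤ ρM * (1 / ρm) * (fP + fI) * |p| := by
  have h1 := hD.abs_kirchhoff_le α hρm (fun p => (hρ α p).1) p
  have h2 : |sI * fI - s * fP| ≤ fP + fI := by
    have a1 := mul_nonneg hsI.1 hfI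
    have a2 := mul_nonneg hs.1 hfP
    have a3 := mul_le_of_le_one_left hfI hsI.2
    have a4 := mul_le_of_le_one_left hfP hs.2
    rw [abs_le]
    constructor <;> linarith
  have h3 := (hD.ρ_pos α p).le
  have h4 := (hρ α p).2
  have h5 : 0 ≤ ρM := h3.trans h4
  calc _ ≤ |D.ρ α p * (sI * fI - s * fP) * D.kirchhoff α p| := le_abs_self _
    _ = D.ρ α p * |sI * fI - s * fP| * |D.kirchhoff α p| := by
        rw [abs_mul, abs_mul, abs_of_nonneg h3]
    _ ≤ ρM * (fP + fI) * (1 / ρm * |p|) := by gcongr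
    _ = _ := by ring

theorem young_source {B f u P ε : ℝ} (hε : 0 < ε) :
    B * f * (2 * |u| + 3 * P) ≤ ε * u ^ 2 + (B ^ 2 / ε + B ^ 2) * f ^ 2 + 9 / 4 * P ^ 2 := by
  have e : ε * u ^ 2 + (B ^ 2 / ε + B ^ 2) * f ^ 2 + 9 / 4 * P ^ 2 - B * f * (2 * |u| + 3 * P) =
      ε * (|u| - B * f / ε) ^ 2 + (B * f - 3 / 2 * P) ^ 2 := by
    rw [← sq_abs u]; field_simp; ring
  rw [← sub_nonneg, e]
  positivity

/-- The energy inequality for one time step. -/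
theorem exists_step_estimate (hD : D.Assumptions) (hℓ : 1 ≤ ℓ) {ξ : ℝ} (hξ : 0 < ξ) :
    ∃ C₁ C₂ : ℝ, 0 < C₁ ∧ 0 < C₂ ∧ ∀ (ι κ : Type) [Fintype ι] [Fintype κ] (m : MeshData ℓ ι κ)
      (N : ℕ) (p s : Phase → ℕ → ι → ℝ), m.IsAdmissible D.Ω D.Γ ξ → D.IsSchemeSolution m N p s →
      ∀ n ≤ N, ∑ K, m.vol K * spaceMean m K D.φ *
          (D.freeEnergy (p .l (n + 1) K) (p .g (n + 1) K) (s .l (n + 1) K) (s .g (n + 1) K) -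
            D.freeEnergy (p .l n K) (p .g n K) (s .l n K) (s .g n K)) +
          D.timeStep N * (D.stateDiss m (s .l (n + 1)) (p .l (n + 1)) (p .g (n + 1)) / 8) ≤
        D.timeStep N * (C₁ + C₂ * ∑ K, m.vol K *
          (D.spaceTimeMean m N n K D.fP ^ 2 + D.spaceTimeMean m N n K D.fI ^ 2)) := by
  obtain ⟨C, hC, hflux⟩ := hD.exists_sum_outFlux_ge hℓ hξ
  obtain ⟨C', hC', hpres⟩ := hD.exists_sum_globalPressure_sq_le hξ
  obtain ⟨ρm, ρM, hρm, hρM, hρ⟩ := hD.ρ_bounds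
  set B := ρM * (1 / ρm) with hB
  have hB0 : 0 < B := by positivity
  -- With this `ε` the Poincaré inequality bounds the source contribution by an eighth of the
  -- dissipation, half of the quarter left by the fluxes.
  set ε := 1 / (8 * C') with hε
  have hε0 : 0 < ε := by positivity
  set P := D.pc 0 with hP
  have hv : 0 ≤ volume.real D.Ω := measureReal_nonneg
  set C₂ := B ^ 2 / ε + B ^ 2 with hC₂
  have hC₂0 : 0 < C₂ := by positivity
  refine ⟨C + 9 / 4 * P ^ 2 * volume.real D.Ω, 2 * C₂, by positivity, by positivity, ?_⟩
  intro ι κ _ _ m N p s hm hsol n hn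
  have hδ := hD.timeStep_pos N
  have hmem : ∀ K, s .l (n + 1) K ∈ Icc (0 : ℝ) 1 := hD.saturation_mem hm hsol (by omega)
  have hg : s .g (n + 1) = fun K => 1 - s .l (n + 1) K := by
    ext K
    have := hD.saturation_add hm hsol (n := n + 1) (by omega) K
    linarith
  have hcap := hsol.capillary n hn
  have hfl := hflux ι κ m (s .l (n + 1)) (p .l (n + 1)) (p .g (n + 1)) hm hmem hcap
  have hpr := hpres ι κ m (s .l (n + 1)) (p .l (n + 1)) (p .g (n + 1)) hm hmem hcap
  rw [← hg] at hfl
  set S := D.stateDiss m (s .l (n + 1)) (p .l (n + 1)) (p .g (n + 1)) with hS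
  set δ := D.timeStep N with hδdef
  set fP := fun K => D.spaceTimeMean m N n K D.fP with hfP
  set fI := fun K => D.spaceTimeMean m N n K D.fI with hfI
  set u := fun K => D.globalPressure (p .l (n + 1) K) (s .l (n + 1) K) with hu
  obtain ⟨φ₀, φ₁, hφ₀, _, hφ⟩ := hD.φ_bounds
  have hcell : ∀ K, m.vol K * spaceMean m K D.φ *
      (D.freeEnergy (p .l (n + 1) K) (p .g (n + 1) K) (s .l (n + 1) K) (s .g (n + 1) K) -
        D.freeEnergy (p .l n K) (p .g n K) (s .l n K) (s .g n K)) +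
      δ * (D.outFlux m .l (s .l (n + 1)) (p .l (n + 1)) K * D.kirchhoff .l (p .l (n + 1) K) +
        D.outFlux m .g (s .g (n + 1)) (p .g (n + 1)) K * D.kirchhoff .g (p .g (n + 1) K)) ≤
      δ * (m.vol K * (ε * u K ^ 2 + C₂ * (fP K + fI K) ^ 2 + 9 / 4 * P ^ 2)) := by
    intro K
    have hvK := hm.vol_pos K
    have hφK := hφ₀.trans_le (spaceMean_mem hm K hD.φ_meas hφ).1
    have hbl := hsol.balance n hn .l K
    have hbg := hsol.balance n hn .g K
    have hE := hD.freeEnergy_sub_le (ql := p .l n K) (qg := p .g n K) (hmem K)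
      (hD.saturation_mem hm hsol (n := n) (by omega) K)
      (hD.saturation_nonneg hm hsol .g n (by omega) K)
      (hD.saturation_add hm hsol (n := n + 1) (by omega) K)
      (hD.saturation_add hm hsol (n := n) (by omega) K) (hcap K)
    have hE' := mul_le_mul_of_nonneg_left hE (mul_pos hvK hφK).le
    have hfP0 : 0 ≤ fP K := hD.spaceTimeMean_nonneg hm hn K hD.fP_nonneg
    have hfI0 : 0 ≤ fI K := hD.spaceTimeMean_nonneg hm hn K hD.fI_nonneg
    have hmemg : s .g (n + 1) K ∈ Icc (0 : ℝ) 1 := by rw [hg]; exact one_sub_mem (hmem K)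
    have sl := hD.source_le hρm hρ .l (p := p .l (n + 1) K) (hmem K)
      (hD.spaceTimeMean_sI_mem hm hn .l K) hfP0 hfI0
    have sg := hD.source_le hρm hρ .g (p := p .g (n + 1) K) hmemg
      (hD.spaceTimeMean_sI_mem hm hn .g K) hfP0 hfI0
    obtain ⟨hpl, hpg⟩ := hD.abs_pressure_le (hmem K) (hcap K)
    have hy := young_source (B := B) (f := fP K + fI K) (u := u K) (P := P) hε0
    have hBf : 0 ≤ B * (fP K + fI K) := by positivity
    -- The coefficients `2` and `3` add up the bounds on the two pressures: `|u| + P` for the liquid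
    -- and `|u| + 2P` for the gas.
    have hsrc : B * (fP K + fI K) * |p .l (n + 1) K| + B * (fP K + fI K) * |p .g (n + 1) K| ≤
        B * (fP K + fI K) * (2 * |u K| + 3 * P) := by
      rw [← mul_add]
      exact mul_le_mul_of_nonneg_left (by linarith) hBf
    have htot := mul_le_mul_of_nonneg_left ((add_le_add sl sg).trans (hsrc.trans hy))
      (mul_pos hδ hvK).le
    have hbal : ∀ α, m.vol K * spaceMean m K D.φ *
        ((D.ρ α (p α (n + 1) K) * s α (n + 1) K - D.ρ α (p α n K) * s α n K) / δ) +
        D.outFlux m α (s α (n + 1)) (p α (n + 1)) K +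
        m.vol K * D.ρ α (p α (n + 1) K) * s α (n + 1) K * fP K =
        m.vol K * D.ρ α (p α (n + 1) K) * D.spaceTimeMean m N n K (D.sI α) * fI K := by
      intro α
      rw [outFlux, ← add_assoc]
      exact hsol.balance n hn α K
    have hbal' : ∀ α, m.vol K * spaceMean m K D.φ *
        ((D.ρ α (p α (n + 1) K) * s α (n + 1) K - D.ρ α (p α n K) * s α n K) *
          D.kirchhoff α (p α (n + 1) K)) +
        δ * (D.outFlux m α (s α (n + 1)) (p α (n + 1)) K * D.kirchhoff α (p α (n + 1) K)) =
        δ * m.vol K * (D.ρ α (p α (n + 1) K) * (D.spaceTimeMean m N n K (D.sI α) * fI K -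
          s α (n + 1) K * fP K) * D.kirchhoff α (p α (n + 1) K)) := by
      intro α
      have h := hbal α
      field_simp at h
      linear_combination D.kirchhoff α (p α (n + 1) K) * h
    have h1 := hbal' .l
    have h2 := hbal' .g
    linarith
  have hsum := Finset.sum_le_sum fun K (_ : K ∈ Finset.univ) => hcell K
  rw [Finset.sum_add_distrib, ← Finset.mul_sum, ← Finset.mul_sum] at hsum
  have hfl' := mul_le_mul_of_nonneg_left hfl hδ.le
  have hright : ∑ K, m.vol K * (ε * u K ^ 2 + C₂ * (fP K + fI K) ^ 2 + 9 / 4 * P ^ 2) ≤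
      S / 8 + 2 * C₂ * ∑ K, m.vol K * (fP K ^ 2 + fI K ^ 2) + 9 / 4 * P ^ 2 * volume.real D.Ω := by
    have e1 : ∑ K, m.vol K * (ε * u K ^ 2) ≤ S / 8 := by
      have : ∑ K, m.vol K * (ε * u K ^ 2) = ε * ∑ K, m.vol K * u K ^ 2 := by
        rw [Finset.mul_sum]; exact Finset.sum_congr rfl fun K _ => by ring
      rw [this]
      refine (mul_le_mul_of_nonneg_left hpr hε0.le).trans (le_of_eq ?_)
      rw [hε]; field_simp
    have e2 : ∑ K, m.vol K * (C₂ * (fP K + fI K) ^ 2) ≤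
        2 * C₂ * ∑ K, m.vol K * (fP K ^ 2 + fI K ^ 2) := by
      rw [Finset.mul_sum]
      refine Finset.sum_le_sum fun K _ => ?_
      have h1 : (fP K + fI K) ^ 2 ≤ 2 * (fP K ^ 2 + fI K ^ 2) := by
        nlinarith [sq_nonneg (fP K - fI K)]
      have h2 := mul_le_mul_of_nonneg_left h1 (mul_nonneg (m.vol_nonneg K) hC₂0.le)
      linarith
    have e3 : ∑ K, m.vol K * (9 / 4 * P ^ 2) = 9 / 4 * P ^ 2 * volume.real D.Ω := by
      rw [← Finset.sum_mul, hm.sum_vol, mul_comm]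
    simp only [mul_add, Finset.sum_add_distrib] at e1 e2 e3 ⊢
    linarith
  have hright' := mul_le_mul_of_nonneg_left hright hδ.le
  linarith

/-- The energy estimate: the dissipation is bounded independently of the mesh and the time step. -/
theorem exists_energy_estimate (hD : D.Assumptions) (hℓ : 1 ≤ ℓ) {ξ : ℝ} (hξ : 0 < ξ) :
    ∃ C : ℝ, 0 < C ∧ ∀ (ι κ : Type) [Fintype ι] [Fintype κ] (m : MeshData ℓ ι κ)
      (N : ℕ) (p s : Phase → ℕ → ι → ℝ), m.IsAdmissible D.Ω D.Γ ξ → D.IsSchemeSolution m N p s →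
      ∑ n ∈ Finset.range (N + 1), D.timeStep N *
        D.stateDiss m (s .l (n + 1)) (p .l (n + 1)) (p .g (n + 1)) ≤ C := by
  obtain ⟨C₁, C₂, hC₁, hC₂, hstep⟩ := hD.exists_step_estimate hℓ hξ
  obtain ⟨ρm, ρM, hρm, hρM, hρ⟩ := hD.ρ_bounds
  obtain ⟨φ₀, φ₁, hφ₀, hφ₁, hφ⟩ := hD.φ_bounds
  set A := ρM * (1 / ρm) + 1 with hA
  have hA0 : 0 < A := by positivity
  have hv : 0 ≤ volume.real D.Ω := measureReal_nonneg
  set P := D.pc 0 with hP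
  have hP0 : 0 ≤ P := hD.pc_nonneg 0 zero_mem
  set Il := ∫ x in D.Ω, |D.p0 .l x| with hIl
  set Ig := ∫ x in D.Ω, |D.p0 .g x| with hIg
  have hIl0 : 0 ≤ Il := integral_nonneg fun _ => abs_nonneg _
  have hIg0 : 0 ≤ Ig := integral_nonneg fun _ => abs_nonneg _
  set JP := ∫ z, D.fP z ^ 2 ∂D.cylinderMeasure with hJP
  set JI := ∫ z, D.fI z ^ 2 ∂D.cylinderMeasure with hJI
  have hJP0 : 0 ≤ JP := integral_nonneg fun _ => sq_nonneg _
  have hJI0 : 0 ≤ JI := integral_nonneg fun _ => sq_nonneg _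
  have hT := hD.T_pos
  refine ⟨8 * (D.T * C₁ + C₂ * (JP + JI) + φ₁ * (A * (Il + Ig) + P * volume.real D.Ω)),
    by positivity, ?_⟩
  intro ι κ _ _ m N p s hm hsol
  set Φ : ℕ → ℝ := fun n => ∑ K, m.vol K * spaceMean m K D.φ *
    D.freeEnergy (p .l n K) (p .g n K) (s .l n K) (s .g n K) with hΦ
  have hw : ∀ K, 0 ≤ m.vol K * spaceMean m K D.φ ∧ m.vol K * spaceMean m K D.φ ≤ φ₁ * m.vol K := by
    intro K
    have h := spaceMean_mem hm K hD.φ_meas hφ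
    have hvK := (hm.vol_pos K).le
    refine ⟨mul_nonneg hvK (hφ₀.le.trans h.1), ?_⟩
    rw [mul_comm]
    exact mul_le_mul_of_nonneg_right h.2 hvK
  have hΦsub : ∀ n, ∑ K, m.vol K * spaceMean m K D.φ *
      (D.freeEnergy (p .l (n + 1) K) (p .g (n + 1) K) (s .l (n + 1) K) (s .g (n + 1) K) -
        D.freeEnergy (p .l n K) (p .g n K) (s .l n K) (s .g n K)) = Φ (n + 1) - Φ n := by
    intro n
    simp only [hΦ, mul_sub, Finset.sum_sub_distrib]
  have hsum := Finset.sum_le_sum fun n (hn : n ∈ Finset.range (N + 1)) =>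
    hstep ι κ m N p s hm hsol n (Nat.lt_succ_iff.1 (Finset.mem_range.1 hn))
  simp only [hΦsub] at hsum
  rw [Finset.sum_add_distrib, Finset.sum_range_sub Φ (N + 1)] at hsum
  -- After telescoping only the two end energies remain. The entropies are nonnegative, so the final
  -- energy is bounded below by the capillary part alone.
  have hlow : -(φ₁ * (P * volume.real D.Ω)) ≤ Φ (N + 1) := by
    rw [← hm.sum_vol, hΦ, Finset.mul_sum, Finset.mul_sum, ← Finset.sum_neg_distrib]
    refine Finset.sum_le_sum fun K _ => ?_
    have hmem := hD.saturation_mem hm hsol (n := N + 1) le_rfl K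
    have hgn := hD.saturation_nonneg hm hsol .g (N + 1) le_rfl K
    have h1 := mul_nonneg (hD.entropy_nonneg .l (p .l (N + 1) K)) hmem.1
    have h2 := mul_nonneg (hD.entropy_nonneg .g (p .g (N + 1) K)) hgn
    have h3 := (hD.capEnergy_bounds hmem).2
    have h4 : -P ≤ D.freeEnergy (p .l (N + 1) K) (p .g (N + 1) K) (s .l (N + 1) K)
        (s .g (N + 1) K) := by
      rw [freeEnergy]; linarith
    have h5 := mul_le_mul_of_nonneg_left h4 (hw K).1
    have h6 := mul_le_mul_of_nonneg_right (hw K).2 hP0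
    linarith
  -- The entropy grows at most linearly in the pressure, so the `L¹` norms of the initial pressures
  -- bound the initial energy.
  have hup : Φ 0 ≤ φ₁ * (A * (Il + Ig)) := by
    have hl := hD.sum_vol_mul_abs_p0_le hm .l
    have hg := hD.sum_vol_mul_abs_p0_le hm .g
    have h1 : Φ 0 ≤ ∑ K, φ₁ * (A * (m.vol K * |spaceMean m K (D.p0 .l)| +
        m.vol K * |spaceMean m K (D.p0 .g)|)) := by
      refine Finset.sum_le_sum fun K _ => ?_
      have hmem := hD.saturation_mem hm hsol (n := 0) (by omega) K
      have hgn := hD.saturation_nonneg hm hsol .g 0 (by omega) K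
      have hadd := hD.saturation_add hm hsol (n := 0) (by omega) K
      have h2 := mul_le_of_le_one_right (hD.entropy_nonneg .l (p .l 0 K)) hmem.2
      have h3 := mul_le_of_le_one_right (hD.entropy_nonneg .g (p .g 0 K))
        (by linarith [hmem.1] : s .g 0 K ≤ 1)
      have h4 := (hD.capEnergy_bounds hmem).1
      have h5 := hD.entropy_le .l hρm (fun p => (hρ .l p).1) (fun p => (hρ .l p).2) (p .l 0 K)
      have h6 := hD.entropy_le .g hρm (fun p => (hρ .g p).1) (fun p => (hρ .g p).2) (p .g 0 K)
      have h7 : D.freeEnergy (p .l 0 K) (p .g 0 K) (s .l 0 K) (s .g 0 K) ≤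
          A * (|p .l 0 K| + |p .g 0 K|) := by
        rw [freeEnergy]; linarith
      have h8 := mul_le_mul_of_nonneg_left h7 (hw K).1
      have h9 := mul_le_mul_of_nonneg_right (hw K).2
        (by positivity : 0 ≤ A * (|p .l 0 K| + |p .g 0 K|))
      rw [← hsol.init_p, ← hsol.init_p]
      linarith
    refine h1.trans ?_
    rw [← Finset.mul_sum, ← Finset.mul_sum, Finset.sum_add_distrib]
    gcongr
  have hsrc : ∑ n ∈ Finset.range (N + 1), D.timeStep N * (C₁ + C₂ * ∑ K, m.vol K *
      (D.spaceTimeMean m N n K D.fP ^ 2 + D.spaceTimeMean m N n K D.fI ^ 2)) ≤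
      D.T * C₁ + C₂ * (JP + JI) := by
    have h1 := hD.sum_spaceTimeMean_sq_le hm N hD.fP_memLp
    have h2 := hD.sum_spaceTimeMean_sq_le hm N hD.fI_memLp
    have e : ∑ n ∈ Finset.range (N + 1), D.timeStep N * (C₁ + C₂ * ∑ K, m.vol K *
        (D.spaceTimeMean m N n K D.fP ^ 2 + D.spaceTimeMean m N n K D.fI ^ 2)) =
        D.T * C₁ + C₂ * (∑ n ∈ Finset.range (N + 1), D.timeStep N *
          ∑ K, m.vol K * D.spaceTimeMean m N n K D.fP ^ 2 +
          ∑ n ∈ Finset.range (N + 1), D.timeStep N *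
          ∑ K, m.vol K * D.spaceTimeMean m N n K D.fI ^ 2) := by
      rw [← Finset.sum_add_distrib, Finset.mul_sum, ← timeStep_mul (D := D) N]
      simp only [mul_add (m.vol _), Finset.sum_add_distrib, mul_add, Finset.sum_const,
        Finset.card_range, nsmul_eq_mul]
      push_cast
      simp only [mul_left_comm C₂]
      ring
    rw [e]
    gcongr
  have h8 : ∑ n ∈ Finset.range (N + 1), D.timeStep N *
      (D.stateDiss m (s .l (n + 1)) (p .l (n + 1)) (p .g (n + 1)) / 8) =
      (∑ n ∈ Finset.range (N + 1), D.timeStep N *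
        D.stateDiss m (s .l (n + 1)) (p .l (n + 1)) (p .g (n + 1))) / 8 := by
    rw [Finset.sum_div]
    exact Finset.sum_congr rfl fun n _ => by ring
  rw [h8] at hsum
  linarith

end Assumptions

end FlowData

end TwoPhase

end

/-! ### The three seminorm bounds. -/

theorem corollary5p3 {ℓ : ℕ} (hℓ : 1 ≤ ℓ) (D : TwoPhase.FlowData ℓ) (hD : D.Assumptions)
    (ξ : ℝ) (hξ : 0 < ξ) :
    ∃ C : ℝ, 0 < C ∧
      ∀ (ι κ : Type) [Fintype ι] [Fintype κ] (m : TwoPhase.MeshData ℓ ι κ) (N : ℕ)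
        (p s : TwoPhase.Phase → ℕ → ι → ℝ),
        m.IsAdmissible D.Ω D.Γ ξ → D.IsSchemeSolution m N p s →
          D.discreteSeminorm m N s D.calB ≤ C ∧
          D.weightedSeminorm m N p s .l D.pBar ≤ C ∧
          D.weightedSeminorm m N p s .g D.pTilde ≤ C := by
  obtain ⟨C, hC, henergy⟩ := hD.exists_energy_estimate hℓ hξ
  obtain ⟨C', hC', hface⟩ := hD.exists_face_estimate
  refine ⟨C' * C, by positivity, fun ι κ _ _ m N p s hm hsol => ?_⟩
  -- Any face quantity bounded pointwise by the dissipation inherits the energy estimate; the three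
  -- seminorms are instances.
  have key : ∀ (f : ℕ → ι → ι → ℝ) (h : ℕ → ι → ℝ),
      (∀ n ≤ N, (∀ K L, f n K L ≤ C' * D.diss (s .l (n + 1) K) (s .l (n + 1) L)
        (p .l (n + 1) K) (p .l (n + 1) L) (p .g (n + 1) K) (p .g (n + 1) L)) ∧
        ∀ K, h n K ≤ C' * D.diss (s .l (n + 1) K) 1 (p .l (n + 1) K) 0 (p .g (n + 1) K) 0) →
      ∑ n ∈ Finset.range (N + 1), D.timeStep N * m.faceSum (f n) (h n) ≤ C' * C := by
    intro f h hfh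
    refine le_trans ?_ (mul_le_mul_of_nonneg_left (henergy ι κ m N p s hm hsol) hC'.le)
    rw [Finset.mul_sum]
    refine Finset.sum_le_sum fun n hn => ?_
    obtain ⟨h1, h2⟩ := hfh n (Nat.lt_succ_iff.1 (Finset.mem_range.1 hn))
    rw [mul_left_comm]
    exact mul_le_mul_of_nonneg_left (hm.faceSum_le h1 h2) (hD.timeStep_pos N).le
  have hmem : ∀ n ≤ N, ∀ K, s .l (n + 1) K ∈ Set.Icc (0 : ℝ) 1 := fun n hn =>
    hD.saturation_mem hm hsol (by omega)
  have hg : ∀ n ≤ N, ∀ K, s .g (n + 1) K = 1 - s .l (n + 1) K := fun n hn K => by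
    linarith [hsol.saturated n hn K]
  have hint := fun n (hn : n ≤ N) K L => hface _ (hmem n hn K) _ (hmem n hn L) _ _ _ _
    (hsol.capillary n hn K) (hsol.capillary n hn L)
  have hext := fun n (hn : n ≤ N) K => hface _ (hmem n hn K) 1
    TwoPhase.FlowData.Assumptions.one_mem _ 0 _ 0 (hsol.capillary n hn K)
    (by rw [hD.pc_one, sub_zero])
  refine ⟨?_, ?_, ?_⟩
  · exact key (fun n K L => (D.calB (s .l (n + 1) L) - D.calB (s .l (n + 1) K)) ^ 2)
      (fun n K => (D.calB 1 - D.calB (s .l (n + 1) K)) ^ 2)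
      fun n hn => ⟨fun K L => (hint n hn K L).1, fun K => (hext n hn K).1⟩
  · have h := key (fun n K L => D.upwindM .l (s .l (n + 1) K) (s .l (n + 1) L)
        (p .l (n + 1) K) (p .l (n + 1) L) *
        (D.pBar (s .l (n + 1) L) - D.pBar (s .l (n + 1) K)) ^ 2)
      (fun n K => D.upwindM .l (s .l (n + 1) K) 1 (p .l (n + 1) K) 0 *
        (D.pBar 1 - D.pBar (s .l (n + 1) K)) ^ 2)
      fun n hn => ⟨fun K L => (hint n hn K L).2.1, fun K => (hext n hn K).2.1⟩
    simp only [TwoPhase.MeshData.faceSum, ← mul_assoc] at h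
    simpa only [TwoPhase.FlowData.weightedSeminorm, TwoPhase.FlowData.bdrySat, ← mul_assoc] using h
  · have h := key (fun n K L => D.upwindM .g (s .g (n + 1) K) (s .g (n + 1) L)
        (p .g (n + 1) K) (p .g (n + 1) L) *
        (D.pTilde (s .l (n + 1) L) - D.pTilde (s .l (n + 1) K)) ^ 2)
      (fun n K => D.upwindM .g (s .g (n + 1) K) 0 (p .g (n + 1) K) 0 *
        (D.pTilde 1 - D.pTilde (s .l (n + 1) K)) ^ 2)
      fun n hn => ⟨fun K L => by
          rw [hg n hn K, hg n hn L]; exact (hint n hn K L).2.2.1,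
        fun K => by
          rw [hg n hn K, show (0 : ℝ) = 1 - 1 by norm_num]
          simpa using (hext n hn K).2.2.1⟩
    simp only [TwoPhase.MeshData.faceSum, ← mul_assoc] at h
    simpa only [TwoPhase.FlowData.weightedSeminorm, TwoPhase.FlowData.bdrySat, ← mul_assoc] using h
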